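/- Let $M$ be a smooth $n$-dimensional manifold (Hausdorff, second countable, without boundary), let $2\le p<\infty$, and let $g$ be a continuous Riemannian metric on $M$ of class $W^{1,p}_{\mathrm{loc}}$ (its components in every smooth chart lie in $W^{1,p}_{\mathrm{loc}}$). *Regularisation.* Let $(U_i,\psi_i)_{i\in\mathbb N}$ be a locally finite cover of $M$ by relatively compact smooth charts with $\psi_i(U_i)\subseteq B_1(0)\subset\mathbb R^n$, let $(\eta_i)$ be a smooth partition of unity with $\operatorname{supp}\eta_i\subseteq U_i$, and let $\chi_i\in C_c^\infty(U_i)$ with $\chi_i\equiv1$ on a neighbourhood of $\operatorname{supp}\eta_i$. Let $\rho:\mathbb R^n\to[0,\infty)$ be smooth, supported in the closed unit ball, with $\int\rho=1$, and $\rho_\varepsilon(x)=\varepsilon^{-n}\rho(x/\varepsilon)$. For a distribution or continuous tensor field $\mathcal T$ put $$\mathcal T\star_M\rho_\varepsilon(x)=\sum_i\chi_i(x)\,(\psi_i)^*\big[((\psi_i)_*(\eta_i\mathcal T))*\rho_\varepsilon\big](x),$$ the convolution being taken componentwise on $\mathbb R^n$. *Scalar curvature.* In a chart $(U,\psi)$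 let $\Gamma^k_{ij}=\tfrac12 g^{kl}(\partial_i g_{jl}+\partial_j g_{il}-\partial_l g_{ij})$ with weak derivatives, and $$V^k=g^{ij}\Gamma^k_{ij}-g^{ik}\Gamma^j_{ij},\qquad F=-(\partial_m g^{ij})\Gamma^m_{ij}+(\partial_j g^{ij})\Gamma^m_{im}+g^{ij}\Gamma^m_{ij}\Gamma^k_{km}-g^{ij}\Gamma^m_{ik}\Gamma^k_{jm}.$$ The distributional scalar curvature $R[g]\in\mathcal D'(M)$ is the distribution that is given in each chart by $R[g]=\partial_kV^k+F$, i.e. $\langle R[g],f\,|dx^1\wedge\dots\wedge dx^n|\rangle=\int_{\psi(U)}(-V^k\partial_kf+Ff)\,dx$ for test functions $f$. For a smooth metric $R$ denotes the usual scalar curvature function. *Claim.* The tensor fields $g\star_M\rho_\varepsilon$, $\varepsilon\in(0,1]$, are smooth; for every compact $K\subseteq M$ and all sufficiently small $\varepsilon>0$ (depending on $K$), $g\star_M\rho_\varepsilon$ is symmetric and positive definite at every point of $K$, so that $R[g\star_M\rho_\varepsilon]$ is defined there; and $$R[g]\star_M\rho_\varepsilon-R[g\star_M\rho_\varepsilon]\longrightarrow0\quad\text{in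 }L^{p/2}_{\mathrm{loc}}(M)\text{ as }\varepsilon\downarrow0,$$ that is, for every compact subset $K$ of the image of a smooth chart $\psi$, the difference read in that chart belongs to $L^{p/2}(K)$ for all small $\varepsilon>0$, and its $L^{p/2}(K)$ norm tends to $0$. -/

import Mathlib

open Set Filter Topology MeasureTheory TopologicalSpace Bundle
open scoped Manifold ContDiff ENNReal Distributions LineDeriv

noncomputable section

namespace LowRegScal

/-- The model space `ℝⁿ` with its Euclidean norm. -/
abbrev Eu (n : ℕ) : Type := EuclideanSpace ℝ (Fin n)

/-- The `a`-th standard basis vector of `ℝⁿ`. -/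
def stdVec {n : ℕ} (a : Fin n) : Eu n := EuclideanSpace.single a 1

/-! ### Local function spaces and distributions on open subsets of `ℝⁿ` -/

section Euclidean

variable {n : ℕ}

/-- `f ∈ L^q_loc(Ω)`. -/
def MemLpLoc (Ω : Opens (Eu n)) (q : ℝ≥0∞) (f : Eu n → ℝ) : Prop :=
  ∀ K : Set (Eu n), IsCompact K → K ⊆ Ω → MemLp f q (volume.restrict K)

/-- The distribution `φ ↦ ∫ φ f` on `Ω` defined by a locally integrable function `f`. -/
def distOf (Ω : Opens (Eu n)) (f : Eu n → ℝ) : 𝓓'(Ω, ℝ) :=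
  TestFunction.integralAgainstBilinCLM (ContinuousLinearMap.mul ℝ ℝ) volume f

/-- `w` is the weak partial derivative `∂_a f` on `Ω`: both functions are locally integrable on `Ω`
and `∂_a f = w` as distributions, i.e. `-∫ f ∂_a φ = ∫ w φ` for every test function `φ`. -/
def IsWeakPartial (Ω : Opens (Eu n)) (a : Fin n) (f w : Eu n → ℝ) : Prop :=
  LocallyIntegrableOn f Ω volume ∧ LocallyIntegrableOn w Ω volume ∧
    ∂_{stdVec a} (distOf Ω f) = distOf Ω w

open Classical in
/-- A representative of the weak partial derivative `∂_a f` on `Ω` (which is unique almost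
everywhere on `Ω`); the zero function if there is no weak partial derivative. -/
def weakPartial (Ω : Opens (Eu n)) (a : Fin n) (f : Eu n → ℝ) : Eu n → ℝ :=
  if h : ∃ w, IsWeakPartial Ω a f w then h.choose else 0

/-- `f ∈ W^{1,q}_loc(Ω)`. -/
def MemW1Loc (Ω : Opens (Eu n)) (q : ℝ≥0∞) (f : Eu n → ℝ) : Prop :=
  MemLpLoc Ω q f ∧ ∀ a : Fin n, ∃ w, MemLpLoc Ω q w ∧ IsWeakPartial Ω a f w

/-- The Christoffel symbol `Γᵏᵢⱼ = ½ gᵏˡ (∂ᵢ gⱼₗ + ∂ⱼ gᵢₗ - ∂ₗ gᵢⱼ)` of a metric with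
component matrix `G` whose components have partial derivatives `dG a i j = ∂ₐ gᵢⱼ`. -/
def christoffel (G : Matrix (Fin n) (Fin n) ℝ) (dG : Fin n → Fin n → Fin n → ℝ)
    (k i j : Fin n) : ℝ :=
  (1 / 2) * ∑ l, G⁻¹ k l * (dG i j l + dG j i l - dG l i j)

/-! ### Scalar curvature of a smooth metric in coordinates -/

/-- The classical partial derivative `∂_a f` at `y`. -/
def pderiv (a : Fin n) (f : Eu n → ℝ) (y : Eu n) : ℝ := fderiv ℝ f y (stdVec a)

/-- Classical Christoffel symbols of the metric with component functions `G`. -/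
def Gam (G : Eu n → Matrix (Fin n) (Fin n) ℝ) (k i j : Fin n) (y : Eu n) : ℝ :=
  christoffel (G y) (fun a i j => pderiv a (fun z => G z i j) y) k i j

/-- `Ricᵢⱼ = ∂ₘ Γᵐᵢⱼ - ∂ⱼ Γᵐᵢₘ + Γᵐₘₛ Γˢᵢⱼ - Γᵐⱼₛ Γˢᵢₘ`. -/
def ricci (G : Eu n → Matrix (Fin n) (Fin n) ℝ) (i j : Fin n) (y : Eu n) : ℝ :=
  ∑ m, (pderiv m (Gam G m i j) y - pderiv j (Gam G m i m) y)
    + ∑ m, ∑ s, (Gam G m m s y * Gam G s i j y - Gam G m j s y * Gam G s i m y)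

/-- `R = gⁱʲ Ricᵢⱼ`. -/
def coordScal (G : Eu n → Matrix (Fin n) (Fin n) ℝ) (y : Eu n) : ℝ :=
  ∑ i, ∑ j, (G y)⁻¹ i j * ricci G i j y

/-! ### Distributional scalar curvature in coordinates -/

/-- Christoffel symbols on `Ω` built with weak derivatives of the metric components. -/
def weakGam (Ω : Opens (Eu n)) (G : Eu n → Matrix (Fin n) (Fin n) ℝ) (k i j : Fin n)
    (y : Eu n) : ℝ :=
  christoffel (G y) (fun a i j => weakPartial Ω a (fun z => G z i j) y) k i j

/-- Weak derivatives `∂ₐ gⁱʲ` of the components of the inverse metric. -/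
def weakInv (Ω : Opens (Eu n)) (G : Eu n → Matrix (Fin n) (Fin n) ℝ) (a i j : Fin n) :
    Eu n → ℝ :=
  weakPartial Ω a (fun z => (G z)⁻¹ i j)

/-- `Vᵏ = gⁱʲ Γᵏᵢⱼ - gⁱᵏ Γʲᵢⱼ`. -/
def fieldV (Ω : Opens (Eu n)) (G : Eu n → Matrix (Fin n) (Fin n) ℝ) (k : Fin n) (y : Eu n) : ℝ :=
  ∑ i, ∑ j, ((G y)⁻¹ i j * weakGam Ω G k i j y - (G y)⁻¹ i k * weakGam Ω G j i j y)

/-- `F = -(∂ₘ gⁱʲ) Γᵐᵢⱼ + (∂ⱼ gⁱʲ) Γᵐᵢₘ + gⁱʲ Γᵐᵢⱼ Γᵏₖₘ - gⁱʲ Γᵐᵢₖ Γᵏⱼₘ`. -/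
def fieldF (Ω : Opens (Eu n)) (G : Eu n → Matrix (Fin n) (Fin n) ℝ) (y : Eu n) : ℝ :=
  ∑ i, ∑ j, ∑ m,
      (-(weakInv Ω G m i j y) * weakGam Ω G m i j y + weakInv Ω G j i j y * weakGam Ω G m i m y)
    + ∑ i, ∑ j, ∑ m, ∑ k, (G y)⁻¹ i j *
      (weakGam Ω G m i j y * weakGam Ω G k k m y - weakGam Ω G m i k y * weakGam Ω G k j m y)

/-- The distributional scalar curvature `∂ₖ Vᵏ + F ∈ 𝓓'(Ω)`, that is,
`φ ↦ ∫_Ω (-Vᵏ ∂ₖ φ + F φ)`. -/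
def distScal (Ω : Opens (Eu n)) (G : Eu n → Matrix (Fin n) (Fin n) ℝ) : 𝓓'(Ω, ℝ) :=
  ∑ k, ∂_{stdVec k} (distOf Ω (fieldV Ω G k)) + distOf Ω (fieldF Ω G)

end Euclidean

/-- A mollifier on `ℝⁿ`: smooth, nonnegative, supported in the unit ball, with integral `1`. -/
structure Mollifier (n : ℕ) where
  toFun : Eu n → ℝ
  smooth : ContDiff ℝ ∞ toFun
  nonneg : ∀ x, 0 ≤ toFun x
  supp : tsupport toFun ⊆ Metric.closedBall 0 1
  integral_eq_one : ∫ x, toFun x = 1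

/-- `ρ_ε(x) = ε⁻ⁿ ρ(x / ε)`. -/
def Mollifier.scaled {n : ℕ} (ρ : Mollifier n) (ε : ℝ) (x : Eu n) : ℝ :=
  (ε ^ n)⁻¹ * ρ.toFun (ε⁻¹ • x)

/-! ### Tensor fields, charts, distributions on a manifold -/

section Manifold

variable {n : ℕ} {M : Type*} [TopologicalSpace M] [ChartedSpace (Eu n) M]

/-- The image of a chart, as an open subset of `ℝⁿ`. -/
def chartTarget (e : OpenPartialHomeomorph M (Eu n)) : Opens (Eu n) := ⟨e.target, e.open_target⟩

/-- (Not necessarily continuous) `(0,2)`-tensor fields on `M`. -/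
abbrev Tensor02 (n : ℕ) (M : Type*) [TopologicalSpace M] [ChartedSpace (Eu n) M] : Type _ :=
  ∀ x : M, TangentSpace (𝓡 n) x →L[ℝ] TangentSpace (𝓡 n) x →L[ℝ] ℝ

/-- The pull-back `(v, w) ↦ B (L v) (L w)` of a bilinear form. -/
def pullBilin {V W : Type*} [AddCommGroup V] [Module ℝ V] [TopologicalSpace V]
    [IsTopologicalAddGroup V] [ContinuousSMul ℝ V] [AddCommGroup W] [Module ℝ W]
    [TopologicalSpace W] [IsTopologicalAddGroup W] [ContinuousSMul ℝ W]
    (B : W →L[ℝ] W →L[ℝ] ℝ) (L : V →L[ℝ] W) : V →L[ℝ] V →L[ℝ] ℝ :=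
  (ContinuousLinearMap.precomp ℝ L).comp (B.comp L)

theorem pullBilin_apply {V W : Type*} [AddCommGroup V] [Module ℝ V] [TopologicalSpace V]
    [IsTopologicalAddGroup V] [ContinuousSMul ℝ V] [AddCommGroup W] [Module ℝ W]
    [TopologicalSpace W] [IsTopologicalAddGroup W] [ContinuousSMul ℝ W]
    (B : W →L[ℝ] W →L[ℝ] ℝ) (L : V →L[ℝ] W) (v w : V) :
    pullBilin B L v w = B (L v) (L w) := rfl

/-- The push-forward `e_* h` of a `(0,2)`-tensor field to the image of the chart `e`. -/
def chartRep (e : OpenPartialHomeomorph M (Eu n)) (h : Tensor02 n M) (y : Eu n) :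
    Eu n →L[ℝ] Eu n →L[ℝ] ℝ :=
  pullBilin (h (e.symm y)) (mfderiv 𝓘(ℝ, Eu n) (𝓡 n) e.symm y)

/-- The components `h_{ab} = h(∂_a, ∂_b)` in the chart `e`. -/
def comps (e : OpenPartialHomeomorph M (Eu n)) (h : Tensor02 n M) (y : Eu n) :
    Matrix (Fin n) (Fin n) ℝ :=
  Matrix.of fun a b => chartRep e h y (stdVec a) (stdVec b)

/-- `h ∈ W^{1,q}_loc(M)`: in every smooth chart the components are in `W^{1,q}_loc`. -/
def TensorW1Loc (q : ℝ≥0∞) (h : Tensor02 n M) : Prop :=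
  ∀ e ∈ IsManifold.maximalAtlas (𝓡 n) ∞ M, ∀ a b : Fin n,
    MemW1Loc (chartTarget e) q (fun y => comps e h y a b)

/-- `h` is a smooth tensor field: in every smooth chart the components are smooth. -/
def TensorSmooth (h : Tensor02 n M) : Prop :=
  ∀ e ∈ IsManifold.maximalAtlas (𝓡 n) ∞ M, ∀ a b : Fin n,
    ContDiffOn ℝ ∞ (fun y => comps e h y a b) e.target

/-- `h` is symmetric and positive definite at `x`. -/
def IsRiemannianAt (h : Tensor02 n M) (x : M) : Prop :=
  (∀ v w, h x v w = h x w v) ∧ ∀ v, v ≠ 0 → 0 < h x v v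

/-- The scalar curvature function of a smooth metric `h`, computed at each point in the preferred
chart there (its value does not depend on the chart). -/
def scal (h : Tensor02 n M) (x : M) : ℝ :=
  coordScal (comps (chartAt (Eu n) x) h) (chartAt (Eu n) x x)

/-- A scalar distribution on `M`, presented by its coordinate expression `u e ∈ 𝓓'(e(U))` in every
chart `(U, e)`: `u e φ` is the value of the distribution on the density `(φ ∘ e) |dx¹ ∧ … ∧ dxⁿ|`
supported in `U`. -/
abbrev ChartDistribution (n : ℕ) (M : Type*) [TopologicalSpace M] : Type _ :=
  ∀ e : OpenPartialHomeomorph M (Eu n), 𝓓'(chartTarget e, ℝ)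

/-- The distributional scalar curvature `R[g]`; its expression in a chart is `∂ₖ Vᵏ + F`. -/
def distScalM (h : Tensor02 n M) : ChartDistribution n M :=
  fun e => distScal (chartTarget e) (comps e h)

/-- A family of functions `u_ε` on `M` converges to `0` in `L^q_loc(M)` as `ε ↓ 0`:
on each compact subset of (the image of) each smooth chart, `u_ε` is in `L^q` for small `ε`,
with norm tending to `0`. -/
def TendstoZeroLpLoc (q : ℝ≥0∞) (u : ℝ → M → ℝ) : Prop :=
  ∀ e ∈ IsManifold.maximalAtlas (𝓡 n) ∞ M, ∀ K : Set (Eu n), IsCompact K → K ⊆ e.target →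
    (∀ᶠ ε in 𝓝[>] (0 : ℝ), MemLp (fun y => u ε (e.symm y)) q (volume.restrict K)) ∧
    Tendsto (fun ε => eLpNorm (fun y => u ε (e.symm y)) q (volume.restrict K))
      (𝓝[>] (0 : ℝ)) (𝓝 0)

/-! ### Regularisation by chartwise convolution -/

/-- A function on `M` read in a chart and extended by zero to `ℝⁿ`. -/
def pushFun (e : OpenPartialHomeomorph M (Eu n)) (f : M → ℝ) : Eu n → ℝ :=
  e.target.indicator (fun z => f (e.symm z))

theorem tsupport_pushFun {e : OpenPartialHomeomorph M (Eu n)} {f : M → ℝ}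
    (hc : HasCompactSupport f) (hs : tsupport f ⊆ e.source) :
    tsupport (pushFun e f) ⊆ e '' tsupport f := by
  have hK : IsCompact (e '' tsupport f) := hc.isCompact.image_of_continuousOn
    (e.continuousOn.mono hs)
  refine closure_minimal ?_ hK.isClosed
  intro z hz
  have hz1 : z ∈ e.target := by
    by_contra h
    exact hz (by simp [pushFun, h])
  refine ⟨e.symm z, subset_tsupport f ?_, e.right_inv hz1⟩
  intro h0
  exact hz (by simp [pushFun, h0])

theorem image_tsupport_subset {e : OpenPartialHomeomorph M (Eu n)} {f : M → ℝ}
    (hs : tsupport f ⊆ e.source) : e '' tsupport f ⊆ e.target := by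
  rintro _ ⟨x, hx, rfl⟩
  exact e.map_source (hs hx)

theorem hasCompactSupport_pushFun {e : OpenPartialHomeomorph M (Eu n)} {f : M → ℝ}
    (hc : HasCompactSupport f) (hs : tsupport f ⊆ e.source) :
    HasCompactSupport (pushFun e f) :=
  (hc.isCompact.image_of_continuousOn (e.continuousOn.mono hs)).of_isClosed_subset
    (isClosed_tsupport _) (tsupport_pushFun hc hs)

theorem contDiff_pushFun [IsManifold (𝓡 n) ∞ M] {e : OpenPartialHomeomorph M (Eu n)}
    (he : e ∈ IsManifold.maximalAtlas (𝓡 n) ∞ M) {f : M → ℝ}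
    (hf : ContMDiff (𝓡 n) 𝓘(ℝ, ℝ) ∞ f)
    (hc : HasCompactSupport f) (hs : tsupport f ⊆ e.source) :
    ContDiff ℝ ∞ (pushFun e f) := by
  rw [contDiff_iff_contDiffAt]
  intro z
  by_cases hz : z ∈ e.target
  · have h1 : ContMDiffAt 𝓘(ℝ, Eu n) 𝓘(ℝ, ℝ) ∞ (f ∘ e.symm) z :=
      hf.contMDiffAt.comp z (contMDiffAt_symm_of_mem_maximalAtlas he hz)
    refine h1.contDiffAt.congr_of_eventuallyEq ?_
    filter_upwards [e.open_target.mem_nhds hz] with w hw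
    simp [pushFun, hw]
  · have hz' : z ∉ tsupport (pushFun e f) := fun h =>
      hz (image_tsupport_subset hs (tsupport_pushFun hc hs h))
    exact contDiffAt_const.congr_of_eventuallyEq (notMem_tsupport_iff_eventuallyEq.mp hz')

/-- The data of the regularisation procedure on `M`: a countable locally finite cover by relatively
compact charts `(Uᵢ, ψᵢ)` with values in the unit ball, a subordinate smooth partition of unity
`ηᵢ`, and cut-off functions `χᵢ ∈ C^∞_c(Uᵢ)` equal to `1` near `supp ηᵢ`. -/
structure RegData (n : ℕ) (M : Type*) [TopologicalSpace M] [ChartedSpace (Eu n) M] where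
  ψ : ℕ → OpenPartialHomeomorph M (Eu n)
  ψ_smooth : ∀ i, ψ i ∈ IsManifold.maximalAtlas (𝓡 n) ∞ M
  ψ_relcompact : ∀ i, IsCompact (closure (ψ i).source)
  ψ_target : ∀ i, (ψ i).target ⊆ Metric.ball 0 1
  ψ_locallyFinite : LocallyFinite fun i => (ψ i).source
  ψ_cover : ⋃ i, (ψ i).source = univ
  η : SmoothPartitionOfUnity ℕ (𝓡 n) M univ
  η_subordinate : η.IsSubordinate fun i => (ψ i).source
  χ : ℕ → M → ℝ
  χ_smooth : ∀ i, ContMDiff (𝓡 n) 𝓘(ℝ, ℝ) ∞ (χ i)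
  χ_compact : ∀ i, HasCompactSupport (χ i)
  χ_supp : ∀ i, tsupport (χ i) ⊆ (ψ i).source
  χ_eq_one : ∀ i, ∀ᶠ x in 𝓝ˢ (tsupport (η i)), χ i x = 1

namespace RegData

theorem η_compact (D : RegData n M) (i : ℕ) : HasCompactSupport (D.η i) :=
  (D.ψ_relcompact i).of_isClosed_subset (isClosed_tsupport _)
    ((D.η_subordinate i).trans subset_closure)

/-- The test function `z ↦ ηᵢ(ψᵢ⁻¹ z) ρ_ε(y - z)` on `ψᵢ(Uᵢ)`. -/
def kernel [IsManifold (𝓡 n) ∞ M] (D : RegData n M) (ρ : Mollifier n) (ε : ℝ) (i : ℕ)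
    (y : Eu n) : 𝓓(chartTarget (D.ψ i), ℝ) where
  toFun z := pushFun (D.ψ i) (D.η i) z * ρ.scaled ε (y - z)
  contDiff' := by
    have h1 := contDiff_pushFun (D.ψ_smooth i) (D.η i).contMDiff (D.η_compact i)
      (D.η_subordinate i)
    have h2 : ContDiff ℝ ∞ fun z : Eu n => ρ.scaled ε (y - z) :=
      contDiff_const.mul (ρ.smooth.comp ((contDiff_const.sub contDiff_id).const_smul ε⁻¹))
    exact h1.mul h2
  hasCompactSupport' :=
    (hasCompactSupport_pushFun (D.η_compact i) (D.η_subordinate i)).mul_right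
  tsupport_subset' :=
    (tsupport_mul_subset_left).trans ((tsupport_pushFun (D.η_compact i) (D.η_subordinate i)).trans
      (image_tsupport_subset (D.η_subordinate i)))

/-- `(u ⋆_M ρ_ε)(x) = ∑ᵢ χᵢ(x) [((ψᵢ)_*(ηᵢ u)) * ρ_ε](ψᵢ(x))` for a scalar distribution `u`.
The convolution of `T = (ψᵢ)_*(ηᵢ u)` with `ρ_ε` at `y` is `⟨T, ρ_ε(y - ·)⟩`. -/
def regScalar [IsManifold (𝓡 n) ∞ M] (D : RegData n M) (ρ : Mollifier n)
    (u : ChartDistribution n M) (ε : ℝ) (x : M) : ℝ :=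
  ∑ᶠ i, D.χ i x * u (D.ψ i) (D.kernel ρ ε i (D.ψ i x))

/-- The convolution `((ψᵢ)_*(ηᵢ h)) * ρ_ε` of the compactly supported tensor field
`(ψᵢ)_*(ηᵢ h)` on `ℝⁿ` (its components are convolved one by one). -/
def convTensor (D : RegData n M) (ρ : Mollifier n) (h : Tensor02 n M) (ε : ℝ) (i : ℕ)
    (y : Eu n) : Eu n →L[ℝ] Eu n →L[ℝ] ℝ :=
  ∫ z, (pushFun (D.ψ i) (D.η i) z * ρ.scaled ε (y - z)) • chartRep (D.ψ i) h z

/-- `h ⋆_M ρ_ε = ∑ᵢ χᵢ (ψᵢ)^*[((ψᵢ)_*(ηᵢ h)) * ρ_ε]` for a continuous `(0,2)`-tensor field `h`. -/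
def regTensor (D : RegData n M) (ρ : Mollifier n) (h : Tensor02 n M) (ε : ℝ) : Tensor02 n M :=
  fun x => ∑ᶠ i, D.χ i x •
    pullBilin (D.convTensor ρ h ε i (D.ψ i x)) (mfderiv (𝓡 n) 𝓘(ℝ, Eu n) (D.ψ i) x)

end RegData

end Manifold

end LowRegScal

end

/-! In coordinates the scalar curvature is `∂ₖ(bᵏʲᵃᵇ ∂ⱼ g_ab)` plus terms quadratic in `∂g`, where
`b` (`bcoef`) is quadratic in the inverse metric. Let `H_ε` be the regularised metric. It converges
to `g` locally uniformly and in `W^{1,p}`, so by Hölder the quadratic terms converge in `L^{p/2}`,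
before and after mollification (`tendsLp_lowF`). The difficulty lies in the second-order terms,
which have no limit in `L^{p/2}`; only differences of them can be controlled.

In one chart this is a Friedrichs commutator (`tendsLp_commutator`): `(b w) * ∂ρ_ε - B_ε (w * ∂ρ_ε)`
converges in `L^{p/2}`. The kernel `∂ρ_ε` has mass of order `ε⁻¹`, which is paid for by `b(y - z) -
B_ε(y) = O(ε)` in `L^p` for `‖z‖ ≤ ε`. Hence uniform and `W^{1,p}` convergence of `H_ε` is not
enough: a rate `O(ε)` in `L^p` is needed as well. `SobConv` bundles these three properties. It is
stable under sums, products, reciprocals and changes of coordinates, so the rate passes from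
mollified components to the regularised metric and on to the coefficients `B_ε` built from its
inverse.

A second obstacle is global. In the chart `ψᵢ` the regularised metric is a sum of convolutions
carried out in several charts, so `ηᵢ H_ε` is not the convolution of `ηᵢ g`. The `defect` `Tᵢ`, the
`i`-th summand of `H_ε` minus `ηᵢ H_ε`, measures the difference. It tends to zero with its first
derivatives, but nothing is known about its second derivatives. The single-chart result
`tendsLp_chart` therefore says that the `i`-th term of `R[g] ⋆ ρ_ε` equals `ηᵢ R[H_ε]` plus `secOrd
H_ε Tᵢ`, up to an error tending to zero, where `secOrd` is the linear second-order operator with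
coefficients `bcoef` of `H_ε`.

These corrections are never estimated; they cancel. `secOrd` is invariant under a change of chart up
to terms of order at most one in `Tᵢ` (`secOrd_transform`), and those tend to zero
(`tendsLp_secRem`). So all corrections may be read in one chart, where linearity gives `secOrd H_ε
(∑ Tᵢ)`, and `∑ Tᵢ = 0` because `∑ ηᵢ = 1` (`sum_comps_defect`). Adding the terms `ηᵢ R[H_ε]` in one
chart also uses that the scalar curvature of a smooth metric is chart independent
(`coordScal_transform`). -/

noncomputable section

namespace LowRegScal

/-! ### Convergence in `L^q` of one-parameter families -/

section TendsLp

variable {α : Type*} [MeasurableSpace α] {μ : Measure α} {p q r : ℝ≥0∞}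

/-- The functions `F ε` converge to `f` in `L^q(μ)` as `ε ↓ 0`. -/
def TendsLp (q : ℝ≥0∞) (μ : Measure α) (F : ℝ → α → ℝ) (f : α → ℝ) : Prop :=
  (∀ᶠ ε in 𝓝[>] (0 : ℝ), MemLp (F ε) q μ) ∧ MemLp f q μ ∧
    Tendsto (fun ε => eLpNorm (fun x => F ε x - f x) q μ) (𝓝[>] (0 : ℝ)) (𝓝 0)

/-- `‖F ε - f‖_{L^p(μ)} = O(ε)` as `ε ↓ 0`. -/
def RateLp (p : ℝ≥0∞) (μ : Measure α) (F : ℝ → α → ℝ) (f : α → ℝ) : Prop :=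
  ∃ C : ℝ≥0∞, C ≠ ⊤ ∧ ∀ᶠ ε in 𝓝[>] (0 : ℝ),
    eLpNorm (fun x => F ε x - f x) p μ ≤ C * ENNReal.ofReal ε

theorem TendsLp.const {f : α → ℝ} (hf : MemLp f q μ) : TendsLp q μ (fun _ => f) f :=
  ⟨Eventually.of_forall fun _ => hf, hf, by simp⟩

/-- Membership of `F ε` in `L^q` need not be assumed: once `B ε < 1` the difference `F ε - f` has
finite norm, and `f` is added back. -/
theorem tendsLp_of_le {F : ℝ → α → ℝ} {f : α → ℝ}
    (hF : ∀ᶠ ε in 𝓝[>] (0 : ℝ), AEStronglyMeasurable (F ε) μ) (hf : MemLp f q μ)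
    {B : ℝ → ℝ≥0∞} (hB : Tendsto B (𝓝[>] (0 : ℝ)) (𝓝 0))
    (h : ∀ᶠ ε in 𝓝[>] (0 : ℝ), eLpNorm (fun x => F ε x - f x) q μ ≤ B ε) : TendsLp q μ F f := by
  refine ⟨?_, hf, ?_⟩
  · filter_upwards [hF, h, hB.eventually (gt_mem_nhds (zero_lt_one))] with ε h1 h2 h3
    have : MemLp (fun x => F ε x - f x) q μ :=
      ⟨h1.sub hf.aestronglyMeasurable, (h2.trans_lt h3).trans ENNReal.one_lt_top⟩
    have h4 := this.add hf
    refine h4.ae_eq (Eventually.of_forall fun x => ?_)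
    simp
  · exact tendsto_of_tendsto_of_tendsto_of_le_of_le' tendsto_const_nhds hB
      (Eventually.of_forall fun _ => bot_le) h

theorem TendsLp.congr {F F' : ℝ → α → ℝ} {f f' : α → ℝ} (h : TendsLp q μ F f)
    (hF : ∀ᶠ ε in 𝓝[>] (0 : ℝ), F ε =ᵐ[μ] F' ε) (hf : f =ᵐ[μ] f') : TendsLp q μ F' f' := by
  obtain ⟨h1, h2, h3⟩ := h
  refine ⟨?_, h2.ae_eq hf, h3.congr' ?_⟩
  · filter_upwards [h1, hF] with ε a b using a.ae_eq b
  · filter_upwards [hF] with ε b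
    refine eLpNorm_congr_ae ?_
    filter_upwards [b, hf] with x hx hx'
    rw [hx, hx']

theorem TendsLp.add {F F' : ℝ → α → ℝ} {f f' : α → ℝ} (hq : 1 ≤ q) (h : TendsLp q μ F f)
    (h' : TendsLp q μ F' f') : TendsLp q μ (fun ε x => F ε x + F' ε x) (fun x => f x + f' x) := by
  obtain ⟨h1, h2, h3⟩ := h
  obtain ⟨h1', h2', h3'⟩ := h'
  refine tendsLp_of_le ?_ (h2.add h2') (B := fun ε => eLpNorm (fun x => F ε x - f x) q μ +
    eLpNorm (fun x => F' ε x - f' x) q μ) (by simpa using h3.add h3') ?_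
  · filter_upwards [h1, h1'] with ε a b using (a.add b).aestronglyMeasurable
  · filter_upwards [h1, h1'] with ε a b
    refine le_trans (le_of_eq ?_) (eLpNorm_add_le (a.sub h2).aestronglyMeasurable
      (b.sub h2').aestronglyMeasurable hq)
    congr 1
    ext x
    simp only [Pi.add_apply]
    ring

theorem TendsLp.const_mul {F : ℝ → α → ℝ} {f : α → ℝ} (c : ℝ) (h : TendsLp q μ F f) :
    TendsLp q μ (fun ε x => c * F ε x) (fun x => c * f x) := by
  obtain ⟨h1, h2, h3⟩ := h
  refine ⟨?_, h2.const_mul c, ?_⟩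
  · filter_upwards [h1] with ε a using a.const_mul c
  · have h4 := ENNReal.Tendsto.const_mul (a := ‖c‖ₑ) h3 (Or.inr enorm_ne_top)
    rw [mul_zero] at h4
    refine h4.congr fun ε => ?_
    rw [← eLpNorm_const_smul]
    congr 1
    ext x
    simp only [Pi.smul_apply, smul_eq_mul]
    ring

theorem TendsLp.neg {F : ℝ → α → ℝ} {f : α → ℝ} (h : TendsLp q μ F f) :
    TendsLp q μ (fun ε x => -F ε x) (fun x => -f x) := by
  simpa using h.const_mul (-1)

theorem TendsLp.sub {F F' : ℝ → α → ℝ} {f f' : α → ℝ} (hq : 1 ≤ q) (h : TendsLp q μ F f)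
    (h' : TendsLp q μ F' f') : TendsLp q μ (fun ε x => F ε x - F' ε x) (fun x => f x - f' x) := by
  simpa [sub_eq_add_neg] using h.add hq h'.neg

theorem TendsLp.sum {ι : Type*} {F : ι → ℝ → α → ℝ} {f : ι → α → ℝ} (hq : 1 ≤ q) (s : Finset ι)
    (h : ∀ i ∈ s, TendsLp q μ (F i) (f i)) :
    TendsLp q μ (fun ε x => ∑ i ∈ s, F i ε x) (fun x => ∑ i ∈ s, f i x) := by
  classical
  induction s using Finset.induction_on with
  | empty => simpa using TendsLp.const (q := q) (μ := μ) (MemLp.zero' (ε := ℝ))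
  | insert a s ha ih =>
    simp only [Finset.sum_insert ha]
    exact (h a (by simp)).add hq (ih fun i hi => h i (by simp [hi]))

theorem TendsLp.mono_exponent [IsFiniteMeasure μ] {F : ℝ → α → ℝ} {f : α → ℝ}
    (h : TendsLp p μ F f) (hpq : q ≤ p) (hq : 1 ≤ q) : TendsLp q μ F f := by
  obtain ⟨h1, h2, h3⟩ := h
  have hc : μ univ ^ (1 / q.toReal - 1 / p.toReal) ≠ ⊤ := by
    refine ENNReal.rpow_ne_top_of_nonneg ?_ (measure_ne_top μ _)
    rw [sub_nonneg]
    rcases eq_or_ne p ⊤ with rfl | hp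
    · simp
    · exact one_div_le_one_div_of_le (ENNReal.toReal_pos (by positivity)
        (ne_top_of_le_ne_top hp hpq)) (ENNReal.toReal_mono hp hpq)
  refine tendsLp_of_le (h1.mono fun _ a => a.aestronglyMeasurable) (h2.mono_exponent hpq)
    (B := fun ε => eLpNorm (fun x => F ε x - f x) p μ * μ univ ^ (1 / q.toReal - 1 / p.toReal))
    ?_ ?_
  · simpa using ENNReal.Tendsto.mul_const h3 (Or.inr hc)
  · filter_upwards [h1] with ε a
    exact eLpNorm_le_eLpNorm_mul_rpow_measure_univ hpq (a.sub h2).aestronglyMeasurable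

theorem TendsLp.mono_measure {ν : Measure α} {F : ℝ → α → ℝ} {f : α → ℝ} (h : TendsLp q μ F f)
    (hν : ν ≤ μ) : TendsLp q ν F f := by
  obtain ⟨h1, h2, h3⟩ := h
  refine ⟨h1.mono fun _ a => a.mono_measure hν, h2.mono_measure hν, ?_⟩
  exact tendsto_of_tendsto_of_tendsto_of_le_of_le tendsto_const_nhds h3
    (fun _ => bot_le) fun _ => eLpNorm_mono_measure _ hν

theorem TendsLp.eventually_le {F : ℝ → α → ℝ} {f : α → ℝ} (hq : 1 ≤ q) (h : TendsLp q μ F f) :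
    ∀ᶠ ε in 𝓝[>] (0 : ℝ), eLpNorm (F ε) q μ ≤ 1 + eLpNorm f q μ := by
  obtain ⟨h1, h2, h3⟩ := h
  filter_upwards [h1, h3.eventually (gt_mem_nhds zero_lt_one)] with ε a b
  have : F ε = (fun x => F ε x - f x) + f := by ext; simp
  rw [this]
  refine (eLpNorm_add_le (a.sub h2).aestronglyMeasurable h2.aestronglyMeasurable hq).trans ?_
  exact add_le_add b.le le_rfl

theorem eLpNorm_mul_le {f g : α → ℝ} [hpqr : ENNReal.HolderTriple p q r]
    (hf : AEStronglyMeasurable f μ) (hg : AEStronglyMeasurable g μ) :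
    eLpNorm (fun x => f x * g x) r μ ≤ eLpNorm f p μ * eLpNorm g q μ := by
  have h := eLpNorm_smul_le_mul_eLpNorm (p := p) (q := q) (r := r) hg hf
  have e : f • g = fun x => f x * g x := rfl
  rwa [e] at h

theorem memLp_mul {f g : α → ℝ} [hpqr : ENNReal.HolderTriple p q r]
    (hf : MemLp f p μ) (hg : MemLp g q μ) : MemLp (fun x => f x * g x) r μ := by
  have h := MemLp.smul (p := p) (q := q) (r := r) hg hf
  have e : f • g = fun x => f x * g x := rfl
  rwa [e] at h

theorem TendsLp.mul {F G : ℝ → α → ℝ} {f g : α → ℝ} [hpqr : ENNReal.HolderTriple p q r]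
    (hq : 1 ≤ q) (hr : 1 ≤ r) (hF : TendsLp p μ F f) (hG : TendsLp q μ G g) :
    TendsLp r μ (fun ε x => F ε x * G ε x) (fun x => f x * g x) := by
  have hGb := hG.eventually_le hq
  obtain ⟨h1, h2, h3⟩ := hF
  obtain ⟨k1, k2, k3⟩ := hG
  refine tendsLp_of_le (B := fun ε => eLpNorm (fun x => F ε x - f x) p μ * (1 + eLpNorm g q μ) +
    eLpNorm f p μ * eLpNorm (fun x => G ε x - g x) q μ) ?_ (memLp_mul (p := p) (q := q) h2 k2) ?_ ?_
  · filter_upwards [h1, k1] with ε a b using (memLp_mul (p := p) (q := q) (r := r) a b).aestronglyMeasurable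
  · have e1 := ENNReal.Tendsto.mul_const (b := 1 + eLpNorm g q μ) h3
      (Or.inr (by simp [k2.eLpNorm_ne_top]))
    have e2 := ENNReal.Tendsto.const_mul (a := eLpNorm f p μ) k3 (Or.inr h2.eLpNorm_ne_top)
    simpa using e1.add e2
  · filter_upwards [h1, k1, hGb] with ε a b c
    have : (fun x => F ε x * G ε x - f x * g x) =
        (fun x => (F ε x - f x) * G ε x) + (fun x => f x * (G ε x - g x)) := by
      ext x; simp only [Pi.add_apply]; ring
    rw [this]
    have m1 := a.sub h2
    have m2 := b.sub k2
    refine (eLpNorm_add_le (memLp_mul (p := p) (q := q) (r := r) m1 b).aestronglyMeasurable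
      (memLp_mul (p := p) (q := q) (r := r) h2 m2).aestronglyMeasurable hr).trans ?_
    refine add_le_add ((eLpNorm_mul_le (p := p) (q := q) m1.aestronglyMeasurable b.aestronglyMeasurable).trans ?_)
      (eLpNorm_mul_le (p := p) (q := q) h2.aestronglyMeasurable m2.aestronglyMeasurable)
    exact mul_le_mul' le_rfl c

/-- A three-`δ` argument. The approximating family must be close to `F` for all small `ε` at once,
so density arguments based on it require a bound uniform in `ε`. -/
theorem tendsLp_of_approx {F : ℝ → α → ℝ} {f : α → ℝ} (hq : 1 ≤ q)
    (hF : ∀ᶠ ε in 𝓝[>] (0 : ℝ), AEStronglyMeasurable (F ε) μ) (hf : MemLp f q μ)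
    (h : ∀ δ : ℝ≥0∞, 0 < δ → ∃ (F' : ℝ → α → ℝ) (f' : α → ℝ), TendsLp q μ F' f' ∧
      (∀ᶠ ε in 𝓝[>] (0 : ℝ), eLpNorm (fun x => F ε x - F' ε x) q μ ≤ δ) ∧
      eLpNorm (fun x => f' x - f x) q μ ≤ δ) : TendsLp q μ F f := by
  refine tendsLp_of_le hF hf (B := fun ε => eLpNorm (fun x => F ε x - f x) q μ) ?_
    (Eventually.of_forall fun _ => le_rfl)
  rw [ENNReal.tendsto_nhds_zero]
  intro δ hδ
  obtain ⟨F', f', ⟨h1, h2, h3⟩, h4, h5⟩ := h (δ / 3) (ENNReal.div_pos hδ.ne' (by simp))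
  have h3' := (ENNReal.tendsto_nhds_zero.mp h3) (δ / 3) (ENNReal.div_pos hδ.ne' (by simp))
  filter_upwards [hF, h1, h4, h3'] with ε a b c d
  have e : (fun x => F ε x - f x) =
      (fun x => F ε x - F' ε x) + ((fun x => F' ε x - f' x) + (fun x => f' x - f x)) := by
    ext x; simp only [Pi.add_apply]; ring
  rw [e]
  have m1 := a.sub b.aestronglyMeasurable
  have m2 := (b.sub h2).aestronglyMeasurable
  have m3 := (h2.sub hf).aestronglyMeasurable
  refine (eLpNorm_add_le m1 (m2.add m3) hq).trans ?_
  refine (add_le_add c ((eLpNorm_add_le m2 m3 hq).trans (add_le_add d h5))).trans ?_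
  rw [← add_assoc, ENNReal.add_thirds]

theorem tendsLp_top_of_tendstoUniformlyOn {K : Set α} (hK : MeasurableSet K) {F : ℝ → α → ℝ}
    {f : α → ℝ} (hF : ∀ᶠ ε in 𝓝[>] (0 : ℝ), AEStronglyMeasurable (F ε) (μ.restrict K))
    (hf : MemLp f ∞ (μ.restrict K)) (h : TendstoUniformlyOn F f (𝓝[>] (0 : ℝ)) K) :
    TendsLp ∞ (μ.restrict K) F f := by
  refine tendsLp_of_le hF hf (B := fun ε => eLpNorm (fun x => F ε x - f x) ∞ (μ.restrict K)) ?_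
    (Eventually.of_forall fun _ => le_rfl)
  rw [ENNReal.tendsto_nhds_zero]
  intro δ hδ
  obtain ⟨r, hr, hrδ⟩ : ∃ r : ℝ, 0 < r ∧ ENNReal.ofReal r ≤ δ := by
    rcases eq_or_ne δ ⊤ with rfl | h
    · exact ⟨1, one_pos, le_top⟩
    · exact ⟨δ.toReal, ENNReal.toReal_pos hδ.ne' h, by rw [ENNReal.ofReal_toReal h]⟩
  filter_upwards [Metric.tendstoUniformlyOn_iff.mp h r hr] with ε hε
  refine le_trans ?_ hrδ
  rw [eLpNorm_exponent_top]
  refine eLpNormEssSup_le_of_ae_bound ?_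
  filter_upwards [ae_restrict_mem hK] with x hx
  have := hε x hx
  rw [dist_comm, Real.dist_eq] at this
  exact this.le

theorem RateLp.add {F F' : ℝ → α → ℝ} {f f' : α → ℝ} (hp : 1 ≤ p)
    (mF : ∀ᶠ ε in 𝓝[>] (0 : ℝ), AEStronglyMeasurable (F ε) μ) (mf : AEStronglyMeasurable f μ)
    (mF' : ∀ᶠ ε in 𝓝[>] (0 : ℝ), AEStronglyMeasurable (F' ε) μ) (mf' : AEStronglyMeasurable f' μ)
    (h : RateLp p μ F f) (h' : RateLp p μ F' f') :
    RateLp p μ (fun ε x => F ε x + F' ε x) (fun x => f x + f' x) := by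
  obtain ⟨C, hC, h⟩ := h
  obtain ⟨C', hC', h'⟩ := h'
  refine ⟨C + C', by simp [hC, hC'], ?_⟩
  filter_upwards [mF, mF', h, h'] with ε a b c d
  have e : (fun x => F ε x + F' ε x - (f x + f' x)) =
      (fun x => F ε x - f x) + (fun x => F' ε x - f' x) := by
    ext x; simp only [Pi.add_apply]; ring
  rw [e, add_mul]
  exact (eLpNorm_add_le (a.sub mf) (b.sub mf') hp).trans (add_le_add c d)

/-- In each term of the difference of products one factor is a difference, measured in `L^p`, and
the other is bounded in `L^∞`; the rate thus stays in `L^p` instead of dropping to `L^{p/2}`. -/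
theorem RateLp.mul {F F' : ℝ → α → ℝ} {f f' : α → ℝ} (hp : 1 ≤ p)
    (hF : TendsLp ∞ μ F f) (hF' : TendsLp ∞ μ F' f')
    (h : RateLp p μ F f) (h' : RateLp p μ F' f') :
    RateLp p μ (fun ε x => F ε x * F' ε x) (fun x => f x * f' x) := by
  obtain ⟨C, hC, h⟩ := h
  obtain ⟨C', hC', h'⟩ := h'
  have hb := hF'.eventually_le le_top
  obtain ⟨m1, m2, -⟩ := hF
  obtain ⟨m1', m2', -⟩ := hF'
  refine ⟨C * (1 + eLpNorm f' ∞ μ) + eLpNorm f ∞ μ * C', ?_, ?_⟩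
  · have := m2.eLpNorm_ne_top
    have := m2'.eLpNorm_ne_top
    finiteness
  · filter_upwards [m1, m1', h, h', hb] with ε a b c d k
    have e : (fun x => F ε x * F' ε x - f x * f' x) =
        (fun x => (F ε x - f x) * F' ε x) + (fun x => f x * (F' ε x - f' x)) := by
      ext x; simp only [Pi.add_apply]; ring
    rw [e]
    have n1 := (a.sub m2).aestronglyMeasurable
    have n2 := (b.sub m2').aestronglyMeasurable
    refine (eLpNorm_add_le (n1.mul b.aestronglyMeasurable)
      (m2.aestronglyMeasurable.mul n2) hp).trans ?_
    have e1 := eLpNorm_mul_le (p := p) (q := ∞) (r := p) n1 b.aestronglyMeasurable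
    have e2 := eLpNorm_mul_le (p := ∞) (q := p) (r := p) m2.aestronglyMeasurable n2
    calc _ ≤ (C * ENNReal.ofReal ε) * (1 + eLpNorm f' ∞ μ)
        + eLpNorm f ∞ μ * (C' * ENNReal.ofReal ε) :=
          add_le_add (e1.trans (mul_le_mul' c k)) (e2.trans (mul_le_mul' le_rfl d))
      _ = _ := by ring

end TendsLp

/-! ### Minkowski's integral inequality -/

section Minkowski

variable {α β : Type*} [MeasurableSpace α] [MeasurableSpace β] {μ : Measure α} {ν : Measure β}

/-- **Minkowski's integral inequality** for an integral against a kernel of finite mass. -/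
theorem eLpNorm_integral_mul_le [SFinite μ] [SFinite ν] {q : ℝ≥0∞} (hq : 1 ≤ q) (hq' : q ≠ ⊤)
    {f : α → β → ℝ} {k : β → ℝ}
    (hf : AEStronglyMeasurable (Function.uncurry f) (μ.prod ν)) (hk : Measurable k)
    (hm : ∫⁻ z, ‖k z‖ₑ ∂ν ≠ ⊤) {C : ℝ≥0∞}
    (h : ∀ z, k z ≠ 0 → eLpNorm (fun y => f y z) q μ ≤ C) :
    eLpNorm (fun y => ∫ z, f y z * k z ∂ν) q μ ≤ C * ∫⁻ z, ‖k z‖ₑ ∂ν := by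
  set r := q.toReal with hr
  have hq0 : q ≠ 0 := by positivity
  have hr1 : 1 ≤ r := by
    rw [hr, ← ENNReal.toReal_one]
    exact ENNReal.toReal_mono hq' hq
  have hr0 : 0 < r := by linarith
  -- The kernel is absorbed into a measure of finite mass `m`. Hölder in `z` then costs `m ^ (r -
  -- 1)`, and Tonelli exchanges the two integrals.
  set ν' := ν.withDensity (fun z => ‖k z‖ₑ) with hν'
  have hke : Measurable fun z => ‖k z‖ₑ := hk.enorm
  set m := ∫⁻ z, ‖k z‖ₑ ∂ν with hmdef
  have hν'u : ν' univ = m := by rw [hν', withDensity_apply _ MeasurableSet.univ]; simp [hmdef]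
  have hfin : IsFiniteMeasure ν' := ⟨by rw [hν'u]; exact hm.lt_top⟩
  have hac : ν' ≪ ν := withDensity_absolutelyContinuous _ _
  have hf' : AEStronglyMeasurable (Function.uncurry f) (μ.prod ν') :=
    hf.mono_ac (Measure.AbsolutelyContinuous.rfl.prod hac)
  have key : ∀ᵐ y ∂μ, ‖∫ z, f y z * k z ∂ν‖ₑ ^ r ≤ m ^ (r - 1) * ∫⁻ z, ‖f y z‖ₑ ^ r ∂ν' := by
    filter_upwards [hf'.prodMk_left] with y hy
    have h1 : ‖∫ z, f y z * k z ∂ν‖ₑ ≤ eLpNorm (f y) 1 ν' := by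
      refine (enorm_integral_le_lintegral_enorm _).trans ?_
      rw [eLpNorm_one_eq_lintegral_enorm, hν', lintegral_withDensity_eq_lintegral_mul_non_measurable _
        hke (Eventually.of_forall fun _ => enorm_lt_top)]
      refine lintegral_mono fun z => ?_
      simp [enorm_mul, mul_comm]
    have h2 := eLpNorm_le_eLpNorm_mul_rpow_measure_univ (μ := ν') hq hy
    rw [hν'u] at h2
    calc _ ≤ (eLpNorm (f y) q ν' * m ^ (1 / (1 : ℝ≥0∞).toReal - 1 / q.toReal)) ^ r :=
          ENNReal.rpow_le_rpow (h1.trans h2) hr0.le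
      _ = _ := by
          rw [ENNReal.mul_rpow_of_nonneg _ _ hr0.le, eLpNorm_eq_lintegral_rpow_enorm_toReal hq0 hq',
            ← ENNReal.rpow_mul, ← ENNReal.rpow_mul, ← hr, mul_comm]
          congr 2
          · simp; field_simp
          · rw [one_div, inv_mul_cancel₀ hr0.ne', ENNReal.rpow_one]
  have main : ∫⁻ y, ‖∫ z, f y z * k z ∂ν‖ₑ ^ r ∂μ ≤ (C * m) ^ r := by
    calc _ ≤ ∫⁻ y, m ^ (r - 1) * ∫⁻ z, ‖f y z‖ₑ ^ r ∂ν' ∂μ := lintegral_mono_ae key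
      _ = m ^ (r - 1) * ∫⁻ y, ∫⁻ z, ‖f y z‖ₑ ^ r ∂ν' ∂μ := by
          rw [lintegral_const_mul' _ _ (ENNReal.rpow_ne_top_of_nonneg (by linarith) hm)]
      _ = m ^ (r - 1) * ∫⁻ z, ∫⁻ y, ‖f y z‖ₑ ^ r ∂μ ∂ν' := by
          rw [lintegral_lintegral_swap (f := fun y z => ‖f y z‖ₑ ^ r)
            (hf'.enorm.pow_const r)]
      _ ≤ m ^ (r - 1) * ∫⁻ z, C ^ r ∂ν' := by
          refine mul_le_mul' le_rfl ?_
          rw [hν', lintegral_withDensity_eq_lintegral_mul_non_measurable _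
            hke (Eventually.of_forall fun _ => enorm_lt_top),
            lintegral_withDensity_eq_lintegral_mul_non_measurable _
            hke (Eventually.of_forall fun _ => enorm_lt_top)]
          refine lintegral_mono fun z => ?_
          by_cases hz : k z = 0
          · simp [hz]
          · simp only [Pi.mul_apply]
            gcongr
            have := h z hz
            rw [eLpNorm_eq_lintegral_rpow_enorm_toReal hq0 hq', ← hr] at this
            calc _ = ((∫⁻ y, ‖f y z‖ₑ ^ r ∂μ) ^ (1 / r)) ^ r := by
                  rw [← ENNReal.rpow_mul, one_div, inv_mul_cancel₀ hr0.ne', ENNReal.rpow_one]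
              _ ≤ _ := ENNReal.rpow_le_rpow this hr0.le
      _ = (C * m) ^ r := by
          rw [lintegral_const, hν'u, ENNReal.mul_rpow_of_nonneg _ _ hr0.le, mul_left_comm]
          congr 1
          conv_lhs => rw [← ENNReal.rpow_one m]
          -- Merging the powers of `m` requires `m ≠ 0`; for `m = 0` both sides vanish because `r >
          -- 0`.
          rcases eq_or_ne m 0 with h0 | h0
          · rw [h0, ENNReal.rpow_one, mul_zero, ENNReal.zero_rpow_of_pos hr0]
          · rw [ENNReal.rpow_one]
            nth_rewrite 2 [← ENNReal.rpow_one m]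
            rw [← ENNReal.rpow_add _ _ h0 hm]
            congr 1; ring
  rw [eLpNorm_eq_lintegral_rpow_enorm_toReal hq0 hq', ← hr]
  calc _ ≤ ((C * m) ^ r) ^ (1 / r) := ENNReal.rpow_le_rpow main (by positivity)
    _ = _ := by rw [← ENNReal.rpow_mul, mul_one_div_cancel hr0.ne', ENNReal.rpow_one]

end Minkowski


/-! ### Convolution with a test function -/

section Convolution

variable {n : ℕ}

/-- The convolution `f * k` on `ℝⁿ`. -/
def cv (k f : Eu n → ℝ) (y : Eu n) : ℝ := ∫ z, f z * k (y - z)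

theorem cv_eq_integral_sub (k f : Eu n → ℝ) (y : Eu n) : cv k f y = ∫ z, f (y - z) * k z := by
  rw [cv, ← integral_sub_left_eq_self (fun z => f z * k (y - z)) volume y]
  simp

theorem cv_eq_convolution (k f : Eu n → ℝ) :
    cv k f = convolution f k (ContinuousLinearMap.mul ℝ ℝ) volume := rfl

theorem contDiff_pderiv {f : Eu n → ℝ} (hf : ContDiff ℝ ∞ f) (a : Fin n) :
    ContDiff ℝ ∞ (pderiv a f) :=
  (hf.fderiv_right (m := ∞) (by simp)).clm_apply contDiff_const

theorem tsupport_pderiv_subset (a : Fin n) (f : Eu n → ℝ) : tsupport (pderiv a f) ⊆ tsupport f := by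
  refine (closure_mono fun x hx => ?_).trans (tsupport_fderiv_subset ℝ (f := f))
  intro h
  exact hx (by simp [pderiv, h])

theorem hasCompactSupport_pderiv {f : Eu n → ℝ} (hf : HasCompactSupport f) (a : Fin n) :
    HasCompactSupport (pderiv a f) :=
  hf.of_isClosed_subset (isClosed_tsupport _) (tsupport_pderiv_subset a f)

theorem contDiff_cv {k f : Eu n → ℝ} (hk : ContDiff ℝ ∞ k) (hkc : HasCompactSupport k)
    (hf : LocallyIntegrable f volume) : ContDiff ℝ ∞ (cv k f) :=
  hkc.contDiff_convolution_right (n := (⊤ : ℕ∞)) (ContinuousLinearMap.mul ℝ ℝ) hf hk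

theorem pderiv_cv {k f : Eu n → ℝ} (hk : ContDiff ℝ ∞ k) (hkc : HasCompactSupport k)
    (hf : LocallyIntegrable f volume) (a : Fin n) : pderiv a (cv k f) = cv (pderiv a k) f := by
  ext y
  have h := hkc.hasFDerivAt_convolution_right (ContinuousLinearMap.mul ℝ ℝ) hf
    (hk.of_le (by simp)) y
  rw [pderiv, cv_eq_convolution, h.fderiv, convolution_precompR_apply _ hf (hkc.fderiv ℝ)
    (hk.continuous_fderiv (by simp))]
  rfl

theorem integrable_cv {k f : Eu n → ℝ} (hk : Continuous k) (hkc : HasCompactSupport k)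
    (hf : LocallyIntegrable f volume) (y : Eu n) :
    Integrable (fun z => f z * k (y - z)) volume :=
  hkc.convolutionExists_right (ContinuousLinearMap.mul ℝ ℝ) hf hk y

theorem integrable_cv_sub {k f : Eu n → ℝ} (hk : Continuous k) (hkc : HasCompactSupport k)
    (hf : LocallyIntegrable f volume) (y : Eu n) :
    Integrable (fun z => f (y - z) * k z) volume := by
  have h := (integrable_cv hk hkc hf y).comp_sub_left y
  simpa using h

theorem cv_add {k f g : Eu n → ℝ} (hk : Continuous k) (hkc : HasCompactSupport k)
    (hf : LocallyIntegrable f volume) (hg : LocallyIntegrable g volume) (y : Eu n) :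
    cv k (fun z => f z + g z) y = cv k f y + cv k g y := by
  rw [cv, cv, cv, ← integral_add (integrable_cv hk hkc hf y) (integrable_cv hk hkc hg y)]
  simp only [add_mul]

theorem cv_sub {k f g : Eu n → ℝ} (hk : Continuous k) (hkc : HasCompactSupport k)
    (hf : LocallyIntegrable f volume) (hg : LocallyIntegrable g volume) (y : Eu n) :
    cv k (fun z => f z - g z) y = cv k f y - cv k g y := by
  rw [cv, cv, cv, ← integral_sub (integrable_cv hk hkc hf y) (integrable_cv hk hkc hg y)]
  simp only [sub_mul]

theorem cv_sum {ι : Type*} (s : Finset ι) {k : Eu n → ℝ} {f : ι → Eu n → ℝ} (hk : Continuous k)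
    (hkc : HasCompactSupport k) (hf : ∀ i ∈ s, LocallyIntegrable (f i) volume) (y : Eu n) :
    cv k (fun z => ∑ i ∈ s, f i z) y = ∑ i ∈ s, cv k (f i) y := by
  simp only [cv, Finset.sum_mul]
  exact integral_finsetSum _ fun i hi => integrable_cv hk hkc (hf i hi) y

/-- `w` is the weak partial derivative `∂_a f` on the set `U` (tested with functions supported
there). -/
def WeakD (U : Set (Eu n)) (a : Fin n) (f w : Eu n → ℝ) : Prop :=
  ∀ φ : Eu n → ℝ, ContDiff ℝ ∞ φ → HasCompactSupport φ → tsupport φ ⊆ U →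
    ∫ z, f z * pderiv a φ z = -∫ z, w z * φ z

/-- Test the weak derivative against `z ↦ k (y - z)`: the sign from the reflection cancels the sign
from integration by parts. -/
theorem cv_pderiv_of_weakD {a : Fin n} {f w k : Eu n → ℝ} (h : WeakD univ a f w)
    (hk : ContDiff ℝ ∞ k) (hkc : HasCompactSupport k) : cv (pderiv a k) f = cv k w := by
  ext y
  have hφ : ContDiff ℝ ∞ fun z => k (y - z) := hk.comp (contDiff_const.sub contDiff_id)
  have hφc : HasCompactSupport fun z => k (y - z) := hkc.comp_homeomorph (Homeomorph.subLeft y)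
  have h1 := h _ hφ hφc (subset_univ _)
  have h2 : ∀ z, pderiv a (fun z => k (y - z)) z = -pderiv a k (y - z) := by
    intro z
    have h2 := ((hk.differentiable (by simp)).differentiableAt (x := y - z)).hasFDerivAt.comp z
      ((hasFDerivAt_id z).const_sub y)
    have h3 : fderiv ℝ (fun z => k (y - z)) z = _ := h2.fderiv
    rw [pderiv, h3]
    simp [pderiv]
  simp only [h2, mul_neg, integral_neg, neg_inj] at h1
  exact h1

theorem WeakD.mono {U V : Set (Eu n)} {a : Fin n} {f w : Eu n → ℝ} (h : WeakD V a f w)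
    (hUV : U ⊆ V) : WeakD U a f w := fun φ h1 h2 h3 => h φ h1 h2 (h3.trans hUV)

theorem cv_eq_zero_of_notMem {C : Set (Eu n)} {r : ℝ} {f k : Eu n → ℝ}
    (hf : ∀ z ∉ C, f z = 0) (hk : ∀ z, r < ‖z‖ → k z = 0) {y : Eu n}
    (hy : ∀ z ∈ C, r < dist y z) : cv k f y = 0 := by
  rw [cv]
  refine integral_eq_zero_of_ae (Eventually.of_forall fun z => ?_)
  by_cases hz : z ∈ C
  · simp [hk (y - z) (by rw [← dist_eq_norm]; exact hy z hz)]
  · simp [hf z hz]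

theorem hasCompactSupport_cv {f k : Eu n → ℝ} (hf : HasCompactSupport f)
    (hk : HasCompactSupport k) : HasCompactSupport (cv k f) := by
  rw [cv_eq_convolution]
  exact hf.convolution _ hk

theorem aestronglyMeasurable_sub {f : Eu n → ℝ} (hf : AEStronglyMeasurable f volume)
    {μ : Measure (Eu n)} [SFinite μ] (hμ : μ ≤ volume) :
    AEStronglyMeasurable (Function.uncurry fun y z : Eu n => f (y - z)) (μ.prod volume) := by
  have h1 : AEStronglyMeasurable (fun p : Eu n × Eu n => f (p.1 - p.2))
      ((volume : Measure (Eu n)).prod volume) :=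
    hf.comp_quasiMeasurePreserving (quasiMeasurePreserving_sub_of_right_invariant volume volume)
  exact h1.mono_ac (Measure.AbsolutelyContinuous.prod hμ.absolutelyContinuous
    Measure.AbsolutelyContinuous.rfl)

theorem measurePreserving_sub (z : Eu n) :
    MeasurePreserving (fun y : Eu n => y - z) volume volume :=
  measurePreserving_sub_right volume z

theorem eLpNorm_comp_sub {f : Eu n → ℝ} {q : ℝ≥0∞} (hf : AEStronglyMeasurable f volume)
    (z : Eu n) : eLpNorm (fun y => f (y - z)) q volume = eLpNorm f q volume :=
  eLpNorm_comp_measurePreserving hf (measurePreserving_sub z)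

variable {q : ℝ≥0∞}

theorem memLp_comp_sub {f : Eu n → ℝ} (hf : MemLp f q volume) (z : Eu n) :
    MemLp (fun y => f (y - z)) q volume :=
  hf.comp_measurePreserving (measurePreserving_sub z)

theorem lintegral_enorm_ne_top {k : Eu n → ℝ} (hk : Continuous k) (hkc : HasCompactSupport k) :
    ∫⁻ z, ‖k z‖ₑ ≠ ⊤ :=
  (hk.integrable_of_hasCompactSupport hkc).2.ne

/-- **Young's inequality** for the convolution with a test function. -/
theorem eLpNorm_cv_le {k f : Eu n → ℝ} (hq : 1 ≤ q) (hq' : q ≠ ⊤) (hk : Continuous k)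
    (hkc : HasCompactSupport k) (hf : AEStronglyMeasurable f volume) :
    eLpNorm (cv k f) q volume ≤ eLpNorm f q volume * ∫⁻ z, ‖k z‖ₑ := by
  have h : cv k f = fun y => ∫ z, f (y - z) * k z := funext (cv_eq_integral_sub k f)
  rw [h]
  exact eLpNorm_integral_mul_le hq hq' (aestronglyMeasurable_sub hf le_rfl) hk.measurable
    (lintegral_enorm_ne_top hk hkc) fun z _ => (eLpNorm_comp_sub hf z).le

theorem memLp_cv {k f : Eu n → ℝ} (hq : 1 ≤ q) (hq' : q ≠ ⊤) (hk : ContDiff ℝ ∞ k)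
    (hkc : HasCompactSupport k) (hf : MemLp f q volume) : MemLp (cv k f) q volume :=
  ⟨(contDiff_cv hk hkc (hf.locallyIntegrable hq)).continuous.aestronglyMeasurable,
    (eLpNorm_cv_le hq hq' hk.continuous hkc hf.aestronglyMeasurable).trans_lt
      (ENNReal.mul_lt_top hf.2 (lintegral_enorm_ne_top hk.continuous hkc).lt_top)⟩

/-- Continuity of translations in `L^q`. -/
theorem exists_translate_le {f : Eu n → ℝ} (hq : 1 ≤ q) (hq' : q ≠ ⊤) (hf : MemLp f q volume)
    {δ : ℝ≥0∞} (hδ : 0 < δ) :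
    ∃ r : ℝ, 0 < r ∧ ∀ z : Eu n, ‖z‖ ≤ r → eLpNorm (fun y => f (y - z) - f y) q volume ≤ δ := by
  have : Fact (1 ≤ q) := ⟨hq⟩
  -- Translations depend continuously on `z` in the compact-open topology, and composition with
  -- measure preserving maps is then continuous into `L^q`, as `q` is finite.
  have hc : Continuous fun z : Eu n =>
      (⟨fun y => y - z, by fun_prop⟩ : C(Eu n, Eu n)) := by
    refine ContinuousMap.continuous_of_continuous_uncurry _ ?_
    exact continuous_snd.sub continuous_fst
  have h1 := Continuous.compMeasurePreservingLp (continuous_const (y := hf.toLp f)) hc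
    (fun z => measurePreserving_sub z) hq'
  have h2 : Tendsto (fun z : Eu n => eLpNorm (fun y => f (y - z) - f y) q volume) (𝓝 0) (𝓝 0) := by
    have h3 := (EMetric.tendsto_nhds.mp (h1.tendsto 0))
    rw [ENNReal.tendsto_nhds_zero]
    intro η hη
    filter_upwards [h3 η hη] with z hz
    have e0 : (Lp.compMeasurePreserving (fun y : Eu n => y - 0) (measurePreserving_sub 0))
        (hf.toLp f) = hf.toLp f := by
      rw [Lp.toLp_compMeasurePreserving]
      congr 1
      ext y; simp
    refine le_trans (le_of_eq ?_) hz.le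
    have e1 : ((⟨fun y => y - z, by fun_prop⟩ : C(Eu n, Eu n)) : Eu n → Eu n) = fun y => y - z := rfl
    have e2 : ((⟨fun y => y - 0, by fun_prop⟩ : C(Eu n, Eu n)) : Eu n → Eu n) = fun y => y - 0 := rfl
    simp only [e1, e2]
    rw [e0, Lp.toLp_compMeasurePreserving, Lp.edist_toLp_toLp]
    rfl
  obtain ⟨r, hr, hrr⟩ := Metric.eventually_nhds_iff.mp ((ENNReal.tendsto_nhds_zero.mp h2) δ hδ)
  refine ⟨r / 2, by positivity, fun z hz => hrr ?_⟩
  rw [dist_zero_right]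
  linarith

end Convolution

/-! ### Mollifiers -/

section Mollify

variable {n : ℕ}

/-- The rescaled function `x ↦ ε⁻ⁿ k(x / ε)`. -/
def dil (k : Eu n → ℝ) (ε : ℝ) (x : Eu n) : ℝ := (ε ^ n)⁻¹ * k (ε⁻¹ • x)

theorem contDiff_dil {k : Eu n → ℝ} (hk : ContDiff ℝ ∞ k) (ε : ℝ) : ContDiff ℝ ∞ (dil k ε) :=
  contDiff_const.mul (hk.comp (contDiff_id.const_smul ε⁻¹))

theorem pderiv_dil {k : Eu n → ℝ} (hk : ContDiff ℝ ∞ k) (ε : ℝ) (a : Fin n) (x : Eu n) :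
    pderiv a (dil k ε) x = ε⁻¹ * dil (pderiv a k) ε x := by
  have h1 : HasFDerivAt (fun x : Eu n => ε⁻¹ • x) (ε⁻¹ • ContinuousLinearMap.id ℝ (Eu n)) x :=
    (hasFDerivAt_id x).const_smul ε⁻¹
  have h2 := ((hk.differentiable (by simp)).differentiableAt (x := ε⁻¹ • x)).hasFDerivAt.comp x h1
  have h3 := h2.const_mul (ε ^ n)⁻¹
  have h4 : fderiv ℝ (dil k ε) x = _ := h3.fderiv
  rw [pderiv, h4]
  simp only [dil, pderiv, smul_apply, ContinuousLinearMap.comp_apply,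
    ContinuousLinearMap.id_apply, map_smul, smul_eq_mul]
  ring

theorem dil_eq_zero {k : Eu n → ℝ} (hk : tsupport k ⊆ Metric.closedBall 0 1) {ε : ℝ} (hε : 0 < ε)
    {z : Eu n} (hz : ε < ‖z‖) : dil k ε z = 0 := by
  have : k (ε⁻¹ • z) = 0 := by
    refine image_eq_zero_of_notMem_tsupport fun h => ?_
    have := hk h
    rw [mem_closedBall_zero_iff, norm_smul, norm_inv, Real.norm_of_nonneg hε.le,
      inv_mul_le_iff₀ hε, mul_one] at this
    linarith
  simp [dil, this]

theorem hasCompactSupport_dil {k : Eu n → ℝ} (hk : tsupport k ⊆ Metric.closedBall 0 1) {ε : ℝ}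
    (hε : 0 < ε) : HasCompactSupport (dil k ε) :=
  HasCompactSupport.intro (isCompact_closedBall 0 ε) fun z hz =>
    dil_eq_zero hk hε (by simpa using hz)

theorem integral_dil (k : Eu n → ℝ) {ε : ℝ} (hε : 0 < ε) : ∫ x, dil k ε x = ∫ x, k x := by
  simp only [dil]
  rw [integral_const_mul, Measure.integral_comp_inv_smul_of_nonneg volume k hε.le]
  simp [hε.ne']

theorem lintegral_dil {k : Eu n → ℝ} (hk : Continuous k)
    (hk1 : tsupport k ⊆ Metric.closedBall 0 1) {ε : ℝ} (hε : 0 < ε) :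
    ∫⁻ x, ‖dil k ε x‖ₑ = ∫⁻ x, ‖k x‖ₑ := by
  have hkc : HasCompactSupport k := (isCompact_closedBall 0 1).of_isClosed_subset
    (isClosed_tsupport k) hk1
  have hdc : Continuous (dil k ε) := continuous_const.mul (hk.comp (continuous_const_smul _))
  rw [← ofReal_integral_norm_eq_lintegral_enorm (hk.integrable_of_hasCompactSupport hkc),
    ← ofReal_integral_norm_eq_lintegral_enorm
      (hdc.integrable_of_hasCompactSupport (hasCompactSupport_dil hk1 hε)),
    ← integral_dil (fun x => ‖k x‖) hε]
  congr 1
  refine integral_congr_ae (Eventually.of_forall fun x => ?_)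
  simp only [dil, norm_mul, norm_inv, norm_pow, Real.norm_of_nonneg hε.le]

variable (ρ : Mollifier n)

theorem Mollifier.scaled_eq_dil (ε : ℝ) : ρ.scaled ε = dil ρ.toFun ε := rfl

theorem Mollifier.contDiff_scaled (ε : ℝ) : ContDiff ℝ ∞ (ρ.scaled ε) := contDiff_dil ρ.smooth ε

theorem Mollifier.hasCompactSupport_scaled {ε : ℝ} (hε : 0 < ε) :
    HasCompactSupport (ρ.scaled ε) := hasCompactSupport_dil ρ.supp hε

theorem Mollifier.scaled_eq_zero {ε : ℝ} (hε : 0 < ε) {z : Eu n} (hz : ε < ‖z‖) :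
    ρ.scaled ε z = 0 := dil_eq_zero ρ.supp hε hz

theorem Mollifier.scaled_nonneg {ε : ℝ} (hε : 0 < ε) (z : Eu n) : 0 ≤ ρ.scaled ε z :=
  mul_nonneg (by positivity) (ρ.nonneg _)

theorem Mollifier.integral_scaled {ε : ℝ} (hε : 0 < ε) : ∫ z, ρ.scaled ε z = 1 :=
  (integral_dil _ hε).trans ρ.integral_eq_one

theorem Mollifier.lintegral_scaled {ε : ℝ} (hε : 0 < ε) : ∫⁻ z, ‖ρ.scaled ε z‖ₑ = 1 := by
  rw [← ofReal_integral_norm_eq_lintegral_enorm ((ρ.contDiff_scaled ε).continuous.integrable_of_hasCompactSupport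
    (ρ.hasCompactSupport_scaled hε))]
  simp only [Real.norm_of_nonneg (ρ.scaled_nonneg hε _)]
  rw [ρ.integral_scaled hε, ENNReal.ofReal_one]

theorem Mollifier.pderiv_scaled_eq_zero {ε : ℝ} (hε : 0 < ε) (a : Fin n) {z : Eu n}
    (hz : ε < ‖z‖) : pderiv a (ρ.scaled ε) z = 0 := by
  rw [ρ.scaled_eq_dil, pderiv_dil ρ.smooth,
    dil_eq_zero ((tsupport_pderiv_subset a _).trans ρ.supp) hε hz, mul_zero]

/-- A derivative on the mollifier costs exactly a factor `ε⁻¹`; this is the loss which the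
commutator estimate has to make up for. -/
theorem Mollifier.lintegral_pderiv_scaled {ε : ℝ} (hε : 0 < ε) (a : Fin n) :
    ∫⁻ z, ‖pderiv a (ρ.scaled ε) z‖ₑ =
      ENNReal.ofReal ε⁻¹ * ∫⁻ z, ‖pderiv a ρ.toFun z‖ₑ := by
  have hc := (contDiff_pderiv ρ.smooth a).continuous
  rw [← lintegral_dil hc ((tsupport_pderiv_subset a _).trans ρ.supp) hε,
    ← lintegral_const_mul' _ _ ENNReal.ofReal_ne_top]
  refine lintegral_congr fun z => ?_
  rw [ρ.scaled_eq_dil, pderiv_dil ρ.smooth, enorm_mul, Real.enorm_of_nonneg (by positivity)]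

variable {q : ℝ≥0∞}

/-- Since `k` has integral one, `f y` can be put under the integral; differences of translates then
control the mollification error. -/
theorem cv_sub_self_eq {k f : Eu n → ℝ} (hk : Continuous k) (hkc : HasCompactSupport k)
    (hk1 : ∫ z, k z = 1) (hf : LocallyIntegrable f volume) (y : Eu n) :
    cv k f y - f y = ∫ z, (f (y - z) - f y) * k z := by
  simp only [sub_mul]
  rw [integral_sub (integrable_cv_sub hk hkc hf y)
    ((hk.integrable_of_hasCompactSupport hkc).const_mul _), integral_const_mul, hk1, mul_one,
    cv_eq_integral_sub]

/-- If the translates of `f` by vectors of length at most `ε` differ from `f` by at most `C` in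
`L^q`, then so does the mollification of `f` at scale `ε`. -/
theorem Mollifier.eLpNorm_cv_sub_le {f : Eu n → ℝ} (hq : 1 ≤ q) (hq' : q ≠ ⊤)
    (hf : MemLp f q volume) {ε : ℝ} (hε : 0 < ε) {C : ℝ≥0∞}
    (h : ∀ z : Eu n, ‖z‖ ≤ ε → eLpNorm (fun y => f (y - z) - f y) q volume ≤ C) :
    eLpNorm (fun y => cv (ρ.scaled ε) f y - f y) q volume ≤ C := by
  have hk := (ρ.contDiff_scaled ε).continuous
  have hkc := ρ.hasCompactSupport_scaled hε
  simp only [cv_sub_self_eq hk hkc (ρ.integral_scaled hε) (hf.locallyIntegrable hq)]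
  have := eLpNorm_integral_mul_le (μ := volume) (ν := volume) hq hq'
    (f := fun y z : Eu n => f (y - z) - f y) (k := ρ.scaled ε) (C := C)
    ((aestronglyMeasurable_sub hf.aestronglyMeasurable le_rfl).sub
      hf.aestronglyMeasurable.comp_fst) hk.measurable
    (by rw [ρ.lintegral_scaled hε]; simp) (fun z hz => h z (by
      by_contra hc
      exact hz (ρ.scaled_eq_zero hε (not_le.mp hc))))
  rwa [ρ.lintegral_scaled hε, mul_one] at this

theorem eventually_pos : ∀ᶠ ε in 𝓝[>] (0 : ℝ), 0 < ε := eventually_mem_nhdsWithin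

theorem eventually_le_pos {r : ℝ} (hr : 0 < r) : ∀ᶠ ε in 𝓝[>] (0 : ℝ), ε ≤ r :=
  (eventually_le_nhds hr).filter_mono nhdsWithin_le_nhds

/-- Mollifications converge in `L^q`. -/
theorem Mollifier.tendsLp_cv {f : Eu n → ℝ} (hq : 1 ≤ q) (hq' : q ≠ ⊤) (hf : MemLp f q volume) :
    TendsLp q volume (fun ε => cv (ρ.scaled ε) f) f := by
  refine tendsLp_of_le (B := fun ε => eLpNorm (fun y => cv (ρ.scaled ε) f y - f y) q volume)
    ?_ hf ?_ (Eventually.of_forall fun _ => le_rfl)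
  · filter_upwards [eventually_pos] with ε hε
    exact (memLp_cv hq hq' (ρ.contDiff_scaled ε) (ρ.hasCompactSupport_scaled hε)
      hf).aestronglyMeasurable
  · rw [ENNReal.tendsto_nhds_zero]
    intro δ hδ
    obtain ⟨r, hr, h⟩ := exists_translate_le hq hq' hf hδ
    filter_upwards [eventually_pos, eventually_le_pos hr] with ε hε hεr
    exact ρ.eLpNorm_cv_sub_le hq hq' hf hε fun z hz => h z (hz.trans hεr)

/-- Mollifications of continuous functions with compact support converge uniformly. -/
theorem Mollifier.tendstoUniformly_cv {f : Eu n → ℝ} (hf : Continuous f)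
    (hfc : HasCompactSupport f) :
    TendstoUniformly (fun ε => cv (ρ.scaled ε) f) f (𝓝[>] (0 : ℝ)) := by
  rw [Metric.tendstoUniformly_iff]
  intro δ hδ
  obtain ⟨r, hr, h⟩ := Metric.uniformContinuous_iff.mp (hf.uniformContinuous_of_tendsto_cocompact
    hfc.is_zero_at_infty) (δ / 2) (by positivity)
  filter_upwards [eventually_pos, eventually_le_pos (half_pos hr)] with ε hε hεr y
  have hk := (ρ.contDiff_scaled ε).continuous
  have hkc := ρ.hasCompactSupport_scaled hε
  rw [dist_comm, Real.dist_eq, cv_sub_self_eq hk hkc (ρ.integral_scaled hε) hf.locallyIntegrable]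
  have hb : ‖∫ z, (f (y - z) - f y) * ρ.scaled ε z‖ ≤ ∫ z, δ / 2 * ρ.scaled ε z := by
    refine norm_integral_le_of_norm_le ((hk.integrable_of_hasCompactSupport hkc).const_mul _)
      (Eventually.of_forall fun z => ?_)
    rw [norm_mul, Real.norm_of_nonneg (ρ.scaled_nonneg hε z)]
    by_cases hz : ε < ‖z‖
    · simp [ρ.scaled_eq_zero hε hz]
    · refine mul_le_mul_of_nonneg_right ?_ (ρ.scaled_nonneg hε z)
      have := h (a := y - z) (b := y) (by simp; linarith)
      rw [Real.dist_eq] at this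
      exact this.le
  rw [integral_const_mul, ρ.integral_scaled hε, mul_one] at hb
  rw [← Real.norm_eq_abs]
  linarith

end Mollify


/-! ### Weak derivatives and translations -/

section WeakTranslate

variable {n : ℕ} {p q : ℝ≥0∞}

theorem sum_smul_stdVec (v : Eu n) : ∑ a, v a • stdVec a = v := by
  ext i
  simp [stdVec, Pi.single_apply]

theorem fderiv_eq_sum_pderiv (f : Eu n → ℝ) (x v : Eu n) :
    fderiv ℝ f x v = ∑ a, v a * pderiv a f x := by
  conv_lhs => rw [← sum_smul_stdVec v]
  simp [pderiv]

theorem abs_apply_le_norm (v : Eu n) (a : Fin n) : |v a| ≤ ‖v‖ := by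
  rw [← Real.norm_eq_abs]
  exact PiLp.norm_apply_le v a

/-- Fundamental theorem of calculus along the segment from `y` to `y - z`, followed by Minkowski's
inequality in the segment parameter. -/
theorem eLpNorm_translate_sub_le_of_contDiff {g : Eu n → ℝ} (hp : 1 ≤ p) (hp' : p ≠ ⊤)
    (hg : ContDiff ℝ ∞ g) (z : Eu n) :
    eLpNorm (fun y => g (y - z) - g y) p volume ≤
      ENNReal.ofReal ‖z‖ * ∑ a, eLpNorm (pderiv a g) p volume := by
  set Φ : Eu n → ℝ → ℝ := fun y t => ∑ a, -(z a) * pderiv a g (y - t • z) with hΦ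
  have hd : ∀ a, Continuous (pderiv a g) := fun a => (contDiff_pderiv hg a).continuous
  have hΦc : Continuous (Function.uncurry Φ) := by
    refine continuous_finsetSum _ fun a _ => continuous_const.mul ((hd a).comp ?_)
    exact continuous_fst.sub (continuous_snd.smul continuous_const)
  have h1 : ∀ y, g (y - z) - g y = ∫ t in Ioc (0 : ℝ) 1, Φ y t * 1 := by
    intro y
    have hD : ∀ t : ℝ, HasDerivAt (fun t : ℝ => g (y - t • z)) (Φ y t) t := by
      intro t
      have e1 : HasDerivAt (fun t : ℝ => y - t • z) (-z) t := by
        simpa using ((hasDerivAt_id t).smul_const z).const_sub y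
      have e2 := ((hg.differentiable (by simp)).differentiableAt
        (x := y - t • z)).hasFDerivAt.comp_hasDerivAt t e1
      rw [fderiv_eq_sum_pderiv] at e2
      exact e2
    have := intervalIntegral.integral_eq_sub_of_hasDerivAt (a := 0) (b := 1)
      (fun t _ => hD t) ((hΦc.comp (Continuous.prodMk_right y)).intervalIntegrable 0 1)
    rw [intervalIntegral.integral_of_le zero_le_one] at this
    simpa using this.symm
  simp only [h1]
  have h2 := eLpNorm_integral_mul_le (μ := (volume : Measure (Eu n)))
    (ν := (volume : Measure ℝ).restrict (Ioc 0 1)) hp hp' (f := Φ) (k := fun _ => 1)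
    (C := ENNReal.ofReal ‖z‖ * ∑ a, eLpNorm (pderiv a g) p volume)
    hΦc.aestronglyMeasurable measurable_const (by simp) (fun t _ => by
      have e : (fun y => Φ y t) = ∑ a, (fun y => -(z a) * pderiv a g (y - t • z)) := by
        ext y; simp [hΦ]
      rw [e]
      refine (eLpNorm_sum_le (fun a _ => (continuous_const.mul ((hd a).comp
        (continuous_id.sub continuous_const))).aestronglyMeasurable) hp).trans ?_
      rw [Finset.mul_sum]
      refine Finset.sum_le_sum fun a _ => ?_
      have e2 : (fun y => -(z a) * pderiv a g (y - t • z)) =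
        (-(z a)) • (fun y => pderiv a g (y - t • z)) := rfl
      change eLpNorm (fun y => -(z a) * pderiv a g (y - t • z)) p volume ≤ _
      rw [e2, eLpNorm_const_smul, eLpNorm_comp_sub (hd a).aestronglyMeasurable]
      gcongr
      rw [enorm_neg, Real.enorm_eq_ofReal_abs]
      exact ENNReal.ofReal_le_ofReal (abs_apply_le_norm z a))
  simpa using h2

/-- Apply the smooth estimate to mollifications of `f`, whose gradients are mollifications of `w`
and hence no larger in norm. The mollifier is auxiliary and disappears in the limit. -/
theorem eLpNorm_translate_sub_le (ρ : Mollifier n) {f : Eu n → ℝ} {w : Fin n → Eu n → ℝ}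
    (hp : 1 ≤ p) (hp' : p ≠ ⊤) (hf : MemLp f p volume) (hw : ∀ a, MemLp (w a) p volume)
    (hfw : ∀ a, WeakD univ a f (w a)) (z : Eu n) :
    eLpNorm (fun y => f (y - z) - f y) p volume ≤
      ENNReal.ofReal ‖z‖ * ∑ a, eLpNorm (w a) p volume := by
  have hT := (ρ.tendsLp_cv hp hp' hf).2.2
  have hlim : Tendsto (fun ε => eLpNorm (fun y => cv (ρ.scaled ε) f y - f y) p volume +
      eLpNorm (fun y => cv (ρ.scaled ε) f y - f y) p volume +
      ENNReal.ofReal ‖z‖ * ∑ a, eLpNorm (w a) p volume) (𝓝[>] (0 : ℝ))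
      (𝓝 (0 + 0 + ENNReal.ofReal ‖z‖ * ∑ a, eLpNorm (w a) p volume)) :=
    (hT.add hT).add tendsto_const_nhds
  rw [zero_add, zero_add] at hlim
  refine ge_of_tendsto hlim ?_
  filter_upwards [eventually_pos] with ε hε
  have hk := ρ.contDiff_scaled ε
  have hkc := ρ.hasCompactSupport_scaled hε
  have hfl := hf.locallyIntegrable hp
  set F := cv (ρ.scaled ε) f with hF
  have hFL : MemLp F p volume := memLp_cv hp hp' hk hkc hf
  have e : (fun y => f (y - z) - f y) = (fun y => f (y - z) - F (y - z)) +
      ((fun y => F y - f y) + fun y => F (y - z) - F y) := by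
    ext y; simp only [Pi.add_apply]; ring
  have m1 := ((memLp_comp_sub hf z).sub (memLp_comp_sub hFL z)).aestronglyMeasurable
  have m2 := (hFL.sub hf).aestronglyMeasurable
  have m3 := ((memLp_comp_sub hFL z).sub hFL).aestronglyMeasurable
  rw [e, add_assoc]
  refine (eLpNorm_add_le m1 (m2.add m3) hp).trans (add_le_add ?_
    ((eLpNorm_add_le m2 m3 hp).trans (add_le_add le_rfl ?_)))
  · have := eLpNorm_comp_sub (q := p) (f := fun y => f y - F y) (hf.sub hFL).aestronglyMeasurable z
    change eLpNorm (fun y => f (y - z) - F (y - z)) p volume ≤ _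
    rw [this, ← eLpNorm_neg]
    refine le_of_eq (congrArg (fun h => eLpNorm h p volume) ?_)
    ext y; simp
  · refine (eLpNorm_translate_sub_le_of_contDiff hp hp' (contDiff_cv hk hkc hfl) z).trans ?_
    gcongr with a
    rw [pderiv_cv hk hkc hfl, cv_pderiv_of_weakD (hfw a) hk hkc]
    refine (eLpNorm_cv_le hp hp' hk.continuous hkc (hw a).aestronglyMeasurable).trans ?_
    rw [ρ.lintegral_scaled hε, mul_one]

/-- Only displacements of length at most `ε` enter the mollification, so the translation estimate
yields a rate and not merely convergence. -/
theorem Mollifier.rateLp_cv (ρ : Mollifier n) {f : Eu n → ℝ} {w : Fin n → Eu n → ℝ}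
    (hp : 1 ≤ p) (hp' : p ≠ ⊤) (hf : MemLp f p volume) (hw : ∀ a, MemLp (w a) p volume)
    (hfw : ∀ a, WeakD univ a f (w a)) : RateLp p volume (fun ε => cv (ρ.scaled ε) f) f := by
  refine ⟨∑ a, eLpNorm (w a) p volume, ?_, ?_⟩
  · exact (ENNReal.sum_lt_top.mpr fun a _ => (hw a).2).ne
  · filter_upwards [eventually_pos] with ε hε
    refine ρ.eLpNorm_cv_sub_le hp hp' hf hε fun z hz => ?_
    refine (eLpNorm_translate_sub_le ρ hp hp' hf hw hfw z).trans ?_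
    rw [mul_comm]
    gcongr

theorem integrable_mul_of_tsupport_subset {U : Set (Eu n)} {f ψ : Eu n → ℝ}
    (hf : LocallyIntegrableOn f U volume) (hψ : Continuous ψ) (hc : HasCompactSupport ψ)
    (hs : tsupport ψ ⊆ U) : Integrable (fun z => f z * ψ z) volume := by
  have h1 : IntegrableOn f (tsupport ψ) volume := hf.integrableOn_compact_subset hs hc.isCompact
  have h2 : IntegrableOn (fun z => f z * ψ z) (tsupport ψ) volume :=
    h1.mul_continuousOn hψ.continuousOn hc.isCompact
  rwa [integrableOn_iff_integrable_of_support_subset] at h2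
  exact (Function.support_mul_subset_right f ψ).trans (subset_tsupport ψ)

theorem pderiv_mul {f g : Eu n → ℝ} {x : Eu n} (hf : DifferentiableAt ℝ f x)
    (hg : DifferentiableAt ℝ g x) (a : Fin n) :
    pderiv a (fun z => f z * g z) x = pderiv a f x * g x + f x * pderiv a g x := by
  rw [pderiv, fderiv_fun_mul hf hg]
  simp only [pderiv, add_apply, smul_apply, smul_eq_mul]
  ring

/-- Multiplication by a cut-off function extends a weak derivative by zero. -/
theorem WeakD.cutoff {U : Set (Eu n)} {a : Fin n} {f w η : Eu n → ℝ} (h : WeakD U a f w)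
    (hf : LocallyIntegrableOn f U volume) (hw : LocallyIntegrableOn w U volume)
    (hη : ContDiff ℝ ∞ η) (hηc : HasCompactSupport η) (hηs : tsupport η ⊆ U) :
    WeakD univ a (fun z => η z * f z) (fun z => η z * w z + pderiv a η z * f z) := by
  intro φ hφ hφc _
  have hηφ : ContDiff ℝ ∞ fun z => η z * φ z := hη.mul hφ
  have hs : ∀ ψ : Eu n → ℝ, tsupport (fun z => η z * ψ z) ⊆ U := fun ψ =>
    (tsupport_mul_subset_left (f := η) (g := ψ)).trans hηs
  have hcs : ∀ ψ : Eu n → ℝ, HasCompactSupport (fun z => η z * ψ z) := fun ψ =>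
    hηc.mul_right (f' := ψ)
  have h1 := h _ hηφ (hcs φ) (hs φ)
  have hd : ∀ z, pderiv a (fun z => η z * φ z) z = pderiv a η z * φ z + η z * pderiv a φ z :=
    fun z => pderiv_mul (hη.differentiable (by simp)).differentiableAt
      (hφ.differentiable (by simp)).differentiableAt a
  have i1 : Integrable (fun z => f z * (pderiv a η z * φ z)) volume := by
    refine integrable_mul_of_tsupport_subset hf
      ((contDiff_pderiv hη a).continuous.mul hφ.continuous)
      ((hasCompactSupport_pderiv hηc a).mul_right (f' := φ)) ?_
    exact (tsupport_mul_subset_left (f := pderiv a η) (g := φ)).trans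
      ((tsupport_pderiv_subset a η).trans hηs)
  have i2 : Integrable (fun z => f z * (η z * pderiv a φ z)) volume :=
    integrable_mul_of_tsupport_subset hf (hη.continuous.mul (contDiff_pderiv hφ a).continuous)
      (hcs _) (hs _)
  have i3 : Integrable (fun z => w z * (η z * φ z)) volume :=
    integrable_mul_of_tsupport_subset hw hηφ.continuous (hcs _) (hs _)
  have e1 : ∫ z, f z * pderiv a (fun z => η z * φ z) z =
      (∫ z, f z * (pderiv a η z * φ z)) + ∫ z, f z * (η z * pderiv a φ z) := by
    rw [← integral_add i1 i2]
    refine integral_congr_ae (Eventually.of_forall fun z => ?_)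
    simp only [hd]; ring
  have e2 : ∫ z, (η z * w z + pderiv a η z * f z) * φ z =
      (∫ z, w z * (η z * φ z)) + ∫ z, f z * (pderiv a η z * φ z) := by
    rw [← integral_add i3 i1]
    refine integral_congr_ae (Eventually.of_forall fun z => ?_)
    ring
  have e3 : ∫ z, η z * f z * pderiv a φ z = ∫ z, f z * (η z * pderiv a φ z) :=
    integral_congr_ae (Eventually.of_forall fun z => by ring)
  rw [e2, e3]
  linarith

end WeakTranslate

/-! ### The commutator estimate -/

section Commutator

variable {n : ℕ} {p q : ℝ≥0∞}

theorem RateLp.tendsLp {α : Type*} [MeasurableSpace α] {μ : Measure α} {F : ℝ → α → ℝ} {f : α → ℝ}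
    (h : RateLp p μ F f) (hF : ∀ᶠ ε in 𝓝[>] (0 : ℝ), AEStronglyMeasurable (F ε) μ)
    (hf : MemLp f p μ) : TendsLp p μ F f := by
  obtain ⟨C, hC, h⟩ := h
  refine tendsLp_of_le hF hf ?_ h
  have h1 : Tendsto (fun ε : ℝ => C * ENNReal.ofReal ε) (𝓝 0) (𝓝 (C * ENNReal.ofReal 0)) :=
    ENNReal.Tendsto.const_mul (ENNReal.continuous_ofReal.tendsto 0) (Or.inr hC)
  simpa using h1.mono_left nhdsWithin_le_nhds

/-- Written as one integral, the integrand is `(b (y - z) - B y) w (y - z)` times the derivative of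
the mollifier at `z`. For `‖z‖ ≤ ε` the first factor is `O(ε)` in `L^p`, which balances the mass
`ε⁻¹` of the kernel. The bound does not depend on `ε` and is linear in the norm of `w`, so limits
need only be computed for smooth `w`. -/
theorem eLpNorm_commutator_le [ENNReal.HolderTriple p p q] (ρ : Mollifier n) (hp : 1 ≤ p)
    (hq : 1 ≤ q) (hq' : q ≠ ⊤) {L : Set (Eu n)} {b B w : Eu n → ℝ} (hb : Continuous b)
    (hB : AEStronglyMeasurable B (volume.restrict L)) (hw : MemLp w p volume) {ε : ℝ} (hε : 0 < ε)
    {C C' : ℝ≥0∞} (hbt : ∀ z : Eu n, eLpNorm (fun y => b (y - z) - b y) p volume ≤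
      ENNReal.ofReal ‖z‖ * C)
    (hBb : eLpNorm (fun y => B y - b y) p (volume.restrict L) ≤ C' * ENNReal.ofReal ε)
    (a : Fin n) :
    eLpNorm (fun y => cv (pderiv a (ρ.scaled ε)) (fun z => b z * w z) y -
      B y * cv (pderiv a (ρ.scaled ε)) w y) q (volume.restrict L) ≤
      (C + C') * (∫⁻ z, ‖pderiv a ρ.toFun z‖ₑ) * eLpNorm w p volume := by
  set k := pderiv a (ρ.scaled ε) with hk
  have hkc : Continuous k := (contDiff_pderiv (ρ.contDiff_scaled ε) a).continuous
  have hks : HasCompactSupport k := hasCompactSupport_pderiv (ρ.hasCompactSupport_scaled hε) a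
  have hwl := hw.locallyIntegrable hp
  have hbw : LocallyIntegrable (fun z => b z * w z) volume := by
    have := hwl.locallyIntegrableOn univ |>.continuousOn_mul hb.continuousOn
      isOpen_univ.isLocallyClosed
    rwa [locallyIntegrableOn_univ] at this
  have e : (fun y => cv k (fun z => b z * w z) y - B y * cv k w y) =
      fun y => ∫ z, ((b (y - z) - B y) * w (y - z)) * k z := by
    ext y
    rw [cv_eq_integral_sub, cv_eq_integral_sub, ← integral_const_mul,
      ← integral_sub (integrable_cv_sub hkc hks hbw y)
        ((integrable_cv_sub hkc hks hwl y).const_mul _)]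
    refine integral_congr_ae (Eventually.of_forall fun z => ?_)
    ring
  rw [e]
  have hL : volume.restrict L ≤ (volume : Measure (Eu n)) := Measure.restrict_le_self
  have mw := aestronglyMeasurable_sub hw.aestronglyMeasurable hL
  have mb : AEStronglyMeasurable (Function.uncurry fun y z : Eu n => b (y - z) - B y)
      ((volume.restrict L).prod volume) :=
    (aestronglyMeasurable_sub hb.aestronglyMeasurable hL).sub hB.comp_fst
  refine (eLpNorm_integral_mul_le (μ := volume.restrict L) (ν := volume) hq hq'
    (f := fun y z => (b (y - z) - B y) * w (y - z)) (k := k)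
    (C := (C + C') * ENNReal.ofReal ε * eLpNorm w p volume) (mb.mul mw) hkc.measurable
    (lintegral_enorm_ne_top hkc hks) ?_).trans (le_of_eq ?_)
  · intro z hz
    have hzε : ‖z‖ ≤ ε := by
      by_contra hc
      exact hz (ρ.pderiv_scaled_eq_zero hε a (not_le.mp hc))
    have m1 : AEStronglyMeasurable (fun y => b (y - z) - b y) (volume.restrict L) :=
      ((hb.comp (continuous_id.sub continuous_const)).sub hb).aestronglyMeasurable
    have m2 : AEStronglyMeasurable (fun y => B y - b y) (volume.restrict L) :=
      hB.sub hb.aestronglyMeasurable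
    have e1 : (fun y => b (y - z) - B y) = (fun y => b (y - z) - b y) - fun y => B y - b y := by
      ext y; simp
    have h1 : eLpNorm (fun y => b (y - z) - B y) p (volume.restrict L) ≤
        (C + C') * ENNReal.ofReal ε := by
      rw [e1, add_mul]
      refine (eLpNorm_sub_le m1 m2 hp).trans (add_le_add ?_ hBb)
      refine (eLpNorm_mono_measure _ hL).trans ((hbt z).trans ?_)
      rw [mul_comm]
      gcongr
    have m3 := (memLp_comp_sub hw z).aestronglyMeasurable.mono_measure hL
    refine (eLpNorm_mul_le (p := p) (q := p) (by rw [e1]; exact m1.sub m2) m3).trans ?_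
    refine mul_le_mul' h1 ((eLpNorm_mono_measure _ hL).trans ?_)
    rw [eLpNorm_comp_sub hw.aestronglyMeasurable]
  · rw [hk, ρ.lintegral_pderiv_scaled hε]
    have : ENNReal.ofReal ε * ENNReal.ofReal ε⁻¹ = 1 := by
      rw [← ENNReal.ofReal_mul hε.le, mul_inv_cancel₀ hε.ne', ENNReal.ofReal_one]
    calc _ = (C + C') * (ENNReal.ofReal ε * ENNReal.ofReal ε⁻¹) *
          (∫⁻ z, ‖pderiv a ρ.toFun z‖ₑ) * eLpNorm w p volume := by ring
      _ = _ := by rw [this, mul_one]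

/-- The **Friedrichs commutator lemma**: if `b` has a weak gradient in `L^p`, `B ε = b + O(ε)` in
`L^p(L)` and `w ∈ L^p`, then `(b w) * ∂ρ_ε - B ε (w * ∂ρ_ε) → (∂b) w` in `L^q(L)`, `q = p / 2`. -/
theorem tendsLp_commutator [ENNReal.HolderTriple p p q] (ρ : Mollifier n) (hp : 1 ≤ p)
    (hp' : p ≠ ⊤) (hq : 1 ≤ q) (hq' : q ≠ ⊤) {L : Set (Eu n)} {b : Eu n → ℝ} (hb : Continuous b)
    (hbc : HasCompactSupport b) {W : Fin n → Eu n → ℝ} (hW : ∀ a, MemLp (W a) p volume)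
    (hbW : ∀ a, WeakD univ a b (W a)) {B : ℝ → Eu n → ℝ}
    (hB : ∀ᶠ ε in 𝓝[>] (0 : ℝ), AEStronglyMeasurable (B ε) (volume.restrict L))
    (hBb : RateLp p (volume.restrict L) B b) {w : Eu n → ℝ} (hw : MemLp w p volume)
    (hwc : HasCompactSupport w) (a : Fin n) :
    TendsLp q (volume.restrict L)
      (fun ε y => cv (pderiv a (ρ.scaled ε)) (fun z => b z * w z) y -
        B ε y * cv (pderiv a (ρ.scaled ε)) w y) (fun y => W a y * w y) := by
  have hL : volume.restrict L ≤ (volume : Measure (Eu n)) := Measure.restrict_le_self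
  have hbp : MemLp b p volume := hb.memLp_of_hasCompactSupport hbc
  have hbl : LocallyIntegrableOn b univ volume := hb.locallyIntegrable.locallyIntegrableOn _
  have hbt := eLpNorm_translate_sub_le ρ hp hp' hbp hW hbW
  have hWl : ∀ a, LocallyIntegrable (W a) volume := fun a => (hW a).locallyIntegrable hp
  obtain ⟨C', hC', hrate⟩ := id hBb
  set C := ∑ a, eLpNorm (W a) p volume with hCdef
  have hC : C ≠ ⊤ := (ENNReal.sum_lt_top.mpr fun a _ => (hW a).2).ne
  set m := ∫⁻ z, ‖pderiv a ρ.toFun z‖ₑ with hmdef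
  have hm : m ≠ ⊤ := lintegral_enorm_ne_top (contDiff_pderiv ρ.smooth a).continuous
    (hasCompactSupport_pderiv ((isCompact_closedBall 0 1).of_isClosed_subset
      (isClosed_tsupport _) ρ.supp) a)
  have hmulL : ∀ {u : Eu n → ℝ}, LocallyIntegrable u volume →
      LocallyIntegrable (fun z => b z * u z) volume := by
    intro u hu
    have := hu.locallyIntegrableOn univ |>.continuousOn_mul hb.continuousOn
      isOpen_univ.isLocallyClosed
    rwa [locallyIntegrableOn_univ] at this
  have hmeas : ∀ {u : Eu n → ℝ}, MemLp u p volume → ∀ᶠ ε in 𝓝[>] (0 : ℝ),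
      AEStronglyMeasurable (fun y => cv (pderiv a (ρ.scaled ε)) (fun z => b z * u z) y -
        B ε y * cv (pderiv a (ρ.scaled ε)) u y) (volume.restrict L) := by
    intro u hu
    filter_upwards [eventually_pos, hB] with ε hε hBε
    have hk := contDiff_pderiv (ρ.contDiff_scaled ε) a
    have hkc := hasCompactSupport_pderiv (ρ.hasCompactSupport_scaled hε) a
    have hul := hu.locallyIntegrable hp
    exact (contDiff_cv hk hkc (hmulL hul)).continuous.aestronglyMeasurable.sub
      (hBε.mul (contDiff_cv hk hkc hul).continuous.aestronglyMeasurable)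
  refine tendsLp_of_approx hq (hmeas hw) ((memLp_mul (p := p) (q := p) (hW a) hw).mono_measure hL) ?_
  intro δ hδ
  -- `T` dominates both constants met below, that of the uniform commutator bound and the norm of `W
  -- a`; the summand `1` makes it nonzero.
  set T := (C + C') * m + eLpNorm (W a) p volume + 1 with hT
  have hTt : T ≠ ⊤ := by
    have := (hW a).2.ne
    finiteness
  have hT0 : T ≠ 0 := by simp [hT]
  have hη : 0 < δ / T := ENNReal.div_pos hδ.ne' hTt
  -- The approximation of `w` is its mollification at one fixed scale `δ₀`; it is smooth and, as `w`
  -- has compact support, compactly supported.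
  obtain ⟨δ₀, hδ₀w, hδ₀⟩ := ((ENNReal.tendsto_nhds_zero.mp (ρ.tendsLp_cv hp hp' hw).2.2 _ hη).and
    eventually_pos).exists
  set w' := cv (ρ.scaled δ₀) w with hw'
  have hwl := hw.locallyIntegrable hp
  have hws : ContDiff ℝ ∞ w' :=
    contDiff_cv (ρ.contDiff_scaled δ₀) (ρ.hasCompactSupport_scaled hδ₀) hwl
  have hwsc : HasCompactSupport w' := hasCompactSupport_cv hwc (ρ.hasCompactSupport_scaled hδ₀)
  have hwp : MemLp w' p volume := hws.continuous.memLp_of_hasCompactSupport hwsc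
  have hwpl := hwp.locallyIntegrable hp
  have hdw : MemLp (pderiv a w') p volume :=
    (contDiff_pderiv hws a).continuous.memLp_of_hasCompactSupport (hasCompactSupport_pderiv hwsc a)
  have hbound : ∀ c : ℝ≥0∞, c ≤ T → c * (δ / T) ≤ δ := fun c hc =>
    (mul_le_mul' hc le_rfl).trans (le_of_eq (ENNReal.mul_div_cancel hT0 hTt))
  refine ⟨fun ε y => cv (pderiv a (ρ.scaled ε)) (fun z => b z * w' z) y -
    B ε y * cv (pderiv a (ρ.scaled ε)) w' y, fun y => W a y * w' y, ?_, ?_, ?_⟩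
  -- For smooth `w'` the derivative can be moved off the kernel: the expression becomes `∂(b w') *
  -- ρ_ε - B ε (∂w' * ρ_ε)`, with limit `∂(b w') - b ∂w' = (∂b) w'`.
  · have hWD := (hbW a).cutoff hbl ((hWl a).locallyIntegrableOn _) hws hwsc (subset_univ _)
    have hm1 : MemLp (fun z => w' z * W a z + pderiv a w' z * b z) q volume :=
      (memLp_mul (p := p) (q := p) hwp (hW a)).add (memLp_mul (p := p) (q := p) hdw hbp)
    have t1 := (ρ.tendsLp_cv hq hq' hm1).mono_measure hL
    have t2 := (hBb.tendsLp hB (hbp.mono_measure hL)).mul (r := q) hp hq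
      ((ρ.tendsLp_cv hp hp' hdw).mono_measure hL)
    refine (t1.sub hq t2).congr ?_ (Eventually.of_forall fun y => ?_)
    · filter_upwards [eventually_pos] with ε hε
      refine Eventually.of_forall fun y => ?_
      have hk := ρ.contDiff_scaled ε
      have hkc := ρ.hasCompactSupport_scaled hε
      have e1 := congrFun (cv_pderiv_of_weakD hWD hk hkc) y
      have hwd : WeakD univ a w' (pderiv a w') := by
        intro φ hφ hφc _
        have := integral_mul_fderiv_eq_neg_fderiv_mul_of_integrable (μ := (volume : Measure (Eu n)))
          (f := w') (g := φ) (v := stdVec a) (𝕜 := ℝ)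
          (((contDiff_pderiv hws a).continuous.mul hφ.continuous).integrable_of_hasCompactSupport
            (hφc.mul_left))
          ((hws.continuous.mul (contDiff_pderiv hφ a).continuous).integrable_of_hasCompactSupport
            (hwsc.mul_right))
          ((hws.continuous.mul hφ.continuous).integrable_of_hasCompactSupport hwsc.mul_right)
          (fun x _ => hws.differentiable (by simp) x) (fun x _ => hφ.differentiable (by simp) x)
        exact this
      have e2 := congrFun (cv_pderiv_of_weakD hwd hk hkc) y
      simp only
      rw [e2, ← e1]
      simp only [mul_comm (b _)]
    · simp only; ring
  · filter_upwards [eventually_pos, hB, hrate] with ε hε hBε hr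
    have hk := (contDiff_pderiv (ρ.contDiff_scaled ε) a).continuous
    have hkc := hasCompactSupport_pderiv (ρ.hasCompactSupport_scaled hε) a
    have hww : MemLp (fun z => w z - w' z) p volume := hw.sub hwp
    have h1 := eLpNorm_commutator_le (q := q) ρ hp hq hq' hb hBε hww hε hbt hr a
    refine le_trans (le_of_eq ?_) (h1.trans ((mul_le_mul' le_rfl ?_).trans (hbound ((C + C') * m) ?_)))
    · congr 1
      ext y
      have e1 := cv_sub hk hkc (hmulL hwl) (hmulL hwpl) y
      have e2 := cv_sub hk hkc hwl hwpl y
      rw [e2]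
      simp only [mul_sub]
      rw [e1]
      ring
    · rw [← eLpNorm_neg]
      refine le_trans (le_of_eq ?_) hδ₀w
      congr 1
      ext y; simp [hw']
    · rw [hT, add_assoc]
      exact le_self_add
  · have e1 : (fun y => W a y * w' y - W a y * w y) = fun y => W a y * (w' y - w y) := by
      ext y; ring
    rw [e1]
    refine (eLpNorm_mono_measure _ hL).trans ((eLpNorm_mul_le (p := p) (q := p)
      (hW a).aestronglyMeasurable (hwp.sub hw).aestronglyMeasurable).trans
      ((mul_le_mul' le_rfl hδ₀w).trans (hbound _ ?_)))
    rw [hT, add_comm ((C + C') * m), add_assoc]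
    exact le_self_add

end Commutator


/-! ### Families of smooth functions converging in `W^{1,p}` and uniformly -/

section SobConv

variable {n : ℕ} {p : ℝ≥0∞}

/-- The smooth functions `F ε` converge to `f` uniformly on `K`, at rate `O(ε)` in `L^p(K)`, and
their partial derivatives converge to `w a` in `L^p(K)`. -/
structure SobConv (p : ℝ≥0∞) (K : Set (Eu n)) (F : ℝ → Eu n → ℝ) (f : Eu n → ℝ)
    (w : Fin n → Eu n → ℝ) : Prop where
  smooth : ∀ᶠ ε in 𝓝[>] (0 : ℝ), ∀ y ∈ K, ContDiffAt ℝ ∞ (F ε) y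
  unif : TendstoUniformlyOn F f (𝓝[>] (0 : ℝ)) K
  rate : RateLp p (volume.restrict K) F f
  deriv : ∀ a, TendsLp p (volume.restrict K) (fun ε => pderiv a (F ε)) (w a)

theorem contDiffAt_pderiv {f : Eu n → ℝ} {y : Eu n} (hf : ContDiffAt ℝ ∞ f y) (a : Fin n) :
    ContDiffAt ℝ ∞ (pderiv a f) y :=
  (hf.fderiv_right (m := ∞) (by simp)).clm_apply contDiffAt_const

theorem continuousOn_of_contDiffAt {f : Eu n → ℝ} {K : Set (Eu n)}
    (h : ∀ y ∈ K, ContDiffAt ℝ ∞ f y) : ContinuousOn f K :=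
  fun y hy => (h y hy).continuousAt.continuousWithinAt

theorem memLp_of_continuousOn {f : Eu n → ℝ} {K : Set (Eu n)} (hK : IsCompact K)
    (hf : ContinuousOn f K) (q : ℝ≥0∞) : MemLp f q (volume.restrict K) := by
  have hfin : IsFiniteMeasure (volume.restrict K) := ⟨by simpa using hK.measure_lt_top⟩
  obtain ⟨C, hC⟩ := hK.exists_bound_of_continuousOn hf
  exact MemLp.of_bound (hf.aestronglyMeasurable hK.measurableSet) C
    ((ae_restrict_mem hK.measurableSet).mono fun x hx => hC x hx)

theorem pderiv_add {f g : Eu n → ℝ} {x : Eu n} (hf : DifferentiableAt ℝ f x)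
    (hg : DifferentiableAt ℝ g x) (a : Fin n) :
    pderiv a (fun z => f z + g z) x = pderiv a f x + pderiv a g x := by
  rw [pderiv, fderiv_fun_add hf hg]
  simp [pderiv]

theorem pderiv_sub {f g : Eu n → ℝ} {x : Eu n} (hf : DifferentiableAt ℝ f x)
    (hg : DifferentiableAt ℝ g x) (a : Fin n) :
    pderiv a (fun z => f z - g z) x = pderiv a f x - pderiv a g x := by
  rw [pderiv, fderiv_fun_sub hf hg]
  simp [pderiv]

theorem pderiv_sum {ι : Type*} (s : Finset ι) {f : ι → Eu n → ℝ} {x : Eu n}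
    (hf : ∀ i ∈ s, DifferentiableAt ℝ (f i) x) (a : Fin n) :
    pderiv a (fun z => ∑ i ∈ s, f i z) x = ∑ i ∈ s, pderiv a (f i) x := by
  rw [pderiv, fderiv_fun_sum hf]
  simp [pderiv]

theorem pderiv_inv {f : Eu n → ℝ} {x : Eu n} (hf : DifferentiableAt ℝ f x) (h0 : f x ≠ 0)
    (a : Fin n) : pderiv a (fun z => (f z)⁻¹) x = -pderiv a f x * ((f x)⁻¹ * (f x)⁻¹) := by
  have h := (hasDerivAt_inv h0).comp_hasFDerivAt x hf.hasFDerivAt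
  have h' : fderiv ℝ (fun z => (f z)⁻¹) x = _ := h.fderiv
  rw [pderiv, h']
  simp only [pderiv, smul_apply, smul_eq_mul]
  field_simp

theorem pderiv_congr {f g : Eu n → ℝ} {x : Eu n} (h : f =ᶠ[𝓝 x] g) (a : Fin n) :
    pderiv a f x = pderiv a g x := by
  rw [pderiv, h.fderiv_eq, pderiv]

theorem _root_.ContDiffAt.differentiableAt_infty {f : Eu n → ℝ} {x : Eu n} (h : ContDiffAt ℝ ∞ f x) :
    DifferentiableAt ℝ f x := h.differentiableAt (by simp)

/-- Compactness of `f '' K` makes continuity of `Φ` at its points uniform, also for comparison with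
nearby points outside that image, where the values of `F ε` may lie. -/
theorem tendstoUniformlyOn_comp {X Y : Type*} [UniformSpace X] [UniformSpace Y]
    {K : Set (Eu n)} (hK : IsCompact K) {F : ℝ → Eu n → X} {f : Eu n → X} {l : Filter ℝ}
    (hf : ContinuousOn f K) (hF : TendstoUniformlyOn F f l K) {Φ : X → Y}
    (hΦ : ∀ y ∈ K, ContinuousAt Φ (f y)) :
    TendstoUniformlyOn (fun ε y => Φ (F ε y)) (fun y => Φ (f y)) l K := by
  intro r hr
  have h := (hK.image_of_continuousOn hf).uniformContinuousAt_of_continuousAt Φ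
    (by rintro _ ⟨y, hy, rfl⟩; exact hΦ y hy) hr
  filter_upwards [hF _ h] with ε hε y hy
  exact hε y hy (mem_image_of_mem f hy)

variable {K : Set (Eu n)} {F G : ℝ → Eu n → ℝ} {f g : Eu n → ℝ} {w v : Fin n → Eu n → ℝ}

theorem SobConv.continuousOn (h : SobConv p K F f w) : ContinuousOn f K :=
  h.unif.continuousOn (h.smooth.mono fun _ hε => continuousOn_of_contDiffAt hε).frequently

theorem SobConv.tendsLp_top (hK : IsCompact K) (h : SobConv p K F f w) :
    TendsLp ∞ (volume.restrict K) F f :=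
  tendsLp_top_of_tendstoUniformlyOn hK.measurableSet
    (h.smooth.mono fun _ hε => (continuousOn_of_contDiffAt hε).aestronglyMeasurable hK.measurableSet)
    (memLp_of_continuousOn hK h.continuousOn _) h.unif

theorem SobConv.aestronglyMeasurable (hK : IsCompact K) (h : SobConv p K F f w) :
    ∀ᶠ ε in 𝓝[>] (0 : ℝ), AEStronglyMeasurable (F ε) (volume.restrict K) :=
  h.smooth.mono fun _ hε => (continuousOn_of_contDiffAt hε).aestronglyMeasurable hK.measurableSet

theorem SobConv.tendsLp (hp : 1 ≤ p) (hK : IsCompact K) (h : SobConv p K F f w) :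
    TendsLp p (volume.restrict K) F f :=
  have : IsFiniteMeasure (volume.restrict K) := ⟨by simpa using hK.measure_lt_top⟩
  (h.tendsLp_top hK).mono_exponent le_top hp

theorem SobConv.const (hK : IsCompact K) (hf : ∀ y ∈ K, ContDiffAt ℝ ∞ f y) :
    SobConv p K (fun _ => f) f (fun a => pderiv a f) where
  smooth := Eventually.of_forall fun _ => hf
  unif := by
    rw [Metric.tendstoUniformlyOn_iff]
    intro δ hδ
    exact Eventually.of_forall fun _ y _ => by simpa using hδ
  rate := ⟨0, by simp, by simp⟩
  deriv a := TendsLp.const (memLp_of_continuousOn hK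
    (continuousOn_of_contDiffAt fun y hy => contDiffAt_pderiv (hf y hy) a) _)

theorem SobConv.mono {K' : Set (Eu n)} (h : SobConv p K F f w) (hK : K' ⊆ K) :
    SobConv p K' F f w where
  smooth := h.smooth.mono fun _ hε y hy => hε y (hK hy)
  unif := h.unif.mono hK
  rate := by
    obtain ⟨C, hC, h1⟩ := h.rate
    exact ⟨C, hC, h1.mono fun _ hε =>
      (eLpNorm_mono_measure _ (Measure.restrict_mono hK le_rfl)).trans hε⟩
  deriv a := (h.deriv a).mono_measure (Measure.restrict_mono hK le_rfl)

theorem SobConv.congr_left (hK : IsCompact K) (h : SobConv p K F f w)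
    (hFG : ∀ᶠ ε in 𝓝[>] (0 : ℝ), ∀ y ∈ K, F ε =ᶠ[𝓝 y] G ε) : SobConv p K G f w where
  smooth := by
    filter_upwards [h.smooth, hFG] with ε h1 h2 y hy
    exact (h1 y hy).congr_of_eventuallyEq (h2 y hy).symm
  unif := h.unif.congr (hFG.mono fun _ hε y hy => (hε y hy).eq_of_nhds)
  rate := by
    obtain ⟨C, hC, h1⟩ := h.rate
    refine ⟨C, hC, ?_⟩
    filter_upwards [h1, hFG] with ε h2 h3
    refine le_trans (le_of_eq (eLpNorm_congr_ae ?_)) h2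
    filter_upwards [ae_restrict_mem hK.measurableSet] with y hy
    rw [(h3 y hy).eq_of_nhds]
  deriv a := by
    refine (h.deriv a).congr ?_ ae_eq_rfl
    filter_upwards [hFG] with ε h3
    filter_upwards [ae_restrict_mem hK.measurableSet] with y hy
    exact pderiv_congr (h3 y hy) a

theorem SobConv.congr_right (hK : IsCompact K) (h : SobConv p K F f w) (hfg : EqOn f g K) :
    SobConv p K F g w where
  smooth := h.smooth
  unif := h.unif.congr_right hfg
  rate := by
    obtain ⟨C, hC, h1⟩ := h.rate
    refine ⟨C, hC, ?_⟩
    filter_upwards [h1] with ε h2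
    refine le_trans (le_of_eq (eLpNorm_congr_ae ?_)) h2
    filter_upwards [ae_restrict_mem hK.measurableSet] with y hy
    rw [hfg hy]
  deriv := h.deriv

theorem SobConv.congr_deriv (h : SobConv p K F f w)
    (hwv : ∀ a, w a =ᵐ[volume.restrict K] v a) : SobConv p K F f v where
  smooth := h.smooth
  unif := h.unif
  rate := h.rate
  deriv a := (h.deriv a).congr (Eventually.of_forall fun _ => ae_eq_rfl) (hwv a)

theorem SobConv.add (hp : 1 ≤ p) (hK : IsCompact K) (hf : SobConv p K F f w)
    (hg : SobConv p K G g v) :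
    SobConv p K (fun ε y => F ε y + G ε y) (fun y => f y + g y) (fun a y => w a y + v a y) where
  smooth := by
    filter_upwards [hf.smooth, hg.smooth] with ε h1 h2 y hy using (h1 y hy).add (h2 y hy)
  unif := hf.unif.add hg.unif
  rate := hf.rate.add hp (hf.aestronglyMeasurable hK) (hf.tendsLp hp hK).2.1.aestronglyMeasurable
    (hg.aestronglyMeasurable hK) (hg.tendsLp hp hK).2.1.aestronglyMeasurable hg.rate
  deriv a := by
    refine ((hf.deriv a).add hp (hg.deriv a)).congr ?_ ae_eq_rfl
    filter_upwards [hf.smooth, hg.smooth] with ε h1 h2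
    filter_upwards [ae_restrict_mem hK.measurableSet] with y hy
    exact (pderiv_add (h1 y hy).differentiableAt_infty (h2 y hy).differentiableAt_infty a).symm

/-- Uniform convergence puts the undifferentiated factors in `L^∞`, so both terms of the Leibniz
rule stay in `L^p`. -/
theorem SobConv.mul (hp : 1 ≤ p) (hK : IsCompact K) (hf : SobConv p K F f w)
    (hg : SobConv p K G g v) :
    SobConv p K (fun ε y => F ε y * G ε y) (fun y => f y * g y)
      (fun a y => w a y * g y + f y * v a y) where
  smooth := by
    filter_upwards [hf.smooth, hg.smooth] with ε h1 h2 y hy using (h1 y hy).mul (h2 y hy)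
  unif := by
    have h1 : TendstoUniformlyOn (fun ε y => (F ε y, G ε y)) (fun y => (f y, g y))
        (𝓝[>] (0 : ℝ)) K := fun u hu => (hf.unif.prodMk hg.unif u hu).diag_of_prod
    exact tendstoUniformlyOn_comp hK (hf.continuousOn.prodMk hg.continuousOn) h1
      (Φ := fun x : ℝ × ℝ => x.1 * x.2) (fun y _ => by fun_prop)
  rate := hf.rate.mul hp (hf.tendsLp_top hK) (hg.tendsLp_top hK) hg.rate
  deriv a := by
    refine (((hf.deriv a).mul (r := p) le_top hp (hg.tendsLp_top hK)).add hp
      ((hf.tendsLp_top hK).mul (r := p) hp hp (hg.deriv a))).congr ?_ ae_eq_rfl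
    filter_upwards [hf.smooth, hg.smooth] with ε h1 h2
    filter_upwards [ae_restrict_mem hK.measurableSet] with y hy
    exact (pderiv_mul (h1 y hy).differentiableAt_infty (h2 y hy).differentiableAt_infty a).symm

theorem SobConv.const_mul (hp : 1 ≤ p) (hK : IsCompact K) (c : ℝ) (hf : SobConv p K F f w) :
    SobConv p K (fun ε y => c * F ε y) (fun y => c * f y) (fun a y => c * w a y) := by
  have h := (SobConv.const (p := p) hK (f := fun _ => c) fun _ _ => contDiffAt_const).mul hp hK hf
  refine h.congr_deriv fun a => Eventually.of_forall fun y => ?_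
  simp [pderiv]

theorem SobConv.sub (hp : 1 ≤ p) (hK : IsCompact K) (hf : SobConv p K F f w)
    (hg : SobConv p K G g v) :
    SobConv p K (fun ε y => F ε y - G ε y) (fun y => f y - g y) (fun a y => w a y - v a y) := by
  simpa [sub_eq_add_neg] using hf.add hp hK (hg.const_mul hp hK (-1))

theorem SobConv.sum {ι : Type*} (hp : 1 ≤ p) (hK : IsCompact K) (s : Finset ι)
    {F : ι → ℝ → Eu n → ℝ} {f : ι → Eu n → ℝ} {w : ι → Fin n → Eu n → ℝ}
    (h : ∀ i ∈ s, SobConv p K (F i) (f i) (w i)) :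
    SobConv p K (fun ε y => ∑ i ∈ s, F i ε y) (fun y => ∑ i ∈ s, f i y)
      (fun a y => ∑ i ∈ s, w i a y) := by
  classical
  induction s using Finset.induction_on with
  | empty =>
    refine (SobConv.const (p := p) hK (f := fun _ => (0 : ℝ)) fun _ _ =>
      contDiffAt_const).congr_deriv fun a => Eventually.of_forall fun y => ?_
    simp [pderiv]
  | insert i s hi ih =>
    simp only [Finset.sum_insert hi]
    exact (h i (by simp)).add hp hK (ih fun j hj => h j (by simp [hj]))

theorem SobConv.eventually_ne (hK : IsCompact K) (h : SobConv p K F f w)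
    (h0 : ∀ y ∈ K, f y ≠ 0) : ∀ᶠ ε in 𝓝[>] (0 : ℝ), ∀ y ∈ K, F ε y ≠ 0 := by
  have h1 := tendstoUniformlyOn_comp hK h.continuousOn h.unif (Φ := fun x : ℝ => x⁻¹)
    (fun y hy => continuousAt_inv₀ (h0 y hy))
  have h2 : ContinuousOn (fun y => (f y)⁻¹) K := h.continuousOn.inv₀ h0
  obtain ⟨C, hC⟩ := hK.exists_bound_of_continuousOn h2
  -- `C` bounds `|1 / f|` on `K`, so `|f|` exceeds `(1 + |C|)⁻¹` there and a smaller uniform error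
  -- cannot reach zero.
  have h3 : 0 < (1 + |C|)⁻¹ := by positivity
  filter_upwards [Metric.tendstoUniformlyOn_iff.mp h.unif _ h3] with ε hε y hy h00
  have h4 := hε y hy
  rw [h00, dist_zero_right] at h4
  have h5 := hC y hy
  rw [norm_inv] at h5
  have h6 : 0 < ‖f y‖ := norm_pos_iff.mpr (h0 y hy)
  have h7 : ‖f y‖⁻¹ < 1 + |C| := by linarith [le_abs_self C]
  have h8 := inv_strictAnti₀ (by positivity) h7
  rw [inv_inv] at h8
  linarith

/-- The identity `1/F - 1/f = -(F - f) · (1/F)(1/f)` transfers the rate, the last two factors being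
bounded in `L^∞` for small `ε`. -/
theorem SobConv.inv (hp : 1 ≤ p) (hK : IsCompact K) (h : SobConv p K F f w)
    (h0 : ∀ y ∈ K, f y ≠ 0) :
    SobConv p K (fun ε y => (F ε y)⁻¹) (fun y => (f y)⁻¹)
      (fun a y => -w a y * ((f y)⁻¹ * (f y)⁻¹)) := by
  have hne := h.eventually_ne hK h0
  have hu := tendstoUniformlyOn_comp hK h.continuousOn h.unif (Φ := fun x : ℝ => x⁻¹)
    (fun y hy => continuousAt_inv₀ (h0 y hy))
  have hs : ∀ᶠ ε in 𝓝[>] (0 : ℝ), ∀ y ∈ K, ContDiffAt ℝ ∞ (fun y => (F ε y)⁻¹) y := by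
    filter_upwards [h.smooth, hne] with ε h1 h2 y hy using (h1 y hy).inv (h2 y hy)
  have ht : TendsLp ∞ (volume.restrict K) (fun ε y => (F ε y)⁻¹) (fun y => (f y)⁻¹) :=
    tendsLp_top_of_tendstoUniformlyOn hK.measurableSet
      (hs.mono fun _ hε => (continuousOn_of_contDiffAt hε).aestronglyMeasurable hK.measurableSet)
      (memLp_of_continuousOn hK (h.continuousOn.inv₀ h0) _) hu
  refine ⟨hs, hu, ?_, fun a => ?_⟩
  · obtain ⟨C, hC, hr⟩ := h.rate
    have hcm := ht.mul (r := ∞) le_top le_top (TendsLp.const ht.2.1)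
    have hb := hcm.eventually_le le_top
    refine ⟨C * (1 + eLpNorm (fun y => (f y)⁻¹ * (f y)⁻¹) ∞ (volume.restrict K)), ?_, ?_⟩
    · have := hcm.2.1.2.ne
      finiteness
    · filter_upwards [hr, hb, hne, hcm.1, h.aestronglyMeasurable hK] with ε h1 h2 h3 h4 h5
      have e : (fun y => (F ε y)⁻¹ - (f y)⁻¹) =ᵐ[volume.restrict K]
          fun y => (-1 : ℝ) • ((F ε y - f y) * ((F ε y)⁻¹ * (f y)⁻¹)) := by
        filter_upwards [ae_restrict_mem hK.measurableSet] with y hy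
        have a1 := h3 y hy
        have a2 := h0 y hy
        simp only [smul_eq_mul]
        field_simp
        ring
      rw [eLpNorm_congr_ae e]
      have e2 : (fun y => (-1 : ℝ) • ((F ε y - f y) * ((F ε y)⁻¹ * (f y)⁻¹))) =
        (-1 : ℝ) • fun y => (F ε y - f y) * ((F ε y)⁻¹ * (f y)⁻¹) := rfl
      rw [e2, eLpNorm_const_smul]
      simp only [enorm_neg, enorm_one, one_mul]
      refine (eLpNorm_mul_le (p := p) (q := ∞) (h5.sub
        (h.tendsLp hp hK).2.1.aestronglyMeasurable) h4.aestronglyMeasurable).trans ?_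
      calc _ ≤ (C * ENNReal.ofReal ε) * (1 + eLpNorm (fun y => (f y)⁻¹ * (f y)⁻¹) ∞
            (volume.restrict K)) := mul_le_mul' h1 h2
        _ = _ := by ring
  · refine ((h.deriv a).neg.mul (r := p) le_top hp (ht.mul (r := ∞) le_top le_top ht)).congr ?_
      ae_eq_rfl
    filter_upwards [h.smooth, hne] with ε h1 h2
    filter_upwards [ae_restrict_mem hK.measurableSet] with y hy
    exact (pderiv_inv (h1 y hy).differentiableAt_infty (h2 y hy) a).symm

/-- Functions vanishing off a closed set `C`: convergence on `K ∩ C` gives convergence on `K`. -/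
theorem SobConv.extend {C : Set (Eu n)} (hC : IsClosed C)
    (h : SobConv p (K ∩ C) F f w) (hF : ∀ᶠ ε in 𝓝[>] (0 : ℝ), ∀ y ∉ C, F ε y = 0)
    (hf : ∀ y ∉ C, f y = 0) : SobConv p K F f (fun a => C.indicator (w a)) := by
  -- Closedness of `C` upgrades vanishing off `C` to vanishing near each such point, so the
  -- derivatives vanish there too.
  have hloc : ∀ᶠ ε in 𝓝[>] (0 : ℝ), ∀ y ∉ C, F ε =ᶠ[𝓝 y] fun _ => (0 : ℝ) :=
    hF.mono fun ε hε y hy => by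
      filter_upwards [hC.isOpen_compl.mem_nhds hy] with z hz using hε z hz
  have hrr : (volume.restrict K).restrict C = volume.restrict (K ∩ C) := by
    rw [Measure.restrict_restrict hC.measurableSet, inter_comm]
  have hnorm : ∀ (q : ℝ≥0∞) (u : Eu n → ℝ), (∀ y ∉ C, u y = 0) →
      eLpNorm u q (volume.restrict K) = eLpNorm u q (volume.restrict (K ∩ C)) := by
    intro q u hu
    rw [← hrr, ← eLpNorm_indicator_eq_eLpNorm_restrict hC.measurableSet]
    congr 1
    exact (indicator_eq_self.mpr fun y hy => by
      by_contra hc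
      exact hy (hu y hc)).symm
  refine ⟨?_, ?_, ?_, fun a => ?_⟩
  · filter_upwards [h.smooth, hloc] with ε h1 h2 y hy
    by_cases hyC : y ∈ C
    · exact h1 y ⟨hy, hyC⟩
    · exact contDiffAt_const.congr_of_eventuallyEq (h2 y hyC)
  · rw [Metric.tendstoUniformlyOn_iff]
    intro δ hδ
    filter_upwards [Metric.tendstoUniformlyOn_iff.mp h.unif δ hδ, hF] with ε h1 h2 y hy
    by_cases hyC : y ∈ C
    · exact h1 y ⟨hy, hyC⟩
    · rw [h2 y hyC, hf y hyC]; simpa using hδ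
  · obtain ⟨c, hc, hr⟩ := h.rate
    refine ⟨c, hc, ?_⟩
    filter_upwards [hr, hF] with ε h1 h2
    rw [hnorm _ _ fun y hy => by rw [h2 y hy, hf y hy, sub_zero]]
    exact h1
  · obtain ⟨h1, h2, h3⟩ := h.deriv a
    have hd : ∀ᶠ ε in 𝓝[>] (0 : ℝ), ∀ y ∉ C, pderiv a (F ε) y = 0 := by
      filter_upwards [hloc] with ε hε y hy
      rw [pderiv_congr (hε y hy)]
      simp [pderiv]
    refine ⟨?_, ?_, h3.congr' ?_⟩
    · filter_upwards [h1, hd] with ε h4 h5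
      rw [← hrr, ← memLp_indicator_iff_restrict hC.measurableSet] at h4
      rwa [indicator_eq_self.mpr fun y hy => by
        by_contra hc
        exact hy (h5 y hc)] at h4
    · rw [memLp_indicator_iff_restrict hC.measurableSet, hrr]
      exact h2
    · filter_upwards [hd] with ε h5
      rw [hnorm _ _ fun y hy => by rw [h5 y hy, indicator_of_notMem hy, sub_zero]]
      refine eLpNorm_congr_ae ?_
      rw [← hrr]
      filter_upwards [ae_restrict_mem hC.measurableSet] with y hy
      rw [indicator_of_mem hy]

end SobConv


/-! ### Weak derivatives as distributional derivatives -/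

section WeakLink

variable {n : ℕ} {p : ℝ≥0∞}

theorem distOf_apply {Ω : Opens (Eu n)} {f : Eu n → ℝ} (hf : LocallyIntegrableOn f Ω volume)
    (φ : 𝓓(Ω, ℝ)) : distOf Ω f φ = ∫ z, f z * φ z := by
  refine (TestFunction.integralAgainstBilinCLM_eq_integral
    (B := ContinuousLinearMap.mul ℝ ℝ) hf (f := φ)).trans ?_
  exact integral_congr_ae (Eventually.of_forall fun z => mul_comm _ _)

theorem lineDeriv_distOf_apply {Ω : Opens (Eu n)} {f : Eu n → ℝ}
    (hf : LocallyIntegrableOn f Ω volume) (a : Fin n) (φ : 𝓓(Ω, ℝ)) :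
    (∂_{stdVec a} (distOf Ω f)) φ = -∫ z, f z * pderiv a φ z := by
  rw [Distribution.lineDerivOp_apply_apply, map_neg, distOf_apply hf]
  rfl

/-- Evaluate the identity of distributions on test functions; from here on weak derivatives are
handled through integrals. -/
theorem isWeakPartial_iff {Ω : Opens (Eu n)} {a : Fin n} {f w : Eu n → ℝ} :
    IsWeakPartial Ω a f w ↔ LocallyIntegrableOn f Ω volume ∧ LocallyIntegrableOn w Ω volume ∧
      WeakD Ω a f w := by
  constructor
  · rintro ⟨h1, h2, h3⟩
    refine ⟨h1, h2, fun φ hφ hφc hφs => ?_⟩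
    have h4 := congrArg (fun T : 𝓓'(Ω, ℝ) => T ⟨φ, hφ, hφc, hφs⟩) h3
    change (∂_{stdVec a} (distOf Ω f)) _ = distOf Ω w _ at h4
    rw [lineDeriv_distOf_apply h1, distOf_apply h2] at h4
    change -∫ z, f z * pderiv a φ z = ∫ z, w z * φ z at h4
    linarith
  · rintro ⟨h1, h2, h3⟩
    refine ⟨h1, h2, ?_⟩
    ext φ
    rw [lineDeriv_distOf_apply h1, distOf_apply h2,
      h3 φ φ.contDiff φ.hasCompactSupport φ.tsupport_subset, neg_neg]

theorem MemLpLoc.locallyIntegrableOn {Ω : Opens (Eu n)} {f : Eu n → ℝ} (hp : 1 ≤ p)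
    (hf : MemLpLoc Ω p f) : LocallyIntegrableOn f Ω volume := by
  rw [locallyIntegrableOn_iff Ω.isOpen.isLocallyClosed]
  intro K hKΩ hK
  have hfin : IsFiniteMeasure (volume.restrict K) := ⟨by simpa using hK.measure_lt_top⟩
  exact memLp_one_iff_integrable.mp ((hf K hK hKΩ).mono_exponent hp)

/-- The fundamental lemma of the calculus of variations, applied to `w - w'`. -/
theorem WeakD.ae_eq {U : Set (Eu n)} (hU : IsOpen U) {a : Fin n} {f w w' : Eu n → ℝ}
    (h : WeakD U a f w) (h' : WeakD U a f w') (hw : LocallyIntegrableOn w U volume)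
    (hw' : LocallyIntegrableOn w' U volume) : ∀ᵐ x ∂volume, x ∈ U → w x = w' x := by
  have h1 := hU.ae_eq_zero_of_integral_contDiff_smul_eq_zero (f := fun x => w x - w' x) (μ := volume)
    (hw.sub hw') (fun φ hφ hφc hφs => by
      have e1 := h φ hφ hφc hφs
      have e2 := h' φ hφ hφc hφs
      have i1 := integrable_mul_of_tsupport_subset hw hφ.continuous hφc hφs
      have i2 := integrable_mul_of_tsupport_subset hw' hφ.continuous hφc hφs
      have e3 : ∫ x, φ x • (w x - w' x) = (∫ x, w x * φ x) - ∫ x, w' x * φ x := by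
        rw [← integral_sub i1 i2]
        refine integral_congr_ae (Eventually.of_forall fun x => ?_)
        simp only [smul_eq_mul]; ring
      rw [e3]; linarith)
  filter_upwards [h1] with x hx hxU
  have := hx hxU
  linarith

theorem weakPartial_spec {Ω : Opens (Eu n)} {a : Fin n} {f w : Eu n → ℝ}
    (h : IsWeakPartial Ω a f w) : IsWeakPartial Ω a f (weakPartial Ω a f) := by
  have h' : ∃ w, IsWeakPartial Ω a f w := ⟨w, h⟩
  rw [weakPartial, dif_pos h']
  exact h'.choose_spec

theorem weakPartial_ae_eq {Ω : Opens (Eu n)} {a : Fin n} {f w : Eu n → ℝ}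
    (h : IsWeakPartial Ω a f w) : ∀ᵐ x ∂volume, x ∈ Ω → weakPartial Ω a f x = w x := by
  obtain ⟨-, h2, h3⟩ := isWeakPartial_iff.mp h
  obtain ⟨-, k2, k3⟩ := isWeakPartial_iff.mp (weakPartial_spec h)
  exact WeakD.ae_eq Ω.isOpen k3 h3 k2 h2

theorem weakPartial_ae_eq_restrict {Ω : Opens (Eu n)} {a : Fin n} {f w : Eu n → ℝ}
    (h : IsWeakPartial Ω a f w) {K : Set (Eu n)} (hK : MeasurableSet K) (hKΩ : K ⊆ Ω) :
    weakPartial Ω a f =ᵐ[volume.restrict K] w := by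
  filter_upwards [ae_restrict_of_ae (weakPartial_ae_eq h), ae_restrict_mem hK] with x hx hxK
  exact hx (hKΩ hxK)

theorem TendsLp.tendsto_integral {α : Type*} [MeasurableSpace α] {μ : Measure α}
    {F : ℝ → α → ℝ} {f : α → ℝ} (h : TendsLp 1 μ F f) :
    Tendsto (fun ε => ∫ x, F ε x ∂μ) (𝓝[>] (0 : ℝ)) (𝓝 (∫ x, f x ∂μ)) := by
  obtain ⟨h1, h2, h3⟩ := h
  refine tendsto_integral_of_L1 f (memLp_one_iff_integrable.mp h2).aestronglyMeasurable
    (h1.mono fun _ h => memLp_one_iff_integrable.mp h) ?_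
  simpa only [eLpNorm_one_eq_lintegral_enorm] using h3

/-- Each `F ε` with `ε` small is smooth at the points of `K`, so classical integration by parts
holds against `φ`; both sides pass to the limit by convergence in `L¹(K)`. -/
theorem SobConv.weakD_of_tsupport_subset {K : Set (Eu n)} {F : ℝ → Eu n → ℝ} {f : Eu n → ℝ}
    {w : Fin n → Eu n → ℝ} (hp : 1 ≤ p) (hK : IsCompact K) (h : SobConv p K F f w) (a : Fin n)
    {φ : Eu n → ℝ} (hφ : ContDiff ℝ ∞ φ) (hφc : HasCompactSupport φ) (hφs : tsupport φ ⊆ K) :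
    ∫ z, f z * pderiv a φ z = -∫ z, w a z * φ z := by
  have hfin : IsFiniteMeasure (volume.restrict K) := ⟨by simpa using hK.measure_lt_top⟩
  have hdφ := (contDiff_pderiv hφ a).continuous
  have restr : ∀ {ψ : Eu n → ℝ} (u : Eu n → ℝ), tsupport ψ ⊆ K →
      ∫ z, u z * ψ z = ∫ z in K, u z * ψ z := by
    intro ψ u hψ
    refine (setIntegral_eq_integral_of_forall_compl_eq_zero fun z hz => ?_).symm
    rw [image_eq_zero_of_notMem_tsupport fun h => hz (hψ h), mul_zero]
  have hds : tsupport (pderiv a φ) ⊆ K := (tsupport_pderiv_subset a φ).trans hφs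
  have t1 := ((h.tendsLp hp hK).mono_exponent hp le_rfl).mul (p := 1) (q := ∞) (r := 1) le_top le_rfl
    (TendsLp.const (memLp_of_continuousOn hK hdφ.continuousOn ∞))
  have t2 := ((h.deriv a).mono_exponent hp le_rfl).mul (p := 1) (q := ∞) (r := 1) le_top le_rfl
    (TendsLp.const (memLp_of_continuousOn hK hφ.continuous.continuousOn ∞))
  have l1 := t1.tendsto_integral
  have l2 := t2.tendsto_integral.neg
  rw [restr _ hds, restr _ hφs]
  refine tendsto_nhds_unique_of_eventuallyEq l1 l2 ?_
  filter_upwards [h.smooth] with ε hε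
  rw [← restr _ hds, ← restr _ hφs]
  have hcont : ∀ {u ψ : Eu n → ℝ}, (∀ z ∈ K, ContinuousAt u z) → Continuous ψ → tsupport ψ ⊆ K →
      HasCompactSupport ψ → Integrable (fun z => u z * ψ z) volume := by
    intro u ψ hu hψ hs hc
    -- `u` is controlled only at points of `K`; the product is continuous everywhere because it
    -- vanishes near each point off the support of `ψ`.
    have h1 : Continuous fun z => u z * ψ z := by
      rw [continuous_iff_continuousAt]
      intro z
      by_cases hz : z ∈ tsupport ψ
      · exact (hu z (hs hz)).mul hψ.continuousAt
      · refine (continuousAt_const (y := (0 : ℝ))).congr ?_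
        filter_upwards [notMem_tsupport_iff_eventuallyEq.mp hz] with y hy
        simp [hy]
    exact h1.integrable_of_hasCompactSupport hc.mul_left
  exact integral_mul_fderiv_eq_neg_fderiv_mul_of_integrable (μ := (volume : Measure (Eu n)))
    (f := F ε) (g := φ) (v := stdVec a) (𝕜 := ℝ)
    (hcont (fun z hz => (contDiffAt_pderiv (hε z hz) a).continuousAt) hφ.continuous hφs hφc)
    (hcont (fun z hz => (hε z hz).continuousAt) hdφ hds (hasCompactSupport_pderiv hφc a))
    (hcont (fun z hz => (hε z hz).continuousAt) hφ.continuous hφs hφc)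
    (fun z hz => (hε z (hφs hz)).differentiableAt_infty)
    (fun z _ => hφ.differentiable (by simp) z)

/-- If the limit already has weak derivatives `w`, then these are the limits of the derivatives. -/
theorem SobConv.of_weakD {U : Set (Eu n)} (hU : IsOpen U) {F : ℝ → Eu n → ℝ} {f : Eu n → ℝ}
    {w : Fin n → Eu n → ℝ} (hp : 1 ≤ p)
    (h : ∀ K : Set (Eu n), IsCompact K → K ⊆ U → ∃ v, SobConv p K F f v)
    (hw : ∀ a, LocallyIntegrableOn (w a) U volume) (hfw : ∀ a, WeakD U a f (w a))
    {K : Set (Eu n)} (hK : IsCompact K) (hKU : K ⊆ U) : SobConv p K F f w := by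
  -- Uniqueness of weak derivatives concerns open sets, so it is applied in the interior of a larger
  -- compact set and restricted to `K` afterwards.
  obtain ⟨K', hK', hKK', hK'U⟩ := exists_compact_between hK hU hKU
  obtain ⟨v, hv⟩ := h K' hK' hK'U
  have hfin : IsFiniteMeasure (volume.restrict K') := ⟨by simpa using hK'.measure_lt_top⟩
  refine (hv.mono (hKK'.trans interior_subset)).congr_deriv fun a => ?_
  have hvi : IntegrableOn (v a) K' volume :=
    memLp_one_iff_integrable.mp ((hv.deriv a).2.1.mono_exponent hp)
  have := WeakD.ae_eq (isOpen_interior (s := K')) (a := a) (f := f) (w := v a) (w' := w a)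
    (fun φ h1 h2 h3 => hv.weakD_of_tsupport_subset hp hK' a h1 h2 (h3.trans interior_subset))
    ((hfw a).mono (interior_subset.trans hK'U))
    (hvi.mono_set interior_subset).locallyIntegrableOn
    ((hw a).mono_set (interior_subset.trans hK'U))
  filter_upwards [ae_restrict_of_ae this, ae_restrict_mem hK.measurableSet] with x hx hxK
  exact hx (hKK' hxK)

/-- `SobConv` on every compact subset of an open set, with derivative limits that do not depend
on the compact set. -/
def SobConvOn (p : ℝ≥0∞) (U : Set (Eu n)) (F : ℝ → Eu n → ℝ) (f : Eu n → ℝ) : Prop :=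
  ∃ w, ∀ K : Set (Eu n), IsCompact K → K ⊆ U → SobConv p K F f w

theorem SobConvOn.isWeakPartial {Ω : Opens (Eu n)} {F : ℝ → Eu n → ℝ} {f : Eu n → ℝ}
    {w : Fin n → Eu n → ℝ} (hp : 1 ≤ p)
    (h : ∀ K : Set (Eu n), IsCompact K → K ⊆ Ω → SobConv p K F f w) (a : Fin n) :
    IsWeakPartial Ω a f (w a) := by
  refine isWeakPartial_iff.mpr ⟨MemLpLoc.locallyIntegrableOn hp fun K hK hKΩ =>
    ((h K hK hKΩ).tendsLp hp hK).2.1, MemLpLoc.locallyIntegrableOn hp fun K hK hKΩ =>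
    ((h K hK hKΩ).deriv a).2.1, fun φ h1 h2 h3 => ?_⟩
  exact (h _ h2.isCompact h3).weakD_of_tsupport_subset hp h2.isCompact a h1 h2 le_rfl

/-- `weakPartial` is an arbitrary representative, but it agrees almost everywhere with the limits of
the derivatives and may replace them. -/
theorem SobConvOn.sobConv_weakPartial {Ω : Opens (Eu n)} {F : ℝ → Eu n → ℝ} {f : Eu n → ℝ}
    (hp : 1 ≤ p) (h : SobConvOn p Ω F f) {K : Set (Eu n)} (hK : IsCompact K) (hKΩ : K ⊆ Ω) :
    SobConv p K F f (fun a => weakPartial Ω a f) := by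
  obtain ⟨w, hw⟩ := h
  exact (hw K hK hKΩ).congr_deriv fun a =>
    (weakPartial_ae_eq_restrict (SobConvOn.isWeakPartial hp hw a) hK.measurableSet hKΩ).symm

theorem SobConvOn.isWeakPartial_weakPartial {Ω : Opens (Eu n)} {F : ℝ → Eu n → ℝ} {f : Eu n → ℝ}
    (hp : 1 ≤ p) (h : SobConvOn p Ω F f) (a : Fin n) :
    IsWeakPartial Ω a f (weakPartial Ω a f) := by
  obtain ⟨w, hw⟩ := h
  exact weakPartial_spec (SobConvOn.isWeakPartial hp hw a)

/-! ### Algebraic operations, determinants and inverse matrices of convergent families. -/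

section Closure

variable {U : Set (Eu n)} {F G : ℝ → Eu n → ℝ} {f g : Eu n → ℝ}

theorem SobConvOn.mul (hp : 1 ≤ p) (hf : SobConvOn p U F f) (hg : SobConvOn p U G g) :
    SobConvOn p U (fun ε y => F ε y * G ε y) (fun y => f y * g y) := by
  obtain ⟨w, hw⟩ := hf
  obtain ⟨v, hv⟩ := hg
  exact ⟨_, fun K hK hKU => (hw K hK hKU).mul hp hK (hv K hK hKU)⟩

theorem SobConvOn.sub (hp : 1 ≤ p) (hf : SobConvOn p U F f) (hg : SobConvOn p U G g) :
    SobConvOn p U (fun ε y => F ε y - G ε y) (fun y => f y - g y) := by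
  obtain ⟨w, hw⟩ := hf
  obtain ⟨v, hv⟩ := hg
  exact ⟨_, fun K hK hKU => (hw K hK hKU).sub hp hK (hv K hK hKU)⟩

theorem SobConvOn.const {f : Eu n → ℝ} (hf : ∀ y ∈ U, ContDiffAt ℝ ∞ f y) :
    SobConvOn p U (fun _ => f) f :=
  ⟨_, fun _ hK hKU => SobConv.const hK fun y hy => hf y (hKU hy)⟩

theorem SobConvOn.sum {ι : Type*} (hp : 1 ≤ p) (s : Finset ι) {F : ι → ℝ → Eu n → ℝ}
    {f : ι → Eu n → ℝ} (h : ∀ i, SobConvOn p U (F i) (f i)) :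
    SobConvOn p U (fun ε y => ∑ i ∈ s, F i ε y) (fun y => ∑ i ∈ s, f i y) := by
  choose w hw using h
  exact ⟨_, fun K hK hKU => SobConv.sum hp hK s fun i _ => hw i K hK hKU⟩

theorem SobConvOn.prod {ι : Type*} (hp : 1 ≤ p) (s : Finset ι) {F : ι → ℝ → Eu n → ℝ}
    {f : ι → Eu n → ℝ} (h : ∀ i, SobConvOn p U (F i) (f i)) :
    SobConvOn p U (fun ε y => ∏ i ∈ s, F i ε y) (fun y => ∏ i ∈ s, f i y) := by
  classical
  induction s using Finset.induction_on with
  | empty => simpa using SobConvOn.const fun _ _ => contDiffAt_const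
  | insert i s hi ih =>
    simp only [Finset.prod_insert hi]
    exact (h i).mul hp ih

theorem SobConvOn.inv (hp : 1 ≤ p) (hf : SobConvOn p U F f) (h0 : ∀ y ∈ U, f y ≠ 0) :
    SobConvOn p U (fun ε y => (F ε y)⁻¹) (fun y => (f y)⁻¹) := by
  obtain ⟨w, hw⟩ := hf
  exact ⟨_, fun K hK hKU => (hw K hK hKU).inv hp hK fun y hy => h0 y (hKU hy)⟩

theorem SobConvOn.det {m : ℕ} (hp : 1 ≤ p) {H : ℝ → Eu n → Matrix (Fin m) (Fin m) ℝ}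
    {A : Eu n → Matrix (Fin m) (Fin m) ℝ}
    (h : ∀ i j, SobConvOn p U (fun ε y => H ε y i j) (fun y => A y i j)) :
    SobConvOn p U (fun ε y => (H ε y).det) (fun y => (A y).det) := by
  simp only [Matrix.det_apply']
  exact SobConvOn.sum hp _ fun σ => (SobConvOn.const fun _ _ => contDiffAt_const).mul hp
    (SobConvOn.prod hp _ fun i => h _ _)

/-- By Cramer's rule the entries of the inverse are quotients of determinants, so closure under
sums, products and reciprocals suffices. -/
theorem SobConvOn.matrix_inv {m : ℕ} (hp : 1 ≤ p) {H : ℝ → Eu n → Matrix (Fin m) (Fin m) ℝ}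
    {A : Eu n → Matrix (Fin m) (Fin m) ℝ}
    (h : ∀ i j, SobConvOn p U (fun ε y => H ε y i j) (fun y => A y i j))
    (h0 : ∀ y ∈ U, (A y).det ≠ 0) (i j : Fin m) :
    SobConvOn p U (fun ε y => (H ε y)⁻¹ i j) (fun y => (A y)⁻¹ i j) := by
  have e : ∀ B : Matrix (Fin m) (Fin m) ℝ,
      B⁻¹ i j = B.det⁻¹ * (B.updateRow j (Pi.single i 1)).det := by
    intro B
    rw [Matrix.inv_def, Matrix.smul_apply, Matrix.adjugate_apply, Ring.inverse_eq_inv', smul_eq_mul]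
  simp only [e]
  refine ((SobConvOn.det hp h).inv hp h0).mul hp (SobConvOn.det hp fun k l => ?_)
  by_cases hk : k = j
  · subst hk
    simp only [Matrix.updateRow_self]
    exact SobConvOn.const fun _ _ => contDiffAt_const
  · simp only [Matrix.updateRow_ne hk]
    exact h k l

end Closure

end WeakLink

/-! ### Change of coordinates -/

section ChangeVar

variable {n : ℕ} {p q : ℝ≥0∞}

theorem TendsLp.comp {α β : Type*} [MeasurableSpace α] [MeasurableSpace β] {μ : Measure α}
    {ν : Measure β} {φ : α → β} {C : ℝ≥0∞} (hC : C ≠ ⊤) (hφ : AEMeasurable φ μ)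
    (hμ : μ.map φ ≤ C • ν) {F : ℝ → β → ℝ} {f : β → ℝ} (h : TendsLp q ν F f) :
    TendsLp q μ (fun ε x => F ε (φ x)) (fun x => f (φ x)) := by
  obtain ⟨h1, h2, h3⟩ := h
  have hm : ∀ {u : β → ℝ}, MemLp u q ν → MemLp (fun x => u (φ x)) q μ := fun hu =>
    (memLp_map_measure_iff (hu.of_measure_le_smul hC hμ).aestronglyMeasurable hφ).mp
      (hu.of_measure_le_smul hC hμ)
  refine tendsLp_of_le (h1.mono fun ε h => (hm h).aestronglyMeasurable) (hm h2)
    (B := fun ε => C ^ (1 / q).toReal • eLpNorm (fun x => F ε x - f x) q ν) ?_ ?_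
  · have := ENNReal.Tendsto.const_mul (a := C ^ (1 / q).toReal) h3
      (Or.inr (ENNReal.rpow_ne_top_of_nonneg ENNReal.toReal_nonneg hC))
    simpa using this
  · filter_upwards [h1] with ε h
    have h4 := (h.sub h2).of_measure_le_smul hC hμ
    have h5 := eLpNorm_map_measure (p := q) h4.aestronglyMeasurable hφ
    have h6 : eLpNorm (fun x => F ε (φ x) - f (φ x)) q μ = eLpNorm (F ε - f) q (μ.map φ) := h5.symm
    rw [h6]
    exact eLpNorm_le_of_measure_le_smul hμ

/-- Change of variables: on the compact set `K` the Jacobian determinant is bounded away from zero,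
so pulling functions back along `φ` increases `L^q` norms by at most a constant factor. -/
theorem exists_map_restrict_le {K : Set (Eu n)} (hK : IsCompact K) {φ : Eu n → Eu n}
    (hφ : ∀ y ∈ K, ContDiffAt ℝ ∞ φ y) (hinj : InjOn φ K) (hdet : ∀ y ∈ K, (fderiv ℝ φ y).det ≠ 0) :
    ∃ C : ℝ≥0∞, C ≠ ⊤ ∧ (volume.restrict K).map φ ≤ C • volume.restrict (φ '' K) := by
  have hc : ContinuousOn (fun y => ((fderiv ℝ φ y).det)⁻¹) K := by
    refine ContinuousOn.inv₀ (fun y hy => ?_) hdet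
    have h1 : ContinuousAt (fderiv ℝ φ) y :=
      ((hφ y hy).fderiv_right (m := 0) (by simp)).continuousAt
    exact (ContinuousLinearMap.continuous_det.continuousAt.comp h1).continuousWithinAt
  obtain ⟨c, hc⟩ := hK.exists_bound_of_continuousOn hc
  have hφm : AEMeasurable φ (volume.restrict K) :=
    (ContinuousOn.aemeasurable (fun y hy => (hφ y hy).continuousAt.continuousWithinAt)
      hK.measurableSet)
  refine ⟨ENNReal.ofReal c, ENNReal.ofReal_ne_top, Measure.le_iff.mpr fun s hs => ?_⟩
  have hind : Measurable (s.indicator (fun _ => (1 : ℝ≥0∞))) := measurable_const.indicator hs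
  have e1 : (volume.restrict K).map φ s = ∫⁻ y in K, s.indicator (fun _ => (1 : ℝ≥0∞)) (φ y) := by
    rw [← lintegral_map' hind.aemeasurable hφm, lintegral_indicator_const hs, one_mul]
  have e2 : volume.restrict (φ '' K) s =
      ∫⁻ y in K, ENNReal.ofReal |(fderiv ℝ φ y).det| * s.indicator (fun _ => (1 : ℝ≥0∞)) (φ y) := by
    rw [← lintegral_image_eq_lintegral_abs_det_fderiv_mul volume hK.measurableSet
      (fun y hy => (hφ y hy).differentiableAt (by simp) |>.hasFDerivAt.hasFDerivWithinAt) hinj,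
      lintegral_indicator_const hs, one_mul]
  rw [e1, Measure.smul_apply, e2, smul_eq_mul, ← lintegral_const_mul' _ _ ENNReal.ofReal_ne_top]
  refine setLIntegral_mono_ae' hK.measurableSet (Eventually.of_forall fun y hy => ?_)
  rw [← mul_assoc, ← ENNReal.ofReal_mul ((norm_nonneg _).trans (hc y hy))]
  refine le_mul_of_one_le_left bot_le ?_
  rw [ENNReal.one_le_ofReal]
  have h1 := hc y hy
  rw [norm_inv, Real.norm_eq_abs] at h1
  have h2 : 0 < |(fderiv ℝ φ y).det| := abs_pos.mpr (hdet y hy)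
  calc (1 : ℝ) = |(fderiv ℝ φ y).det|⁻¹ * |(fderiv ℝ φ y).det| := (inv_mul_cancel₀ h2.ne').symm
    _ ≤ _ := by gcongr

theorem pderiv_comp {f : Eu n → ℝ} {φ : Eu n → Eu n} {y : Eu n} (hf : DifferentiableAt ℝ f (φ y))
    (hφ : DifferentiableAt ℝ φ y) (a : Fin n) :
    pderiv a (fun z => f (φ z)) y = ∑ c, pderiv a (fun z => φ z c) y * pderiv c f (φ y) := by
  have h1 : fderiv ℝ (fun z => f (φ z)) y = _ := (hf.hasFDerivAt.comp y hφ.hasFDerivAt).fderiv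
  rw [pderiv, h1, ContinuousLinearMap.comp_apply, fderiv_eq_sum_pderiv]
  refine Finset.sum_congr rfl fun c _ => ?_
  congr 1
  have h2 := ((EuclideanSpace.proj (𝕜 := ℝ) c).hasFDerivAt (x := φ y)).comp y hφ.hasFDerivAt
  have h3 : fderiv ℝ (fun z => φ z c) y = _ := h2.fderiv
  rw [pderiv, h3]
  rfl

theorem contDiffAt_apply {φ : Eu n → Eu n} {y : Eu n} (hφ : ContDiffAt ℝ ∞ φ y) (c : Fin n) :
    ContDiffAt ℝ ∞ (fun z => φ z c) y :=
  (EuclideanSpace.proj (𝕜 := ℝ) c).contDiff.contDiffAt.comp y hφ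

theorem tendsLp_comp_diffeo {K : Set (Eu n)} (hK : IsCompact K) {φ : Eu n → Eu n}
    (hφ : ∀ y ∈ K, ContDiffAt ℝ ∞ φ y) (hinj : InjOn φ K) (hdet : ∀ y ∈ K, (fderiv ℝ φ y).det ≠ 0)
    {F : ℝ → Eu n → ℝ} {f : Eu n → ℝ} (h : TendsLp q (volume.restrict (φ '' K)) F f) :
    TendsLp q (volume.restrict K) (fun ε x => F ε (φ x)) (fun x => f (φ x)) := by
  obtain ⟨C, hC, hle⟩ := exists_map_restrict_le hK hφ hinj hdet
  exact h.comp hC (ContinuousOn.aemeasurable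
    (fun y hy => (hφ y hy).continuousAt.continuousWithinAt) hK.measurableSet) hle

/-- Convergence obtained in the chart where a convolution is carried out is read in another chart
through this lemma; the derivative limits follow the chain rule. -/
theorem SobConv.comp {K : Set (Eu n)} (hp : 1 ≤ p) (hK : IsCompact K) {φ : Eu n → Eu n}
    (hφ : ∀ y ∈ K, ContDiffAt ℝ ∞ φ y) (hinj : InjOn φ K) (hdet : ∀ y ∈ K, (fderiv ℝ φ y).det ≠ 0)
    {F : ℝ → Eu n → ℝ} {f : Eu n → ℝ} {w : Fin n → Eu n → ℝ} (h : SobConv p (φ '' K) F f w) :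
    SobConv p K (fun ε x => F ε (φ x)) (fun x => f (φ x))
      (fun a y => ∑ c, pderiv a (fun z => φ z c) y * w c (φ y)) := by
  obtain ⟨C, hC, hle⟩ := exists_map_restrict_le hK hφ hinj hdet
  have hφc : ContinuousOn φ K := fun y hy => (hφ y hy).continuousAt.continuousWithinAt
  have hφK : IsCompact (φ '' K) := hK.image_of_continuousOn hφc
  have hφm : AEMeasurable φ (volume.restrict K) := hφc.aemeasurable hK.measurableSet
  refine ⟨?_, ?_, ?_, fun a => ?_⟩
  · filter_upwards [h.smooth] with ε hε y hy
    exact (hε (φ y) (mem_image_of_mem φ hy)).comp y (hφ y hy)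
  · exact (h.unif.comp φ).mono (subset_preimage_image φ K)
  · obtain ⟨c, hc, hr⟩ := h.rate
    refine ⟨C ^ (1 / p).toReal * c, ENNReal.mul_ne_top
      (ENNReal.rpow_ne_top_of_nonneg ENNReal.toReal_nonneg hC) hc, ?_⟩
    filter_upwards [hr, (h.tendsLp hp hφK).1] with ε h1 h2
    have h4 := (h2.sub (h.tendsLp hp hφK).2.1).of_measure_le_smul hC hle
    have h5 := eLpNorm_map_measure (p := p) h4.aestronglyMeasurable hφm
    have h6 : eLpNorm (fun x => F ε (φ x) - f (φ x)) p (volume.restrict K) =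
      eLpNorm (F ε - f) p ((volume.restrict K).map φ) := h5.symm
    rw [h6, mul_assoc]
    exact (eLpNorm_le_of_measure_le_smul hle).trans (mul_le_mul' le_rfl h1)
  · have hd : ∀ c : Fin n, MemLp (pderiv a (fun z => φ z c)) ∞ (volume.restrict K) := fun c =>
      memLp_of_continuousOn hK (continuousOn_of_contDiffAt fun y hy =>
        contDiffAt_pderiv (contDiffAt_apply (hφ y hy) c) a) _
    refine (TendsLp.sum hp Finset.univ fun c _ => (TendsLp.const (hd c)).mul (r := p) hp hp
      (tendsLp_comp_diffeo hK hφ hinj hdet (h.deriv c))).congr ?_ ae_eq_rfl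
    filter_upwards [h.smooth] with ε h1
    filter_upwards [ae_restrict_mem hK.measurableSet] with y hy
    exact (pderiv_comp (h1 _ (mem_image_of_mem φ hy)).differentiableAt_infty
      ((hφ y hy).differentiableAt (by simp)) a).symm

end ChangeVar


/-! ### Scalar curvature in coordinates: divergence form -/

section Coord

variable {n : ℕ}

/-- The coefficients `gʲᵃ gᵏᵇ - gᵏʲ gᵃᵇ` (with `A = g⁻¹`) of the second derivatives `∂ₖ ∂ⱼ g_ab` in
the scalar curvature. -/
def bcoef (A : Matrix (Fin n) (Fin n) ℝ) (k j a b : Fin n) : ℝ := A j a * A k b - A k j * A a b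

/-- The terms of the scalar curvature which are quadratic in first derivatives. -/
def lowF (A : Matrix (Fin n) (Fin n) ℝ) (dA Γ : Fin n → Fin n → Fin n → ℝ) : ℝ :=
  ∑ i, ∑ j, ∑ m, (-(dA m i j) * Γ m i j + dA j i j * Γ m i m)
    + ∑ i, ∑ j, ∑ m, ∑ k, A i j * (Γ m i j * Γ k k m - Γ m i k * Γ k j m)

/-- Only two distinct full contractions of the derivatives occur, `T1` and `T2`: one finds `gⁱʲ Γᵏᵢⱼ
= T1 - T2/2` and `gⁱᵏ Γʲᵢⱼ = T2/2`, while the right side is `T1 - T2`. The array `d` is arbitrary,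
so that weak and classical derivatives are covered at once. -/
theorem contract_christoffel {G : Matrix (Fin n) (Fin n) ℝ} (hG : G.IsSymm)
    (d : Fin n → Fin n → Fin n → ℝ) (k : Fin n) :
    ∑ i, ∑ j, (G⁻¹ i j * christoffel G d k i j - G⁻¹ i k * christoffel G d j i j) =
      ∑ j, ∑ a, ∑ b, bcoef G⁻¹ k j a b * d j a b := by
  set A := G⁻¹ with hA
  have hs : ∀ i j, A i j = A j i := fun i j => by
    have : A.IsSymm := hG.inv
    exact this.apply j i
  set T1 := ∑ i, ∑ j, ∑ l, A i j * A k l * d i j l with hT1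
  set T2 := ∑ i, ∑ j, ∑ l, A i j * A k l * d l i j with hT2
  have e1 : ∑ i, ∑ j, A i j * christoffel G d k i j = T1 - 1 / 2 * T2 := by
    have h1 : ∑ i, ∑ j, ∑ l, A i j * A k l * d j i l = T1 := by
      rw [Finset.sum_comm, hT1]
      refine Finset.sum_congr rfl fun i _ => Finset.sum_congr rfl fun j _ =>
        Finset.sum_congr rfl fun l _ => ?_
      rw [hs j i]
    have h2 : ∑ i, ∑ j, A i j * christoffel G d k i j =
        1 / 2 * (T1 + ∑ i, ∑ j, ∑ l, A i j * A k l * d j i l - T2) := by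
      simp only [hT1, hT2, ← Finset.sum_add_distrib, ← Finset.sum_sub_distrib, Finset.mul_sum,
        christoffel]
      refine Finset.sum_congr rfl fun i _ => Finset.sum_congr rfl fun j _ =>
        Finset.sum_congr rfl fun l _ => ?_
      ring
    rw [h2, h1]; ring
  have e2 : ∑ i, ∑ j, A i k * christoffel G d j i j = 1 / 2 * T2 := by
    have h1 : ∀ i, ∑ j, ∑ l, A i k * A j l * d l i j = ∑ j, ∑ l, A i k * A j l * d j i l := by
      intro i
      rw [Finset.sum_comm]
      refine Finset.sum_congr rfl fun j _ => Finset.sum_congr rfl fun l _ => ?_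
      rw [hs l j]
    have h2 : ∑ i, ∑ j, A i k * christoffel G d j i j =
        1 / 2 * ∑ i, (∑ j, ∑ l, A i k * A j l * d i j l + ∑ j, ∑ l, A i k * A j l * d j i l -
          ∑ j, ∑ l, A i k * A j l * d l i j) := by
      simp only [← Finset.sum_add_distrib, ← Finset.sum_sub_distrib, Finset.mul_sum, christoffel]
      refine Finset.sum_congr rfl fun i _ => Finset.sum_congr rfl fun j _ =>
        Finset.sum_congr rfl fun l _ => ?_
      ring
    have h3 : T2 = ∑ i, ∑ j, ∑ l, A i k * A j l * d i j l := by
      rw [hT2]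
      calc _ = ∑ i, ∑ l, ∑ j, A i j * A k l * d l i j :=
            Finset.sum_congr rfl fun i _ => Finset.sum_comm
        _ = ∑ l, ∑ i, ∑ j, A i j * A k l * d l i j := Finset.sum_comm
        _ = _ := by
            refine Finset.sum_congr rfl fun i _ => Finset.sum_congr rfl fun j _ =>
              Finset.sum_congr rfl fun l _ => ?_
            rw [hs k i]; ring
    rw [h2, h3]
    simp only [h1, add_sub_cancel_right]
  have e3 : ∑ j, ∑ a, ∑ b, bcoef A k j a b * d j a b = T1 - T2 := by
    have h3 : T2 = ∑ j, ∑ a, ∑ b, A k j * A a b * d j a b := by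
      rw [hT2]
      calc _ = ∑ i, ∑ l, ∑ j, A i j * A k l * d l i j :=
            Finset.sum_congr rfl fun i _ => Finset.sum_comm
        _ = ∑ l, ∑ i, ∑ j, A i j * A k l * d l i j := Finset.sum_comm
        _ = _ := by
            refine Finset.sum_congr rfl fun i _ => Finset.sum_congr rfl fun j _ =>
              Finset.sum_congr rfl fun l _ => ?_
            ring
    rw [h3]
    simp only [hT1, ← Finset.sum_sub_distrib, bcoef]
    refine Finset.sum_congr rfl fun i _ => Finset.sum_congr rfl fun j _ =>
      Finset.sum_congr rfl fun l _ => ?_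
    ring
  simp only [Finset.sum_sub_distrib]
  rw [e1, e2, e3]; ring

theorem fieldV_eq {Ω : Opens (Eu n)} {G : Eu n → Matrix (Fin n) (Fin n) ℝ}
    (hG : ∀ z, (G z).IsSymm) (k : Fin n) (y : Eu n) :
    fieldV Ω G k y = ∑ j, ∑ a, ∑ b, bcoef (G y)⁻¹ k j a b *
      weakPartial Ω j (fun z => G z a b) y :=
  contract_christoffel (hG y) (fun a i j => weakPartial Ω a (fun z => G z i j) y) k

theorem contract_Gam {G : Eu n → Matrix (Fin n) (Fin n) ℝ} (hG : ∀ z, (G z).IsSymm) (k : Fin n)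
    (y : Eu n) :
    ∑ i, ∑ j, ((G y)⁻¹ i j * Gam G k i j y - (G y)⁻¹ i k * Gam G j i j y) =
      ∑ j, ∑ a, ∑ b, bcoef (G y)⁻¹ k j a b * pderiv j (fun z => G z a b) y :=
  contract_christoffel (hG y) (fun a i j => pderiv a (fun z => G z i j) y) k

theorem contDiffAt_det {m : ℕ} {H : Eu n → Matrix (Fin m) (Fin m) ℝ} {y : Eu n}
    (h : ∀ i j, ContDiffAt ℝ ∞ (fun z => H z i j) y) : ContDiffAt ℝ ∞ (fun z => (H z).det) y := by
  simp only [Matrix.det_apply']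
  exact ContDiffAt.sum fun σ _ => contDiffAt_const.mul (contDiffAt_prod fun i _ => h _ _)

theorem contDiffAt_matrix_inv {m : ℕ} {H : Eu n → Matrix (Fin m) (Fin m) ℝ} {y : Eu n}
    (h : ∀ i j, ContDiffAt ℝ ∞ (fun z => H z i j) y) (h0 : (H y).det ≠ 0) (i j : Fin m) :
    ContDiffAt ℝ ∞ (fun z => (H z)⁻¹ i j) y := by
  have e : ∀ B : Matrix (Fin m) (Fin m) ℝ,
      B⁻¹ i j = B.det⁻¹ * (B.updateRow j (Pi.single i 1)).det := by
    intro B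
    rw [Matrix.inv_def, Matrix.smul_apply, Matrix.adjugate_apply, Ring.inverse_eq_inv', smul_eq_mul]
  simp only [e]
  refine ((contDiffAt_det h).inv h0).mul (contDiffAt_det fun k l => ?_)
  by_cases hk : k = j
  · subst hk
    simp only [Matrix.updateRow_self]
    exact contDiffAt_const
  · simp only [Matrix.updateRow_ne hk]
    exact h k l

theorem contDiffAt_Gam {G : Eu n → Matrix (Fin n) (Fin n) ℝ} {y : Eu n}
    (h : ∀ i j, ContDiffAt ℝ ∞ (fun z => G z i j) y) (h0 : (G y).det ≠ 0) (k i j : Fin n) :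
    ContDiffAt ℝ ∞ (Gam G k i j) y := by
  have hd : ∀ a i j, ContDiffAt ℝ ∞ (pderiv a (fun z => G z i j)) y :=
    fun a i j => contDiffAt_pderiv (h i j) a
  exact contDiffAt_const.mul (ContDiffAt.sum fun l _ =>
    (contDiffAt_matrix_inv h h0 k l).mul (((hd i j l).add (hd j i l)).sub (hd l i j)))

theorem contDiffAt_bcoef {G : Eu n → Matrix (Fin n) (Fin n) ℝ} {y : Eu n}
    (h : ∀ i j, ContDiffAt ℝ ∞ (fun z => G z i j) y) (h0 : (G y).det ≠ 0) (k j a b : Fin n) :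
    ContDiffAt ℝ ∞ (fun z => bcoef (G z)⁻¹ k j a b) y :=
  ((contDiffAt_matrix_inv h h0 _ _).mul (contDiffAt_matrix_inv h h0 _ _)).sub
    ((contDiffAt_matrix_inv h h0 _ _).mul (contDiffAt_matrix_inv h h0 _ _))

/-- The Leibniz rule for the divergence produces derivatives of the inverse metric; the first sum in
`lowF` cancels exactly these, and `gⁱʲ Ricᵢⱼ` remains. -/
theorem coordScal_eq_div {G : Eu n → Matrix (Fin n) (Fin n) ℝ} {y : Eu n}
    (h : ∀ i j, ContDiffAt ℝ ∞ (fun z => G z i j) y) (h0 : (G y).det ≠ 0) :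
    coordScal G y = ∑ k, pderiv k (fun z => ∑ i, ∑ j,
        ((G z)⁻¹ i j * Gam G k i j z - (G z)⁻¹ i k * Gam G j i j z)) y +
      lowF (G y)⁻¹ (fun a i j => pderiv a (fun z => (G z)⁻¹ i j) y)
        (fun k i j => Gam G k i j y) := by
  have hI : ∀ i j, DifferentiableAt ℝ (fun z => (G z)⁻¹ i j) y :=
    fun i j => (contDiffAt_matrix_inv h h0 i j).differentiableAt_infty
  have hΓ : ∀ k i j, DifferentiableAt ℝ (Gam G k i j) y :=
    fun k i j => (contDiffAt_Gam h h0 k i j).differentiableAt_infty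
  have e1 : ∀ k, pderiv k (fun z => ∑ i, ∑ j,
        ((G z)⁻¹ i j * Gam G k i j z - (G z)⁻¹ i k * Gam G j i j z)) y =
      ∑ i, ∑ j, ((pderiv k (fun z => (G z)⁻¹ i j) y * Gam G k i j y +
        (G y)⁻¹ i j * pderiv k (Gam G k i j) y) -
        (pderiv k (fun z => (G z)⁻¹ i k) y * Gam G j i j y +
        (G y)⁻¹ i k * pderiv k (Gam G j i j) y)) := by
    intro k
    have m1 : ∀ i j, DifferentiableAt ℝ (fun z => (G z)⁻¹ i j * Gam G k i j z) y :=
      fun i j => (hI i j).fun_mul (hΓ k i j)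
    have m2 : ∀ i j, DifferentiableAt ℝ (fun z => (G z)⁻¹ i k * Gam G j i j z) y :=
      fun i j => (hI i k).fun_mul (hΓ j i j)
    rw [pderiv_sum _ (fun i _ => DifferentiableAt.fun_sum fun j _ => (m1 i j).fun_sub (m2 i j))]
    refine Finset.sum_congr rfl fun i _ => ?_
    rw [pderiv_sum _ (fun j _ => (m1 i j).fun_sub (m2 i j))]
    refine Finset.sum_congr rfl fun j _ => ?_
    rw [pderiv_sub (m1 i j) (m2 i j), pderiv_mul (hI i j) (hΓ k i j), pderiv_mul (hI i k) (hΓ j i j)]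
  simp only [e1]
  have r1 : ∀ f : Fin n → Fin n → Fin n → ℝ, ∑ k, ∑ i, ∑ j, f k i j = ∑ i, ∑ j, ∑ k, f k i j := by
    intro f
    rw [Finset.sum_comm]
    exact Finset.sum_congr rfl fun i _ => Finset.sum_comm
  have r2 : ∀ f : Fin n → Fin n → Fin n → ℝ, ∑ k, ∑ i, ∑ j, f k i j = ∑ i, ∑ k, ∑ j, f k i j :=
    fun f => Finset.sum_comm
  simp only [Finset.sum_sub_distrib, Finset.sum_add_distrib]
  rw [r1 (fun k i j => pderiv k (fun z => (G z)⁻¹ i j) y * Gam G k i j y),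
    r1 (fun k i j => (G y)⁻¹ i j * pderiv k (Gam G k i j) y),
    r2 (fun k i j => pderiv k (fun z => (G z)⁻¹ i k) y * Gam G j i j y),
    r2 (fun k i j => (G y)⁻¹ i k * pderiv k (Gam G j i j) y)]
  simp only [coordScal, ricci, lowF, mul_add, mul_sub, Finset.mul_sum, Finset.sum_add_distrib,
    Finset.sum_sub_distrib, neg_mul, Finset.sum_neg_distrib]
  have r3 : ∑ i, ∑ j, ∑ m, ∑ s, (G y)⁻¹ i j * (Gam G m m s y * Gam G s i j y) =
      ∑ i, ∑ j, ∑ m, ∑ k, (G y)⁻¹ i j * (Gam G m i j y * Gam G k k m y) := by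
    refine Finset.sum_congr rfl fun i _ => Finset.sum_congr rfl fun j _ => ?_
    rw [Finset.sum_comm]
    refine Finset.sum_congr rfl fun m _ => Finset.sum_congr rfl fun k _ => ?_
    ring
  have r4 : ∑ i, ∑ j, ∑ m, ∑ s, (G y)⁻¹ i j * (Gam G m j s y * Gam G s i m y) =
      ∑ i, ∑ j, ∑ m, ∑ k, (G y)⁻¹ i j * (Gam G m i k y * Gam G k j m y) := by
    refine Finset.sum_congr rfl fun i _ => Finset.sum_congr rfl fun j _ => ?_
    rw [Finset.sum_comm]
    refine Finset.sum_congr rfl fun m _ => Finset.sum_congr rfl fun k _ => ?_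
    ring
  rw [r3, r4]
  ring

/-- The scalar curvature of a smooth metric, in divergence form. -/
theorem coordScal_eq {G : Eu n → Matrix (Fin n) (Fin n) ℝ} {y : Eu n} (hG : ∀ z, (G z).IsSymm)
    (h : ∀ i j, ContDiffAt ℝ ∞ (fun z => G z i j) y) (h0 : (G y).det ≠ 0) :
    coordScal G y = ∑ k, ∑ j, ∑ a, ∑ b,
      (pderiv k (fun z => bcoef (G z)⁻¹ k j a b) y * pderiv j (fun z => G z a b) y +
        bcoef (G y)⁻¹ k j a b * pderiv k (pderiv j (fun z => G z a b)) y) +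
      lowF (G y)⁻¹ (fun a i j => pderiv a (fun z => (G z)⁻¹ i j) y)
        (fun k i j => Gam G k i j y) := by
  rw [coordScal_eq_div h h0]
  congr 1
  refine Finset.sum_congr rfl fun k _ => ?_
  have hB : ∀ j a b, DifferentiableAt ℝ (fun z => bcoef (G z)⁻¹ k j a b) y :=
    fun j a b => (contDiffAt_bcoef h h0 k j a b).differentiableAt_infty
  have hd : ∀ j a b, DifferentiableAt ℝ (pderiv j (fun z => G z a b)) y :=
    fun j a b => (contDiffAt_pderiv (h a b) j).differentiableAt_infty
  simp only [contract_Gam hG k]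
  have hm : ∀ j a b, DifferentiableAt ℝ
      (fun z => bcoef (G z)⁻¹ k j a b * pderiv j (fun z => G z a b) z) y :=
    fun j a b => (hB j a b).fun_mul (hd j a b)
  rw [pderiv_sum _ (fun j _ => DifferentiableAt.fun_sum fun a _ => DifferentiableAt.fun_sum fun b _ =>
    hm j a b)]
  refine Finset.sum_congr rfl fun j _ => ?_
  rw [pderiv_sum _ (fun a _ => DifferentiableAt.fun_sum fun b _ => hm j a b)]
  refine Finset.sum_congr rfl fun a _ => ?_
  rw [pderiv_sum _ (fun b _ => hm j a b)]
  refine Finset.sum_congr rfl fun b _ => ?_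
  exact pderiv_mul (hB j a b) (hd j a b) k

end Coord


/-! ### Covariance of the scalar curvature -/

section Covariance

variable {n : ℕ}

theorem pderiv_const (c : ℝ) (a : Fin n) (y : Eu n) : pderiv a (fun _ => c) y = 0 := by
  simp [pderiv]

theorem pderiv_comm {f : Eu n → ℝ} {y : Eu n} (hf : ContDiffAt ℝ ∞ f y) (a b : Fin n) :
    pderiv a (pderiv b f) y = pderiv b (pderiv a f) y := by
  have hd : DifferentiableAt ℝ (fderiv ℝ f) y :=
    (hf.fderiv_right (m := ∞) (by simp)).differentiableAt (by simp)
  have h : ∀ u v : Fin n, pderiv u (pderiv v f) y =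
      fderiv ℝ (fderiv ℝ f) y (stdVec u) (stdVec v) := by
    intro u v
    have : fderiv ℝ (fun z => fderiv ℝ f z (stdVec v)) y = _ :=
      (hd.hasFDerivAt.clm_apply (hasFDerivAt_const (stdVec v) y)).fderiv
    change fderiv ℝ (fun z => fderiv ℝ f z (stdVec v)) y (stdVec u) = _
    rw [this]
    simp
  rw [h, h]
  exact (hf.isSymmSndFDerivAt (by simpa using (by exact_mod_cast le_top : ((2 : ℕ∞) : WithTop ℕ∞) ≤ ((⊤ : ℕ∞) : WithTop ℕ∞)))) _ _

/-- The entrywise partial derivative of a matrix-valued function. -/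
def matD {m : ℕ} (a : Fin n) (M : Eu n → Matrix (Fin m) (Fin m) ℝ) (y : Eu n) :
    Matrix (Fin m) (Fin m) ℝ := Matrix.of fun i j => pderiv a (fun z => M z i j) y

/-- The entries of `M` are differentiable at `y`. -/
def MatDiffAt {m : ℕ} (M : Eu n → Matrix (Fin m) (Fin m) ℝ) (y : Eu n) : Prop :=
  ∀ i j, DifferentiableAt ℝ (fun z => M z i j) y

section MatD

variable {m : ℕ} {A B : Eu n → Matrix (Fin m) (Fin m) ℝ} {y : Eu n}

theorem MatDiffAt.mul (hA : MatDiffAt A y) (hB : MatDiffAt B y) :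
    MatDiffAt (fun z => A z * B z) y := fun i j => by
  simp only [Matrix.mul_apply]
  exact DifferentiableAt.fun_sum fun k _ => (hA i k).fun_mul (hB k j)

theorem MatDiffAt.sum {ι : Type*} {s : Finset ι} {A : ι → Eu n → Matrix (Fin m) (Fin m) ℝ}
    (hA : ∀ i ∈ s, MatDiffAt (A i) y) : MatDiffAt (fun z => ∑ i ∈ s, A i z) y := fun i j => by
  simp only [Matrix.sum_apply]
  exact DifferentiableAt.fun_sum fun k hk => hA k hk i j

theorem MatDiffAt.smul {f : Eu n → ℝ} (hf : DifferentiableAt ℝ f y) (hA : MatDiffAt A y) :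
    MatDiffAt (fun z => f z • A z) y := fun i j => hf.fun_mul (hA i j)

theorem matD_mul (hA : MatDiffAt A y) (hB : MatDiffAt B y) (a : Fin n) :
    matD a (fun z => A z * B z) y = matD a A y * B y + A y * matD a B y := by
  ext i j
  simp only [matD, Matrix.of_apply, Matrix.add_apply, Matrix.mul_apply]
  rw [pderiv_sum _ (fun k _ => (hA i k).fun_mul (hB k j)), ← Finset.sum_add_distrib]
  exact Finset.sum_congr rfl fun k _ => pderiv_mul (hA i k) (hB k j) a

theorem matD_add (hA : MatDiffAt A y) (hB : MatDiffAt B y) (a : Fin n) :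
    matD a (fun z => A z + B z) y = matD a A y + matD a B y := by
  ext i j
  exact pderiv_add (hA i j) (hB i j) a

theorem matD_sum {ι : Type*} {s : Finset ι} {A : ι → Eu n → Matrix (Fin m) (Fin m) ℝ}
    (hA : ∀ i ∈ s, MatDiffAt (A i) y) (a : Fin n) :
    matD a (fun z => ∑ i ∈ s, A i z) y = ∑ i ∈ s, matD a (A i) y := by
  ext i j
  simp only [matD, Matrix.of_apply, Matrix.sum_apply]
  exact pderiv_sum _ (fun k hk => hA k hk i j) a

theorem matD_smul {f : Eu n → ℝ} (hf : DifferentiableAt ℝ f y) (hA : MatDiffAt A y) (a : Fin n) :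
    matD a (fun z => f z • A z) y = pderiv a f y • A y + f y • matD a A y := by
  ext i j
  exact pderiv_mul hf (hA i j) a

theorem matD_congr (h : A =ᶠ[𝓝 y] B) (a : Fin n) : matD a A y = matD a B y := by
  ext i j
  exact pderiv_congr (h.mono fun z hz => by simp only [hz]) a

end MatD

/-- The Jacobian matrix of a map `ℝⁿ → ℝⁿ`. -/
def jac (φ : Eu n → Eu n) (y : Eu n) : Matrix (Fin n) (Fin n) ℝ :=
  Matrix.of fun c a => pderiv a (fun z => φ z c) y

theorem matD_comp {m : ℕ} {A : Eu n → Matrix (Fin m) (Fin m) ℝ} {φ : Eu n → Eu n} {y : Eu n}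
    (hA : MatDiffAt A (φ y)) (hφ : DifferentiableAt ℝ φ y) (a : Fin n) :
    matD a (fun z => A (φ z)) y = ∑ c, jac φ y c a • matD c A (φ y) := by
  ext i j
  simp only [Matrix.sum_apply, Matrix.smul_apply]
  exact pderiv_comp (hA i j) hφ a

theorem MatDiffAt.comp {m : ℕ} {A : Eu n → Matrix (Fin m) (Fin m) ℝ} {φ : Eu n → Eu n} {y : Eu n}
    (hA : MatDiffAt A (φ y)) (hφ : DifferentiableAt ℝ φ y) : MatDiffAt (fun z => A (φ z)) y :=
  fun i j => (hA i j).fun_comp' y hφ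

theorem contDiffAt_jac {φ : Eu n → Eu n} {y : Eu n} (hφ : ContDiffAt ℝ ∞ φ y) (c a : Fin n) :
    ContDiffAt ℝ ∞ (fun z => jac φ z c a) y :=
  contDiffAt_pderiv (contDiffAt_apply hφ c) a

theorem matDiffAt_jac {φ : Eu n → Eu n} {y : Eu n} (hφ : ContDiffAt ℝ ∞ φ y) :
    MatDiffAt (jac φ) y := fun c a => (contDiffAt_jac hφ c a).differentiableAt_infty

theorem pderiv_jac_comm {φ : Eu n → Eu n} {y : Eu n} (hφ : ContDiffAt ℝ ∞ φ y) (i j c : Fin n) :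
    pderiv i (fun z => jac φ z c j) y = pderiv j (fun z => jac φ z c i) y :=
  pderiv_comm (contDiffAt_apply hφ c) i j

/-- The connection matrices `(Γᵢ)ᵏⱼ = Γᵏᵢⱼ`. -/
def conn (G : Eu n → Matrix (Fin n) (Fin n) ℝ) (i : Fin n) (y : Eu n) :
    Matrix (Fin n) (Fin n) ℝ := Matrix.of fun k j => Gam G k i j y

/-- The curvature matrices `∂ᵢ Γⱼ - ∂ⱼ Γᵢ + Γᵢ Γⱼ - Γⱼ Γᵢ`. -/
def curv (G : Eu n → Matrix (Fin n) (Fin n) ℝ) (i j : Fin n) (y : Eu n) :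
    Matrix (Fin n) (Fin n) ℝ :=
  matD i (conn G j) y - matD j (conn G i) y + conn G i y * conn G j y - conn G j y * conn G i y

theorem Gam_symm {G : Eu n → Matrix (Fin n) (Fin n) ℝ} (hG : ∀ z, (G z).IsSymm) (k i j : Fin n)
    (y : Eu n) : Gam G k i j y = Gam G k j i y := by
  have h : ∀ a b, (fun z => G z a b) = fun z => G z b a := fun a b =>
    funext fun z => (hG z).apply b a
  simp only [Gam, christoffel]
  congr 1
  refine Finset.sum_congr rfl fun l _ => ?_
  rw [h i j]
  ring

/-- With the symmetry of the Christoffel symbols the Ricci tensor is a trace of curvature matrices,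
for which a change of chart is a conjugation. -/
theorem coordScal_eq_curv {G : Eu n → Matrix (Fin n) (Fin n) ℝ} (hG : ∀ z, (G z).IsSymm)
    (y : Eu n) : coordScal G y = ∑ i, ∑ j, ∑ m, (G y)⁻¹ i j * curv G m j y m i := by
  refine Finset.sum_congr rfl fun i _ => Finset.sum_congr rfl fun j _ => ?_
  rw [ricci, ← Finset.mul_sum, ← Finset.sum_add_distrib]
  congr 1
  refine Finset.sum_congr rfl fun m _ => ?_
  have h1 : (fun z => conn G j z m i) = Gam G m i j := funext fun z => Gam_symm hG m j i z
  have h2 : (fun z => conn G m z m i) = Gam G m i m := funext fun z => Gam_symm hG m m i z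
  simp only [curv, Matrix.sub_apply, Matrix.add_apply, matD, Matrix.of_apply, Matrix.mul_apply]
  rw [h1, h2, add_sub_assoc, ← Finset.sum_sub_distrib]
  congr 1
  refine Finset.sum_congr rfl fun s _ => ?_
  simp only [conn, Matrix.of_apply]
  rw [Gam_symm hG s j i, Gam_symm hG s m i]

/-- Contravariance of the inverse metric. Only `J` has to be invertible, since the matrix inverse
reverses products without any condition. -/
theorem jac_mul_inv_mul_transpose {G J : Matrix (Fin n) (Fin n) ℝ} (hJ : J.det ≠ 0) :
    J * (J.transpose * G * J)⁻¹ * J.transpose = G⁻¹ := by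
  have h : IsUnit J.det := isUnit_iff_ne_zero.mpr hJ
  have h' : IsUnit J.transpose.det := by rwa [Matrix.det_transpose]
  rw [Matrix.mul_inv_rev, Matrix.mul_inv_rev, ← Matrix.mul_assoc, Matrix.mul_nonsing_inv _ h,
    Matrix.one_mul, Matrix.mul_assoc, Matrix.nonsing_inv_mul _ h', Matrix.mul_one]

/-- The transformation law of the Christoffel symbols, algebraic form. -/
theorem christoffel_transform {G J : Matrix (Fin n) (Fin n) ℝ} (hG : G.IsSymm) (hJ : J.det ≠ 0)
    (h0 : G.det ≠ 0) {d d' K : Fin n → Fin n → Fin n → ℝ} (hK : ∀ c i j, K c i j = K c j i)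
    (hd : ∀ i j l, d' i j l = ∑ c, ∑ e, (K c i j * G c e * J e l + J c j * G c e * K e i l) +
      ∑ a, ∑ c, ∑ e, J a i * J c j * J e l * d a c e) (c i j : Fin n) :
    ∑ k, J c k * christoffel (J.transpose * G * J) d' k i j =
      K c i j + ∑ a, ∑ b, J a i * J b j * christoffel G d c a b := by
  -- `s` and `t` are twice the Christoffel symbols of the first kind: `s` in the new coordinates,
  -- `t` in the old ones with two indices pulled back.
  set t : Fin n → ℝ := fun e => ∑ a, ∑ b, J a i * J b j * (d a b e + d b a e - d e a b) with ht
  set s : Fin n → ℝ := fun l => d' i j l + d' j i l - d' l i j with hs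
  have hX : ∀ i j l, ∑ c, ∑ e, J c j * G c e * K e i l = ∑ c, ∑ e, K c i l * G c e * J e j := by
    intro i j l
    rw [Finset.sum_comm]
    refine Finset.sum_congr rfl fun c _ => Finset.sum_congr rfl fun e _ => ?_
    rw [hG.apply c e]; ring
  -- In the alternating sum the second derivatives `K` having `l` among their indices cancel by
  -- symmetry of `K` and `G`, and the one with indices `i, j` is doubled.
  have hst : s = Matrix.mulVec J.transpose ((2 : ℝ) • Matrix.mulVec G (fun c => K c i j) + t) := by
    ext l
    have h1 : s l = 2 * (∑ c, ∑ e, K c i j * G c e * J e l) + ∑ e, J e l * t e := by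
      have hK1 : ∀ l i j, ∑ c, ∑ e, K c i j * G c e * J e l = ∑ c, ∑ e, K c j i * G c e * J e l :=
        fun l i j => Finset.sum_congr rfl fun c _ => Finset.sum_congr rfl fun e _ => by rw [hK c i j]
      have hY1 : ∑ a, ∑ c, ∑ e, J a j * J c i * J e l * d a c e =
          ∑ a, ∑ c, ∑ e, J a i * J c j * J e l * d c a e := by
        rw [Finset.sum_comm]
        refine Finset.sum_congr rfl fun a _ => Finset.sum_congr rfl fun c _ =>
          Finset.sum_congr rfl fun e _ => ?_
        ring
      have hY2 : ∑ a, ∑ c, ∑ e, J a l * J c i * J e j * d a c e =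
          ∑ a, ∑ c, ∑ e, J a i * J c j * J e l * d e a c := by
        rw [Finset.sum_comm]
        refine Finset.sum_congr rfl fun a _ => ?_
        rw [Finset.sum_comm]
        refine Finset.sum_congr rfl fun c _ => Finset.sum_congr rfl fun e _ => ?_
        ring
      have hY3 : ∑ e, J e l * t e = ∑ a, ∑ c, ∑ e, J a i * J c j * J e l * d a c e +
          ∑ a, ∑ c, ∑ e, J a i * J c j * J e l * d c a e -
          ∑ a, ∑ c, ∑ e, J a i * J c j * J e l * d e a c := by
        simp only [ht, Finset.mul_sum, ← Finset.sum_add_distrib, ← Finset.sum_sub_distrib]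
        rw [Finset.sum_comm]
        refine Finset.sum_congr rfl fun a _ => ?_
        rw [Finset.sum_comm]
        refine Finset.sum_congr rfl fun c _ => Finset.sum_congr rfl fun e _ => ?_
        ring
      simp only [hs, hd, Finset.sum_add_distrib, hX]
      rw [hY1, hY2, hY3, hK1 l j i, hK1 j l i, hK1 i l j]
      ring
    rw [h1]
    simp only [Matrix.mulVec, dotProduct, Matrix.transpose_apply, Pi.add_apply, Pi.smul_apply,
      smul_eq_mul, mul_add, Finset.sum_add_distrib]
    congr 1
    rw [Finset.sum_comm, Finset.mul_sum]
    refine Finset.sum_congr rfl fun e _ => ?_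
    rw [Finset.mul_sum, Finset.mul_sum, Finset.mul_sum]
    refine Finset.sum_congr rfl fun c _ => ?_
    rw [hG.apply c e]; ring
  have hΓ' : (fun k => christoffel (J.transpose * G * J) d' k i j) =
      (1 / 2 : ℝ) • Matrix.mulVec (J.transpose * G * J)⁻¹ s := by
    ext k
    simp only [christoffel, Pi.smul_apply, smul_eq_mul, Matrix.mulVec, dotProduct, hs]
  have hΓ : (fun k => ∑ a, ∑ b, J a i * J b j * christoffel G d k a b) =
      (1 / 2 : ℝ) • Matrix.mulVec G⁻¹ t := by
    ext k
    simp only [christoffel, Pi.smul_apply, smul_eq_mul, Matrix.mulVec, dotProduct, ht,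
      Finset.mul_sum]
    symm
    calc ∑ e, ∑ a, ∑ b, 1 / 2 * (G⁻¹ k e * (J a i * J b j * (d a b e + d b a e - d e a b)))
        = ∑ a, ∑ e, ∑ b, 1 / 2 * (G⁻¹ k e * (J a i * J b j * (d a b e + d b a e - d e a b))) :=
          Finset.sum_comm
      _ = ∑ a, ∑ b, ∑ e, 1 / 2 * (G⁻¹ k e * (J a i * J b j * (d a b e + d b a e - d e a b))) :=
          Finset.sum_congr rfl fun a _ => Finset.sum_comm
      _ = _ := by
          refine Finset.sum_congr rfl fun a _ => Finset.sum_congr rfl fun b _ =>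
            Finset.sum_congr rfl fun e _ => ?_
          ring
  have key : Matrix.mulVec J (fun k => christoffel (J.transpose * G * J) d' k i j) =
      (fun c => K c i j) + fun k => ∑ a, ∑ b, J a i * J b j * christoffel G d k a b := by
    rw [hΓ', hΓ, hst, Matrix.mulVec_smul, Matrix.mulVec_mulVec, Matrix.mulVec_mulVec,
      jac_mul_inv_mul_transpose hJ, Matrix.mulVec_add, Matrix.mulVec_smul, Matrix.mulVec_mulVec,
      Matrix.nonsing_inv_mul _ (isUnit_iff_ne_zero.mpr h0), Matrix.one_mulVec, smul_add, smul_smul]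
    norm_num
  exact congrFun key c

theorem matD_transform {G G' : Eu n → Matrix (Fin n) (Fin n) ℝ} {φ : Eu n → Eu n} {y : Eu n}
    (hφ : ContDiffAt ℝ ∞ φ y) (hG : MatDiffAt G (φ y))
    (hG' : G' =ᶠ[𝓝 y] fun z => (jac φ z).transpose * G (φ z) * jac φ z) (i j l : Fin n) :
    matD i G' y j l = ∑ c, ∑ e, (pderiv i (fun z => jac φ z c j) y * G (φ y) c e * jac φ y e l +
        jac φ y c j * G (φ y) c e * pderiv i (fun z => jac φ z e l) y) +
      ∑ a, ∑ c, ∑ e, jac φ y a i * jac φ y c j * jac φ y e l * matD a G (φ y) c e := by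
  have hJ := matDiffAt_jac hφ
  have hJt : MatDiffAt (fun z => (jac φ z).transpose) y := fun i j => hJ j i
  have hφd : DifferentiableAt ℝ φ y := hφ.differentiableAt (by simp)
  have hGφ := hG.comp hφd
  rw [matD_congr hG', matD_mul (hJt.mul hGφ) hJ, matD_mul hJt hGφ, matD_comp hG hφd]
  have e1 : (matD i (fun z => (jac φ z).transpose) y * G (φ y) * jac φ y) j l =
      ∑ c, ∑ e, pderiv i (fun z => jac φ z c j) y * G (φ y) c e * jac φ y e l := by
    rw [Finset.sum_comm]
    simp only [Matrix.mul_apply, Finset.sum_mul]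
    rfl
  have e2 : ((jac φ y).transpose * G (φ y) * matD i (jac φ) y) j l =
      ∑ c, ∑ e, jac φ y c j * G (φ y) c e * pderiv i (fun z => jac φ z e l) y := by
    rw [Finset.sum_comm]
    simp only [Matrix.mul_apply, Finset.sum_mul]
    rfl
  have e3 : ((jac φ y).transpose * (∑ a, jac φ y a i • matD a G (φ y)) * jac φ y) j l =
      ∑ a, ∑ c, ∑ e, jac φ y a i * jac φ y c j * jac φ y e l * matD a G (φ y) c e := by
    rw [Matrix.mul_sum, Matrix.sum_mul, Matrix.sum_apply]
    refine Finset.sum_congr rfl fun a _ => ?_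
    rw [Matrix.mul_smul, Matrix.smul_mul, Matrix.smul_apply, Finset.sum_comm]
    simp only [Matrix.mul_apply, Finset.sum_mul, smul_eq_mul, Finset.mul_sum,
      Matrix.transpose_apply]
    refine Finset.sum_congr rfl fun e _ => Finset.sum_congr rfl fun c _ => ?_
    ring
  rw [Matrix.add_mul, Matrix.add_apply, Matrix.add_apply, e1, e2, e3]
  simp only [Finset.sum_add_distrib]
  ring

/-- The transformation law `J Γ'ⱼ = Pⱼ J + ∂ⱼ J` of the connection matrices. -/
theorem conn_transform {G G' : Eu n → Matrix (Fin n) (Fin n) ℝ} {φ : Eu n → Eu n} {y : Eu n}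
    (hφ : ContDiffAt ℝ ∞ φ y) (hG : MatDiffAt G (φ y)) (hGs : (G (φ y)).IsSymm)
    (hG' : G' =ᶠ[𝓝 y] fun z => (jac φ z).transpose * G (φ z) * jac φ z)
    (hJ : (jac φ y).det ≠ 0) (h0 : (G (φ y)).det ≠ 0) (i : Fin n) :
    jac φ y * conn G' i y =
      (∑ a, jac φ y a i • conn G a (φ y)) * jac φ y + matD i (jac φ) y := by
  ext c j
  have h := christoffel_transform hGs hJ h0
    (d := fun a c e => pderiv a (fun z => G z c e) (φ y))
    (d' := fun i j l => pderiv i (fun z => G' z j l) y)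
    (K := fun c i j => pderiv i (fun z => jac φ z c j) y)
    (fun c i j => pderiv_jac_comm hφ i j c) (fun i j l => matD_transform hφ hG hG' i j l) c i j
  have hl : (jac φ y * conn G' i y) c j = ∑ k, jac φ y c k *
      christoffel ((jac φ y).transpose * G (φ y) * jac φ y)
        (fun i j l => pderiv i (fun z => G' z j l) y) k i j := by
    rw [Matrix.mul_apply, ← hG'.eq_of_nhds]
    rfl
  rw [hl, h, add_comm, Matrix.add_apply]
  congr 1
  rw [Finset.sum_mul, Matrix.sum_apply]
  refine Finset.sum_congr rfl fun a _ => ?_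
  rw [Matrix.smul_mul, Matrix.smul_apply, Matrix.mul_apply, smul_eq_mul, Finset.mul_sum]
  refine Finset.sum_congr rfl fun b _ => ?_
  simp only [conn, Matrix.of_apply, Gam]
  ring

/-- The transformation law of the curvature matrices. -/
theorem curv_transform {U : Set (Eu n)} (hU : IsOpen U) {G G' : Eu n → Matrix (Fin n) (Fin n) ℝ}
    {φ : Eu n → Eu n} (hφ : ∀ y ∈ U, ContDiffAt ℝ ∞ φ y) (hGs : ∀ z, (G z).IsSymm)
    (hG : ∀ y ∈ U, ∀ i j, ContDiffAt ℝ ∞ (fun z => G z i j) (φ y))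
    (hG' : ∀ y ∈ U, G' y = (jac φ y).transpose * G (φ y) * jac φ y)
    (hJ : ∀ y ∈ U, (jac φ y).det ≠ 0) (h0 : ∀ y ∈ U, (G (φ y)).det ≠ 0)
    {y : Eu n} (hy : y ∈ U) (i j : Fin n) :
    jac φ y * curv G' i j y =
      (∑ a, ∑ b, (jac φ y a i * jac φ y b j) • curv G a b (φ y)) * jac φ y := by
  have hev : ∀ z ∈ U, G' =ᶠ[𝓝 z] fun z => (jac φ z).transpose * G (φ z) * jac φ z := fun z hz => by
    filter_upwards [hU.mem_nhds hz] with w hw using hG' w hw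
  have hMG : ∀ z ∈ U, MatDiffAt G (φ z) := fun z hz i j => (hG z hz i j).differentiableAt_infty
  -- `P i` is the old connection pulled back in its form index only, so the transformation law
  -- becomes the gauge transformation `J Γ'ᵢ = Pᵢ J + ∂ᵢ J`.
  set P : Fin n → Eu n → Matrix (Fin n) (Fin n) ℝ :=
    fun i z => ∑ a, jac φ z a i • conn G a (φ z) with hP
  have hconn : ∀ i, ∀ z ∈ U, jac φ z * conn G' i z = P i z * jac φ z + matD i (jac φ) z :=
    fun i z hz => conn_transform (hφ z hz) (hMG z hz) (hGs _) (hev z hz) (hJ z hz) (h0 z hz) i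
  have hφd : DifferentiableAt ℝ φ y := (hφ y hy).differentiableAt (by simp)
  have hJd := matDiffAt_jac (hφ y hy)
  have hJa : ∀ a i, DifferentiableAt ℝ (fun z => jac φ z a i) y := fun a i => hJd a i
  have hcG : ∀ a, MatDiffAt (conn G a) (φ y) := fun a k j =>
    (contDiffAt_Gam (hG y hy) (h0 y hy) k a j).differentiableAt_infty
  have hG'c : ∀ i j, ContDiffAt ℝ ∞ (fun z => G' z i j) y := by
    intro i j
    have : ContDiffAt ℝ ∞ (fun z => ((jac φ z).transpose * G (φ z) * jac φ z) i j) y := by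
      simp only [Matrix.mul_apply, Matrix.transpose_apply]
      exact ContDiffAt.sum fun b _ => (ContDiffAt.sum fun a _ =>
        (contDiffAt_jac (hφ y hy) _ _).mul ((hG y hy a b).comp y (hφ y hy))).mul
          (contDiffAt_jac (hφ y hy) _ _)
    exact this.congr_of_eventuallyEq ((hev y hy).mono fun z hz => by simp only [hz])
  have h0' : (G' y).det ≠ 0 := by
    rw [hG' y hy, Matrix.det_mul, Matrix.det_mul, Matrix.det_transpose]
    exact mul_ne_zero (mul_ne_zero (hJ y hy) (h0 y hy)) (hJ y hy)
  have hcG' : ∀ a, MatDiffAt (conn G' a) y := fun a k j =>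
    (contDiffAt_Gam hG'c h0' k a j).differentiableAt_infty
  have hPd : ∀ i, MatDiffAt (P i) y := fun i =>
    MatDiffAt.sum fun a _ => MatDiffAt.smul (hJa a i) ((hcG a).comp hφd)
  have hdJd : ∀ i, MatDiffAt (matD i (jac φ)) y := fun i k l =>
    (contDiffAt_pderiv (contDiffAt_jac (hφ y hy) k l) i).differentiableAt_infty
  -- Second derivatives of `J` commute, so they drop out when the differentiated law is
  -- antisymmetrised in `i` and `j`.
  have hddJ : matD i (matD j (jac φ)) y = matD j (matD i (jac φ)) y := by
    ext k l
    exact pderiv_comm (contDiffAt_jac (hφ y hy) k l) i j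
  have hdJ : ∀ i j, jac φ y * matD i (conn G' j) y = matD i (P j) y * jac φ y +
      P j y * matD i (jac φ) y + matD i (matD j (jac φ)) y - matD i (jac φ) y * conn G' j y := by
    intro i j
    have h1 : matD i (fun z => jac φ z * conn G' j z) y =
        matD i (fun z => P j z * jac φ z + matD j (jac φ) z) y :=
      matD_congr (by filter_upwards [hU.mem_nhds hy] with z hz using hconn j z hz) i
    rw [matD_mul hJd (hcG' j), matD_add ((hPd j).mul hJd) (hdJd j), matD_mul (hPd j) hJd] at h1
    rw [← h1]
    abel
  have hJC : ∀ i j, jac φ y * (conn G' i y * conn G' j y) =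
      P i y * (P j y * jac φ y + matD j (jac φ) y) + matD i (jac φ) y * conn G' j y := by
    intro i j
    rw [← Matrix.mul_assoc, hconn i y hy, Matrix.add_mul, Matrix.mul_assoc, hconn j y hy]
  have hPc : ∀ i j, matD i (P j) y = ∑ a, pderiv i (fun z => jac φ z a j) y • conn G a (φ y) +
      ∑ a, ∑ b, (jac φ y a i * jac φ y b j) • matD a (conn G b) (φ y) := by
    intro i j
    rw [matD_sum (fun a _ => MatDiffAt.smul (hJa a j) ((hcG a).comp hφd))]
    rw [Finset.sum_comm, ← Finset.sum_add_distrib]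
    refine Finset.sum_congr rfl fun a _ => ?_
    rw [matD_smul (hJa a j) ((hcG a).comp hφd), matD_comp (hcG a) hφd, Finset.smul_sum]
    congr 1
    refine Finset.sum_congr rfl fun b _ => ?_
    rw [smul_smul, mul_comm]
  -- The derivatives of `J` inside `∂ᵢ Pⱼ - ∂ⱼ Pᵢ` cancel because `∂ᵢ J_{aj}` is symmetric in `i`
  -- and `j`; the pulled back curvature is thus the curvature of `P`.
  have hR : (∑ a, ∑ b, (jac φ y a i * jac φ y b j) • curv G a b (φ y)) =
      matD i (P j) y - matD j (P i) y + P i y * P j y - P j y * P i y := by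
    rw [hPc, hPc]
    have h1 : ∑ a, pderiv i (fun z => jac φ z a j) y • conn G a (φ y) =
        ∑ a, pderiv j (fun z => jac φ z a i) y • conn G a (φ y) :=
      Finset.sum_congr rfl fun a _ => by rw [pderiv_jac_comm (hφ y hy) i j a]
    have h2 : ∀ i j, P i y * P j y =
        ∑ a, ∑ b, (jac φ y a i * jac φ y b j) • (conn G a (φ y) * conn G b (φ y)) := by
      intro i j
      simp only [hP, Finset.sum_mul, Finset.mul_sum, Matrix.smul_mul, Matrix.mul_smul, smul_smul]
      rw [Finset.sum_comm]
      exact Finset.sum_congr rfl fun a _ => Finset.sum_congr rfl fun b _ => by rw [mul_comm]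
    rw [h1, h2, h2, Finset.sum_comm (f := fun a b => (jac φ y a j * jac φ y b i) •
        matD a (conn G b) (φ y)),
      Finset.sum_comm (f := fun a b => (jac φ y a j * jac φ y b i) •
        (conn G a (φ y) * conn G b (φ y)))]
    rw [add_sub_add_left_eq_sub]
    simp only [← Finset.sum_add_distrib, ← Finset.sum_sub_distrib]
    refine Finset.sum_congr rfl fun a _ => Finset.sum_congr rfl fun b _ => ?_
    rw [mul_comm (jac φ y b j), curv]
    simp only [smul_add, smul_sub]
  rw [hR, curv, Matrix.mul_sub, Matrix.mul_add, Matrix.mul_sub, hdJ i j, hdJ j i, hJC i j, hJC j i,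
    hddJ]
  noncomm_ring

/-- The scalar curvature of a smooth metric does not depend on the chart. -/
theorem coordScal_transform {U : Set (Eu n)} (hU : IsOpen U)
    {G G' : Eu n → Matrix (Fin n) (Fin n) ℝ}
    {φ : Eu n → Eu n} (hφ : ∀ y ∈ U, ContDiffAt ℝ ∞ φ y) (hGs : ∀ z, (G z).IsSymm)
    (hGs' : ∀ z, (G' z).IsSymm)
    (hG : ∀ y ∈ U, ∀ i j, ContDiffAt ℝ ∞ (fun z => G z i j) (φ y))
    (hG' : ∀ y ∈ U, G' y = (jac φ y).transpose * G (φ y) * jac φ y)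
    (hJ : ∀ y ∈ U, (jac φ y).det ≠ 0) (h0 : ∀ y ∈ U, (G (φ y)).det ≠ 0)
    {y : Eu n} (hy : y ∈ U) : coordScal G' y = coordScal G (φ y) := by
  set J := jac φ y with hJdef
  have hJu : IsUnit J.det := isUnit_iff_ne_zero.mpr (hJ y hy)
  have hc : ∀ m j, curv G' m j y =
      ∑ a, ∑ b, (J a m * J b j) • (J⁻¹ * (curv G a b (φ y) * J)) := by
    intro m j
    have h := curv_transform hU hφ hGs hG hG' hJ h0 hy m j
    calc curv G' m j y = J⁻¹ * (J * curv G' m j y) := by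
          rw [← Matrix.mul_assoc, Matrix.nonsing_inv_mul _ hJu, Matrix.one_mul]
      _ = _ := by
          rw [h]
          simp only [Finset.sum_mul, Finset.mul_sum, Matrix.smul_mul, Matrix.mul_smul]
          rfl
  have hA : ∀ c b, (G (φ y))⁻¹ c b = ∑ i, ∑ j, J c i * (G' y)⁻¹ i j * J b j := by
    intro c b
    rw [← jac_mul_inv_mul_transpose (hJ y hy), ← hG' y hy, Finset.sum_comm]
    simp only [Matrix.mul_apply, Finset.sum_mul, Matrix.transpose_apply]
    rfl
  -- The trace over `m` contracts a factor `J` with the `J⁻¹` of the conjugation; what remains is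
  -- the covariant transformation of the Ricci tensor.
  have hm : ∀ i j, ∑ m, curv G' m j y m i =
      ∑ a, ∑ b, ∑ c, J b j * (curv G a b (φ y) a c * J c i) := by
    intro i j
    simp only [hc, Matrix.sum_apply, Matrix.smul_apply, smul_eq_mul]
    rw [Finset.sum_comm]
    refine Finset.sum_congr rfl fun a _ => ?_
    rw [Finset.sum_comm]
    refine Finset.sum_congr rfl fun b _ => ?_
    have h1 : (J * (J⁻¹ * (curv G a b (φ y) * J))) a i = (curv G a b (φ y) * J) a i := by
      rw [← Matrix.mul_assoc, Matrix.mul_nonsing_inv _ hJu, Matrix.one_mul]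
    rw [Matrix.mul_apply] at h1
    rw [← Finset.mul_sum, ← Matrix.mul_apply, ← h1, Finset.mul_sum]
    refine Finset.sum_congr rfl fun m _ => ?_
    ring
  rw [coordScal_eq_curv hGs', coordScal_eq_curv hGs]
  simp only [← Finset.mul_sum, hm, hA]
  simp only [Finset.mul_sum, Finset.sum_mul]
  have hL : ∀ f : Fin n → Fin n → Fin n → Fin n → Fin n → ℝ,
      ∑ i, ∑ j, ∑ a, ∑ b, ∑ c, f i j a b c = ∑ c, ∑ b, ∑ a, ∑ i, ∑ j, f i j a b c := by
    intro f
    calc _ = ∑ i, ∑ a, ∑ j, ∑ b, ∑ c, f i j a b c :=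
          Finset.sum_congr rfl fun i _ => Finset.sum_comm
      _ = ∑ i, ∑ a, ∑ b, ∑ j, ∑ c, f i j a b c :=
          Finset.sum_congr rfl fun i _ => Finset.sum_congr rfl fun a _ => Finset.sum_comm
      _ = ∑ i, ∑ a, ∑ b, ∑ c, ∑ j, f i j a b c :=
          Finset.sum_congr rfl fun i _ => Finset.sum_congr rfl fun a _ =>
            Finset.sum_congr rfl fun b _ => Finset.sum_comm
      _ = ∑ i, ∑ a, ∑ c, ∑ b, ∑ j, f i j a b c :=
          Finset.sum_congr rfl fun i _ => Finset.sum_congr rfl fun a _ => Finset.sum_comm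
      _ = ∑ i, ∑ c, ∑ a, ∑ b, ∑ j, f i j a b c :=
          Finset.sum_congr rfl fun i _ => Finset.sum_comm
      _ = ∑ i, ∑ c, ∑ b, ∑ a, ∑ j, f i j a b c :=
          Finset.sum_congr rfl fun i _ => Finset.sum_congr rfl fun a _ => Finset.sum_comm
      _ = ∑ c, ∑ i, ∑ b, ∑ a, ∑ j, f i j a b c := Finset.sum_comm
      _ = ∑ c, ∑ b, ∑ i, ∑ a, ∑ j, f i j a b c :=
          Finset.sum_congr rfl fun i _ => Finset.sum_comm
      _ = ∑ c, ∑ b, ∑ a, ∑ i, ∑ j, f i j a b c :=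
          Finset.sum_congr rfl fun i _ => Finset.sum_congr rfl fun a _ => Finset.sum_comm
  rw [hL]
  refine Finset.sum_congr rfl fun c _ => Finset.sum_congr rfl fun b _ =>
    Finset.sum_congr rfl fun a _ => Finset.sum_congr rfl fun i _ => Finset.sum_congr rfl fun j _ => ?_
  ring

end Covariance


/-! ### Convergence of the scalar curvature in a single chart -/

section ChartLemma

variable {n : ℕ} {p q : ℝ≥0∞}

theorem holder_le (p q : ℝ≥0∞) [ENNReal.HolderTriple p p q] : q ≤ p := by
  have := ENNReal.HolderTriple.inv_add_inv_eq_inv p p q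
  rw [← ENNReal.inv_le_inv, ← this]
  exact le_self_add

theorem memLp_of_restrict {f : Eu n → ℝ} {K : Set (Eu n)} (hK : MeasurableSet K)
    (hf : MemLp f q (volume.restrict K)) (h0 : ∀ y ∉ K, f y = 0) : MemLp f q volume := by
  rw [← memLp_indicator_iff_restrict hK] at hf
  rwa [indicator_eq_self.mpr fun y hy => by_contra fun h => hy (h0 y h)] at hf

theorem memLp_mul_cutoff {Ω : Opens (Eu n)} {f η : Eu n → ℝ} (hf : MemLpLoc Ω q f)
    (hη : Continuous η) (hηc : HasCompactSupport η) (hηs : tsupport η ⊆ Ω) :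
    MemLp (fun y => η y * f y) q volume :=
  memLp_of_restrict hηc.isCompact.measurableSet
    (memLp_mul (p := ∞) (q := q) (memLp_of_continuousOn hηc.isCompact hη.continuousOn ∞)
      (hf _ hηc.isCompact hηs))
    fun y hy => by simp only [image_eq_zero_of_notMem_tsupport hy, zero_mul]

theorem continuous_mul_cutoff {Ω : Opens (Eu n)} {f η : Eu n → ℝ} (hf : ContinuousOn f Ω)
    (hη : Continuous η) (hηs : tsupport η ⊆ Ω) : Continuous (fun y => η y * f y) := by
  rw [continuous_iff_continuousAt]
  intro y
  by_cases hy : y ∈ Ω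
  · exact hη.continuousAt.mul (hf.continuousAt (Ω.isOpen.mem_nhds hy))
  · have h := notMem_tsupport_iff_eventuallyEq.mp fun h => hy (hηs h)
    refine (continuousAt_const (y := (0 : ℝ))).congr (h.mono fun z hz => ?_)
    have hz' : η z = 0 := hz
    simp only [hz', zero_mul]

theorem SobConvOn.continuousOn {Ω : Opens (Eu n)} {F : ℝ → Eu n → ℝ} {f : Eu n → ℝ}
    (h : SobConvOn p Ω F f) : ContinuousOn f Ω := by
  obtain ⟨w, hw⟩ := h
  intro y hy
  obtain ⟨K, hK, hyK, hKΩ⟩ := exists_compact_subset Ω.isOpen hy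
  exact ((hw K hK hKΩ).continuousOn.continuousAt (mem_interior_iff_mem_nhds.mp hyK)).continuousWithinAt

theorem SobConvOn.tendsLp_pderiv {Ω : Opens (Eu n)} {F : ℝ → Eu n → ℝ} {f : Eu n → ℝ} (hp : 1 ≤ p)
    (h : SobConvOn p Ω F f) {K : Set (Eu n)} (hK : IsCompact K) (hKΩ : K ⊆ Ω) (a : Fin n) :
    TendsLp p (volume.restrict K) (fun ε => pderiv a (F ε)) (weakPartial Ω a f) :=
  (h.sobConv_weakPartial hp hK hKΩ).deriv a

theorem SobConvOn.tendsLp_top {Ω : Opens (Eu n)} {F : ℝ → Eu n → ℝ} {f : Eu n → ℝ}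
    (h : SobConvOn p Ω F f) {K : Set (Eu n)} (hK : IsCompact K) (hKΩ : K ⊆ Ω) :
    TendsLp ∞ (volume.restrict K) F f := by
  obtain ⟨w, hw⟩ := h
  exact (hw K hK hKΩ).tendsLp_top hK

theorem SobConvOn.memLpLoc_weakPartial {Ω : Opens (Eu n)} {F : ℝ → Eu n → ℝ} {f : Eu n → ℝ}
    (hp : 1 ≤ p) (h : SobConvOn p Ω F f) (a : Fin n) : MemLpLoc Ω p (weakPartial Ω a f) :=
  fun _ hK hKΩ => (h.tendsLp_pderiv hp hK hKΩ a).2.1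

theorem SobConvOn.memLpLoc {Ω : Opens (Eu n)} {F : ℝ → Eu n → ℝ} {f : Eu n → ℝ}
    (h : SobConvOn p Ω F f) : MemLpLoc Ω q f :=
  fun _ hK hKΩ => memLp_of_continuousOn hK (h.continuousOn.mono hKΩ) q

theorem SobConvOn.weakD {Ω : Opens (Eu n)} {F : ℝ → Eu n → ℝ} {f : Eu n → ℝ} (hp : 1 ≤ p)
    (h : SobConvOn p Ω F f) (a : Fin n) : WeakD Ω a f (weakPartial Ω a f) :=
  (isWeakPartial_iff.mp (h.isWeakPartial_weakPartial hp a)).2.2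

theorem SobConvOn.eventually_contDiffAt {Ω : Opens (Eu n)} {F : ℝ → Eu n → ℝ} {f : Eu n → ℝ}
    (h : SobConvOn p Ω F f) {K : Set (Eu n)} (hK : IsCompact K) (hKΩ : K ⊆ Ω) :
    ∀ᶠ ε in 𝓝[>] (0 : ℝ), ∀ y ∈ K, ContDiffAt ℝ ∞ (F ε) y := by
  obtain ⟨w, hw⟩ := h
  exact (hw K hK hKΩ).smooth

theorem locallyIntegrable_of_memLp {f : Eu n → ℝ} (hp : 1 ≤ p) (hf : MemLp f p volume) :
    LocallyIntegrable f volume := hf.locallyIntegrable hp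

theorem exists_cutoff {Ω : Opens (Eu n)} {K : Set (Eu n)} (hK : IsCompact K) (hKΩ : K ⊆ Ω) :
    ∃ ζ : Eu n → ℝ, ContDiff ℝ ∞ ζ ∧ HasCompactSupport ζ ∧ tsupport ζ ⊆ Ω ∧
      ∀ᶠ y in 𝓝ˢ K, ζ y = 1 := by
  obtain ⟨T, hT, hKT, hTΩ⟩ := exists_compact_between hK Ω.isOpen hKΩ
  obtain ⟨f, h1, h2, -⟩ := exists_contMDiffMap_one_nhds_of_subset_interior
    (n := (⊤ : ℕ∞)) 𝓘(ℝ, Eu n) hK.isClosed hKT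
  have hs : tsupport f ⊆ T := closure_minimal (fun y hy => by_contra fun h => hy (h2 y h)) hT.isClosed
  exact ⟨f, f.contMDiff.contDiff, hT.of_isClosed_subset (isClosed_tsupport _) hs, hs.trans hTΩ, h1⟩

theorem tendsLp_mollify_restrict (ρ : Mollifier n) {f : Eu n → ℝ} (hq : 1 ≤ q) (hq' : q ≠ ⊤)
    (hf : MemLp f q volume) (K : Set (Eu n)) :
    TendsLp q (volume.restrict K) (fun ε => cv (ρ.scaled ε) f) f :=
  (ρ.tendsLp_cv hq hq' hf).mono_measure Measure.restrict_le_self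

/-- The contribution of one second derivative `b ∂ₖ ∂ⱼ f` to the commutator of mollification and
curvature. -/
theorem tendsLp_second_order [ENNReal.HolderTriple p p q] (ρ : Mollifier n) (hp' : p ≠ ⊤)
    (hq : 1 ≤ q) {Ω : Opens (Eu n)} {F B : ℝ → Eu n → ℝ} {f b : Eu n → ℝ}
    (hF : SobConvOn p Ω F f) (hB : SobConvOn p Ω B b) {η : Eu n → ℝ} (hη : ContDiff ℝ ∞ η)
    (hηc : HasCompactSupport η) (hηs : tsupport η ⊆ Ω) {L : Set (Eu n)} (hL : IsCompact L)
    (hLΩ : L ⊆ Ω) (k j : Fin n) :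
    TendsLp q (volume.restrict L)
      (fun ε y => cv (pderiv k (ρ.scaled ε)) (fun z => η z * (b z * weakPartial Ω j f z)) y -
        η y * (pderiv k (B ε) y * pderiv j (F ε) y + B ε y * pderiv k (pderiv j (F ε)) y) -
        B ε y * pderiv k (pderiv j
          (fun z => cv (ρ.scaled ε) (fun z => η z * f z) z - η z * F ε z)) y)
      (fun y => b y * (pderiv k η y * weakPartial Ω j f y)) := by
  have hqp : q ≤ p := holder_le p q
  have hp : 1 ≤ p := hq.trans hqp
  have hq' : q ≠ ⊤ := ne_top_of_le_ne_top hp' hqp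
  have hfin : IsFiniteMeasure (volume.restrict L) := ⟨by simpa using hL.measure_lt_top⟩
  -- `b` is controlled only on `Ω`, whereas the commutator lemma wants a compactly supported
  -- function on the whole space. It is applied to `ζ b`; since `ζ = 1` near `L` and near the
  -- support of `η`, the result does not see `ζ`.
  obtain ⟨ζ, hζ, hζc, hζs, hζ1⟩ := exists_cutoff (hL.union hηc.isCompact) (union_subset hLΩ hηs)
  have hζL : ∀ y ∈ L, ζ =ᶠ[𝓝 y] fun _ => 1 := fun y hy =>
    eventually_nhdsSet_iff_forall.mp hζ1 y (Or.inl hy)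
  have hζη : ∀ y, ζ y * η y = η y := by
    intro y
    by_cases hy : y ∈ tsupport η
    · rw [(eventually_nhdsSet_iff_forall.mp hζ1 y (Or.inr hy)).self_of_nhds, one_mul]
    · rw [image_eq_zero_of_notMem_tsupport hy, mul_zero]
  have lf := MemLpLoc.locallyIntegrableOn hp (hF.memLpLoc (q := p))
  have lb := MemLpLoc.locallyIntegrableOn hp (hB.memLpLoc (q := p))
  have lwf := fun a => MemLpLoc.locallyIntegrableOn hp (hF.memLpLoc_weakPartial hp a)
  have lwb := fun a => MemLpLoc.locallyIntegrableOn hp (hB.memLpLoc_weakPartial hp a)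
  have hdη := fun a => contDiff_pderiv hη a
  have hdηc := fun a => hasCompactSupport_pderiv hηc a
  have hdηs := fun a => (tsupport_pderiv_subset a η).trans hηs
  have hddη := contDiff_pderiv (hdη j) k
  have hddηc := hasCompactSupport_pderiv (hdηc j) k
  have hddηs := (tsupport_pderiv_subset k (pderiv j η)).trans (hdηs j)
  -- the commutator term
  set w : Eu n → ℝ := fun z => η z * weakPartial Ω j f z with hw
  have hwLp : MemLp w p volume :=
    memLp_mul_cutoff (hF.memLpLoc_weakPartial hp j) hη.continuous hηc hηs
  have hwc : HasCompactSupport w := hηc.mul_right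
  set W : Fin n → Eu n → ℝ := fun a z => ζ z * weakPartial Ω a b z + pderiv a ζ z * b z with hW
  have hWLp : ∀ a, MemLp (W a) p volume := fun a =>
    (memLp_mul_cutoff (hB.memLpLoc_weakPartial hp a) hζ.continuous hζc hζs).add
      (memLp_mul_cutoff hB.memLpLoc (contDiff_pderiv hζ a).continuous (hasCompactSupport_pderiv hζc a)
        ((tsupport_pderiv_subset a ζ).trans hζs))
  have hWD : ∀ a, WeakD univ a (fun z => ζ z * b z) (W a) := fun a =>
    (hB.weakD hp a).cutoff lb (lwb a) hζ hζc hζs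
  have hBL : SobConv p L B b (fun a => weakPartial Ω a b) := hB.sobConv_weakPartial hp hL hLΩ
  have hBL' : SobConv p L B (fun z => ζ z * b z) (fun a => weakPartial Ω a b) :=
    hBL.congr_right hL fun y hy => by simp only [(hζL y hy).self_of_nhds, one_mul]
  have c1 := tendsLp_commutator ρ hp hp' hq hq' (continuous_mul_cutoff hB.continuousOn hζ.continuous hζs)
    hζc.mul_right hWLp hWD (hBL.aestronglyMeasurable hL) hBL'.rate hwLp hwc k
  have hWL : ∀ y ∈ L, W k y = weakPartial Ω k b y := by
    intro y hy
    have h1 : pderiv k ζ y = 0 := by rw [pderiv_congr (hζL y hy), pderiv_const]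
    simp only [hW, (hζL y hy).self_of_nhds, h1]
    ring
  -- the mollified first-order term
  set u : Eu n → ℝ := fun z => pderiv j η z * weakPartial Ω k f z + pderiv k (pderiv j η) z * f z
    with hu
  have huD : WeakD univ k (fun z => pderiv j η z * f z) u :=
    (hF.weakD hp k).cutoff lf (lwf k) (hdη j) (hdηc j) (hdηs j)
  have huLp : MemLp u p volume :=
    (memLp_mul_cutoff (hF.memLpLoc_weakPartial hp k) (hdη j).continuous (hdηc j) (hdηs j)).add
      (memLp_mul_cutoff hF.memLpLoc hddη.continuous hddηc hddηs)
  have tB := hB.tendsLp_top hL hLΩ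
  have tF := hF.tendsLp_top hL hLΩ
  have tBk := hB.tendsLp_pderiv hp hL hLΩ k
  have tFj := hF.tendsLp_pderiv hp hL hLΩ j
  have tFk := hF.tendsLp_pderiv hp hL hLΩ k
  have tc : ∀ {g : Eu n → ℝ}, Continuous g → TendsLp ∞ (volume.restrict L) (fun _ => g) g :=
    fun hg => TendsLp.const (memLp_of_continuousOn hL hg.continuousOn ∞)
  have c2 := (TendsLp.mul (p := ∞) (q := p) (r := p) hp hp tB
    (tendsLp_mollify_restrict ρ hp hp' huLp L)).mono_exponent hqp hq
  have c3 := TendsLp.mul (p := ∞) (q := q) (r := q) hq hq (tc hη.continuous)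
    (TendsLp.mul (p := p) (q := p) (r := q) hp hq tBk tFj)
  -- These terms account for the difference between `∂ₖ∂ⱼ(η F)` and `η ∂ₖ∂ⱼF`, times `B`. They
  -- involve at most first derivatives of `F`; the second derivatives of `F` cancel and are never
  -- estimated.
  have c4 := (TendsLp.mul (p := ∞) (q := p) (r := p) hp hp tB
    (((TendsLp.mul (p := ∞) (q := ∞) (r := ∞) le_top le_top (tc hddη.continuous) tF).mono_exponent
      le_top hp).add hp ((TendsLp.mul (p := ∞) (q := p) (r := p) hp hp (tc (hdη j).continuous) tFk).add
        hp (TendsLp.mul (p := ∞) (q := p) (r := p) hp hp (tc (hdη k).continuous) tFj)))).mono_exponent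
    hqp hq
  refine (((c1.sub hq c2).sub hq c3).add hq c4).congr ?_ ?_
  · filter_upwards [hF.eventually_contDiffAt hL hLΩ, eventually_pos] with ε hFε hε
    filter_upwards [ae_restrict_mem hL.measurableSet] with y hy
    have hk := ρ.contDiff_scaled ε
    have hkc := ρ.hasCompactSupport_scaled hε
    have hFy := hFε y hy
    have lηf : LocallyIntegrable (fun z => η z * f z) volume := locallyIntegrable_of_memLp hp
      (memLp_mul_cutoff hF.memLpLoc hη.continuous hηc hηs)
    have ldηf : LocallyIntegrable (fun z => pderiv j η z * f z) volume := locallyIntegrable_of_memLp hp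
      (memLp_mul_cutoff hF.memLpLoc (hdη j).continuous (hdηc j) (hdηs j))
    have hNj : pderiv j (cv (ρ.scaled ε) (fun z => η z * f z)) =
        fun y => cv (ρ.scaled ε) w y + cv (ρ.scaled ε) (fun z => pderiv j η z * f z) y := by
      rw [pderiv_cv hk hkc lηf, cv_pderiv_of_weakD ((hF.weakD hp j).cutoff lf (lwf j) hη hηc hηs) hk hkc]
      funext y
      exact cv_add hk.continuous hkc (locallyIntegrable_of_memLp hp hwLp) ldηf y
    have hdcv : ∀ {g : Eu n → ℝ}, LocallyIntegrable g volume → ContDiff ℝ ∞ (cv (ρ.scaled ε) g) :=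
      fun hg => contDiff_cv hk hkc hg
    have lw := locallyIntegrable_of_memLp hp hwLp
    -- One derivative is moved onto `η f`. The other can also be moved for the cut-off part, giving
    -- `u`, but has to stay on the kernel for `w`, which need not have weak derivatives.
    have hNkj : pderiv k (pderiv j (cv (ρ.scaled ε) (fun z => η z * f z))) y =
        cv (pderiv k (ρ.scaled ε)) w y + cv (ρ.scaled ε) u y := by
      rw [hNj, pderiv_add (hdcv lw).contDiffAt.differentiableAt_infty
        (hdcv ldηf).contDiffAt.differentiableAt_infty, pderiv_cv hk hkc lw, pderiv_cv hk hkc ldηf,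
        cv_pderiv_of_weakD huD hk hkc]
    have hfirst : pderiv j (fun z => cv (ρ.scaled ε) (fun z => η z * f z) z - η z * F ε z) =ᶠ[𝓝 y]
        fun z => pderiv j (cv (ρ.scaled ε) (fun z => η z * f z)) z -
          (pderiv j η z * F ε z + η z * pderiv j (F ε) z) := by
      have h2 : ∀ᶠ z in 𝓝 y, DifferentiableAt ℝ (F ε) z :=
        ((hFy.of_le (by exact_mod_cast le_top : (1 : WithTop ℕ∞) ≤ _)).eventually
          (by simp)).mono fun z hz => hz.differentiableAt (by simp)
      filter_upwards [h2] with z hz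
      rw [pderiv_sub (hdcv lηf).contDiffAt.differentiableAt_infty
        (hη.contDiffAt.differentiableAt_infty.fun_mul hz), pderiv_mul
          hη.contDiffAt.differentiableAt_infty hz]
    have hsecond : pderiv k (pderiv j
          (fun z => cv (ρ.scaled ε) (fun z => η z * f z) z - η z * F ε z)) y =
        cv (pderiv k (ρ.scaled ε)) w y + cv (ρ.scaled ε) u y -
          (pderiv k (pderiv j η) y * F ε y + pderiv j η y * pderiv k (F ε) y +
            (pderiv k η y * pderiv j (F ε) y + η y * pderiv k (pderiv j (F ε)) y)) := by
      have d1 := (contDiff_pderiv (hdcv lηf) j).contDiffAt (x := y) |>.differentiableAt_infty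
      have d2 := (hdη j).contDiffAt (x := y) |>.differentiableAt_infty
      have d3 := hη.contDiffAt (x := y) |>.differentiableAt_infty
      have d4 := hFy.differentiableAt_infty
      have d5 := (contDiffAt_pderiv hFy j).differentiableAt_infty
      rw [pderiv_congr hfirst, pderiv_sub d1 ((d2.fun_mul d4).fun_add (d3.fun_mul d5)), hNkj,
        pderiv_add (d2.fun_mul d4) (d3.fun_mul d5), pderiv_mul d2 d4, pderiv_mul d3 d5]
    have hcv : cv (pderiv k (ρ.scaled ε)) (fun z => ζ z * b z * w z) =
        cv (pderiv k (ρ.scaled ε)) (fun z => η z * (b z * weakPartial Ω j f z)) := by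
      congr 1
      funext z
      calc ζ z * b z * w z = ζ z * η z * (b z * weakPartial Ω j f z) := by simp only [hw]; ring
        _ = _ := by rw [hζη]
    rw [hsecond, hcv]
    ring
  · filter_upwards [ae_restrict_mem hL.measurableSet] with y hy
    rw [hWL y hy]
    simp only [hu, hw]
    ring

end ChartLemma


/-! ### The curvature of approximating metrics in one chart. -/

section ChartScal

variable {n : ℕ} {p q : ℝ≥0∞}

theorem distScal_apply {Ω : Opens (Eu n)} {G : Eu n → Matrix (Fin n) (Fin n) ℝ}
    (hV : ∀ k, LocallyIntegrableOn (fieldV Ω G k) Ω volume)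
    (hF : LocallyIntegrableOn (fieldF Ω G) Ω volume) (φ : 𝓓(Ω, ℝ)) :
    distScal Ω G φ = ∑ k, -(∫ z, fieldV Ω G k z * pderiv k φ z) + ∫ z, fieldF Ω G z * φ z := by
  unfold distScal
  rw [add_apply, sum_apply, distOf_apply hF]
  congr 1
  exact Finset.sum_congr rfl fun k _ => lineDeriv_distOf_apply (hV k) k φ

variable {Ω : Opens (Eu n)} {G : Eu n → Matrix (Fin n) (Fin n) ℝ}
  {H : ℝ → Eu n → Matrix (Fin n) (Fin n) ℝ}

theorem SobConvOn.bcoef (hp : 1 ≤ p)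
    (hH : ∀ a b, SobConvOn p Ω (fun ε y => H ε y a b) (fun y => G y a b))
    (h0 : ∀ y ∈ Ω, (G y).det ≠ 0) (k j a b : Fin n) :
    SobConvOn p Ω (fun ε y => bcoef (H ε y)⁻¹ k j a b) (fun y => bcoef (G y)⁻¹ k j a b) := by
  have hI := SobConvOn.matrix_inv hp hH h0
  exact ((hI j a).mul hp (hI k b)).sub hp ((hI k j).mul hp (hI a b))

theorem tendsLp_Gam (hp : 1 ≤ p)
    (hH : ∀ a b, SobConvOn p Ω (fun ε y => H ε y a b) (fun y => G y a b))
    (h0 : ∀ y ∈ Ω, (G y).det ≠ 0) {K : Set (Eu n)} (hK : IsCompact K) (hKΩ : K ⊆ Ω)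
    (k i j : Fin n) :
    TendsLp p (volume.restrict K) (fun ε => Gam (H ε) k i j) (weakGam Ω G k i j) := by
  have hI := SobConvOn.matrix_inv hp hH h0
  have hd := fun i j a => (hH i j).tendsLp_pderiv hp hK hKΩ a
  exact (TendsLp.sum hp _ fun l _ => TendsLp.mul (p := ∞) (q := p) (r := p) hp hp
    ((hI k l).tendsLp_top hK hKΩ) (((hd j l i).add hp (hd i l j)).sub hp (hd i j l))).const_mul (1 / 2)

/-- Every term is a product of two factors converging in `L^p`, possibly times a uniformly
convergent one, so Hölder is enough and no commutator enters. -/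
theorem tendsLp_lowF [ENNReal.HolderTriple p p q] (hq : 1 ≤ q)
    (hH : ∀ a b, SobConvOn p Ω (fun ε y => H ε y a b) (fun y => G y a b))
    (h0 : ∀ y ∈ Ω, (G y).det ≠ 0) {K : Set (Eu n)} (hK : IsCompact K) (hKΩ : K ⊆ Ω) :
    TendsLp q (volume.restrict K)
      (fun ε y => lowF (H ε y)⁻¹ (fun a i j => pderiv a (fun z => (H ε z)⁻¹ i j) y)
        (fun k i j => Gam (H ε) k i j y)) (fieldF Ω G) := by
  have hp : 1 ≤ p := hq.trans (holder_le p q)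
  have hI := SobConvOn.matrix_inv hp hH h0
  have hdI := fun i j a => (hI i j).tendsLp_pderiv hp hK hKΩ a
  have hIt := fun i j => (hI i j).tendsLp_top hK hKΩ
  have hΓ := tendsLp_Gam hp hH h0 hK hKΩ
  exact (TendsLp.sum hq _ fun i _ => TendsLp.sum hq _ fun j _ => TendsLp.sum hq _ fun m _ =>
    (TendsLp.mul (p := p) (q := p) (r := q) hp hq (hdI i j m).neg (hΓ m i j)).add hq
      (TendsLp.mul (p := p) (q := p) (r := q) hp hq (hdI i j j) (hΓ m i m))).add hq
    (TendsLp.sum hq _ fun i _ => TendsLp.sum hq _ fun j _ => TendsLp.sum hq _ fun m _ =>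
      TendsLp.sum hq _ fun k _ => TendsLp.mul (p := ∞) (q := q) (r := q) hq hq (hIt i j)
        ((TendsLp.mul (p := p) (q := p) (r := q) hp hq (hΓ m i j) (hΓ k k m)).sub hq
          (TendsLp.mul (p := p) (q := p) (r := q) hp hq (hΓ m i k) (hΓ k j m))))

/-- Integrability comes for free from convergence, as the limit in `TendsLp` belongs to the space.
-/
theorem memLpLoc_fieldF [ENNReal.HolderTriple p p q] (hq : 1 ≤ q)
    (hH : ∀ a b, SobConvOn p Ω (fun ε y => H ε y a b) (fun y => G y a b))
    (h0 : ∀ y ∈ Ω, (G y).det ≠ 0) : MemLpLoc Ω q (fieldF Ω G) :=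
  fun _ hK hKΩ => (tendsLp_lowF (p := p) hq hH h0 hK hKΩ).2.1

theorem memLpLoc_fieldV (hp : 1 ≤ p)
    (hH : ∀ a b, SobConvOn p Ω (fun ε y => H ε y a b) (fun y => G y a b))
    (h0 : ∀ y ∈ Ω, (G y).det ≠ 0) (k : Fin n) : MemLpLoc Ω p (fieldV Ω G k) := by
  intro K hK hKΩ
  have hI := SobConvOn.matrix_inv hp hH h0
  have hIt := fun i j => (hI i j).tendsLp_top hK hKΩ
  have hΓ := tendsLp_Gam hp hH h0 hK hKΩ
  have h := TendsLp.sum hp Finset.univ fun i _ => TendsLp.sum hp Finset.univ fun j _ =>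
    (TendsLp.mul (p := ∞) (q := p) (r := p) hp hp (hIt i j) (hΓ k i j)).sub hp
      (TendsLp.mul (p := ∞) (q := p) (r := p) hp hp (hIt i k) (hΓ j i j))
  exact h.2.1

/-- The mollification of the localised distributional scalar curvature. -/
theorem distScal_kernel_apply [ENNReal.HolderTriple p p q] (hq : 1 ≤ q)
    (hGs : ∀ z, (G z).IsSymm)
    (hH : ∀ a b, SobConvOn p Ω (fun ε y => H ε y a b) (fun y => G y a b))
    (h0 : ∀ y ∈ Ω, (G y).det ≠ 0) {η k : Eu n → ℝ} (hη : ContDiff ℝ ∞ η)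
    (hηc : HasCompactSupport η) (hηs : tsupport η ⊆ Ω) (hk : ContDiff ℝ ∞ k)
    (hkc : HasCompactSupport k) (y : Eu n) (φ : 𝓓(Ω, ℝ)) (hφ : ∀ z, φ z = η z * k (y - z)) :
    distScal Ω G φ = ∑ c, (-cv k (fun z => pderiv c η z * fieldV Ω G c z) y +
        ∑ j, ∑ a, ∑ b, cv (pderiv c k) (fun z => η z * (bcoef (G z)⁻¹ c j a b *
          weakPartial Ω j (fun z => G z a b) z)) y) + cv k (fun z => η z * fieldF Ω G z) y := by
  have hp : 1 ≤ p := hq.trans (holder_le p q)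
  have mV := memLpLoc_fieldV hp hH h0
  have mF := memLpLoc_fieldF (p := p) hq hH h0
  rw [distScal_apply (fun c => (mV c).locallyIntegrableOn hp) (mF.locallyIntegrableOn hq)]
  have hφe : (φ : Eu n → ℝ) = fun z => η z * k (y - z) := funext hφ
  -- The reflection in `y - z` turns `-∫ V ∂φ` into the convolution of `η V` with `∂k`, minus the
  -- convolution of `(∂η) V` with `k`.
  have hdφ : ∀ c z, pderiv c φ z = pderiv c η z * k (y - z) - η z * pderiv c k (y - z) := by
    intro c z
    have hs : HasFDerivAt (fun z : Eu n => y - z) (-ContinuousLinearMap.id ℝ (Eu n)) z :=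
      (hasFDerivAt_id z).const_sub y
    have h2 : fderiv ℝ (fun z => k (y - z)) z = _ :=
      ((hk.differentiable (by simp) (y - z)).hasFDerivAt.comp z hs).fderiv
    have h1 : pderiv c (fun z => k (y - z)) z = -pderiv c k (y - z) := by
      rw [pderiv, h2]; simp [pderiv]
    have h3 : DifferentiableAt ℝ (fun z => k (y - z)) z :=
      ((hk.differentiable (by simp) (y - z)).hasFDerivAt.comp z hs).differentiableAt
    rw [hφe, pderiv_mul hη.contDiffAt.differentiableAt_infty h3, h1]
    ring
  congr 1
  · refine Finset.sum_congr rfl fun c _ => ?_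
    have hdη := contDiff_pderiv hη c
    have hdηc := hasCompactSupport_pderiv hηc c
    have hdηs := (tsupport_pderiv_subset c η).trans hηs
    have hdk := contDiff_pderiv hk c
    have hdkc := hasCompactSupport_pderiv hkc c
    have l1 : LocallyIntegrable (fun z => pderiv c η z * fieldV Ω G c z) volume :=
      locallyIntegrable_of_memLp hp (memLp_mul_cutoff (mV c) hdη.continuous hdηc hdηs)
    have l2 : LocallyIntegrable (fun z => η z * fieldV Ω G c z) volume :=
      locallyIntegrable_of_memLp hp (memLp_mul_cutoff (mV c) hη.continuous hηc hηs)
    have l3 : ∀ j a b, LocallyIntegrable (fun z => η z * (bcoef (G z)⁻¹ c j a b *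
        weakPartial Ω j (fun z => G z a b) z)) volume := fun j a b =>
      locallyIntegrable_of_memLp hp (memLp_mul_cutoff (fun K hK hKΩ =>
        memLp_mul (p := ∞) (q := p) ((SobConvOn.bcoef hp hH h0 c j a b).memLpLoc K hK hKΩ)
          ((hH a b).memLpLoc_weakPartial hp j K hK hKΩ)) hη.continuous hηc hηs)
    have e1 : cv (pderiv c k) (fun z => η z * fieldV Ω G c z) y =
        ∑ j, ∑ a, ∑ b, cv (pderiv c k) (fun z => η z * (bcoef (G z)⁻¹ c j a b *
          weakPartial Ω j (fun z => G z a b) z)) y := by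
      have l4 : ∀ j a, LocallyIntegrable (fun z => ∑ b, η z * (bcoef (G z)⁻¹ c j a b *
          weakPartial Ω j (fun z => G z a b) z)) volume := fun j a =>
        locallyIntegrable_finsetSum _ fun b _ => l3 j a b
      have l5 : ∀ j, LocallyIntegrable (fun z => ∑ a, ∑ b, η z * (bcoef (G z)⁻¹ c j a b *
          weakPartial Ω j (fun z => G z a b) z)) volume := fun j =>
        locallyIntegrable_finsetSum _ fun a _ => l4 j a
      simp only [fieldV_eq hGs, Finset.mul_sum]
      rw [cv_sum _ hdk.continuous hdkc fun j _ => l5 j]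
      refine Finset.sum_congr rfl fun j _ => ?_
      rw [cv_sum _ hdk.continuous hdkc fun a _ => l4 j a]
      refine Finset.sum_congr rfl fun a _ => ?_
      rw [cv_sum _ hdk.continuous hdkc fun b _ => l3 j a b]
    rw [← e1]
    have i1 := integrable_cv hk.continuous hkc l1 y
    have i2 := integrable_cv hdk.continuous hdkc l2 y
    simp only [cv]
    rw [neg_add_eq_sub, ← neg_sub, ← integral_sub i1 i2]
    congr 1
    refine integral_congr_ae (Eventually.of_forall fun z => ?_)
    simp only [hdφ]
    ring
  · refine integral_congr_ae (Eventually.of_forall fun z => ?_)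
    simp only [hφ]
    ring

/-- In a single chart, mollification of the localised scalar curvature commutes with taking the
curvature, up to an explicit second-order term and an error which tends to zero. -/
theorem tendsLp_chart [ENNReal.HolderTriple p p q] (ρ : Mollifier n) (hp' : p ≠ ⊤)
    (hq : 1 ≤ q) (hGs : ∀ z, (G z).IsSymm) (hHs : ∀ ε, 0 < ε → ∀ z, (H ε z).IsSymm)
    (hH : ∀ a b, SobConvOn p Ω (fun ε y => H ε y a b) (fun y => G y a b))
    (h0 : ∀ y ∈ Ω, (G y).det ≠ 0) {η : Eu n → ℝ} (hη : ContDiff ℝ ∞ η)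
    (hηc : HasCompactSupport η) (hηs : tsupport η ⊆ Ω) {L : Set (Eu n)} (hL : IsCompact L)
    (hLΩ : L ⊆ Ω) (φ : ℝ → Eu n → 𝓓(Ω, ℝ))
    (hφ : ∀ ε y z, φ ε y z = η z * ρ.scaled ε (y - z)) :
    TendsLp q (volume.restrict L)
      (fun ε y => distScal Ω G (φ ε y) - η y * coordScal (H ε) y -
        ∑ k, ∑ j, ∑ a, ∑ b, bcoef (H ε y)⁻¹ k j a b * pderiv k (pderiv j (fun z =>
          cv (ρ.scaled ε) (fun z => η z * G z a b) z - η z * H ε z a b)) y)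
      (fun _ => 0) := by
  have hqp : q ≤ p := holder_le p q
  have hp : 1 ≤ p := hq.trans hqp
  have hq' : q ≠ ⊤ := ne_top_of_le_ne_top hp' hqp
  have hfin : IsFiniteMeasure (volume.restrict L) := ⟨by simpa using hL.measure_lt_top⟩
  have hB := SobConvOn.bcoef hp hH h0
  have mV := memLpLoc_fieldV hp hH h0
  have mF := memLpLoc_fieldF (p := p) hq hH h0
  -- `t1` is the principal part, `t2` the part where the derivative falls on the cut-off; `t3` and
  -- `t4` have the common limit `η` times `fieldF`.
  have t1 := TendsLp.sum hq Finset.univ fun k _ => TendsLp.sum hq Finset.univ fun j _ =>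
    TendsLp.sum hq Finset.univ fun a _ => TendsLp.sum hq Finset.univ fun b _ =>
      tendsLp_second_order ρ hp' hq (hH a b) (hB k j a b) hη hηc hηs hL hLΩ k j
  have t2 := TendsLp.sum hq Finset.univ fun k _ => (tendsLp_mollify_restrict ρ hp hp'
    (memLp_mul_cutoff (mV k) (contDiff_pderiv hη k).continuous (hasCompactSupport_pderiv hηc k)
      ((tsupport_pderiv_subset k η).trans hηs)) L).mono_exponent hqp hq
  have t3 := tendsLp_mollify_restrict ρ hq hq' (memLp_mul_cutoff mF hη.continuous hηc hηs) L
  have t4 := TendsLp.mul (p := ∞) (q := q) (r := q) hq hq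
    (TendsLp.const (memLp_of_continuousOn hL hη.continuous.continuousOn ∞))
    (tendsLp_lowF (p := p) hq hH h0 hL hLΩ)
  have hdet := (SobConvOn.det hp hH)
  refine (((t1.sub hq t2).add hq t3).sub hq t4).congr ?_ ?_
  · have hsm : ∀ᶠ ε in 𝓝[>] (0 : ℝ), ∀ a b, ∀ y ∈ L, ContDiffAt ℝ ∞ (fun z => H ε z a b) y :=
      eventually_all.mpr fun a => eventually_all.mpr fun b => (hH a b).eventually_contDiffAt hL hLΩ
    have hne : ∀ᶠ ε in 𝓝[>] (0 : ℝ), ∀ y ∈ L, (H ε y).det ≠ 0 :=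
      (hdet.sobConv_weakPartial hp hL hLΩ).eventually_ne hL fun y hy => h0 y (hLΩ hy)
    filter_upwards [hsm, hne, eventually_pos] with ε hε1 hε2 hε
    filter_upwards [ae_restrict_mem hL.measurableSet] with y hy
    rw [distScal_kernel_apply (p := p) hq hGs hH h0 hη hηc hηs (ρ.contDiff_scaled ε)
      (ρ.hasCompactSupport_scaled hε) y (φ ε y) (hφ ε y),
      coordScal_eq (hHs ε hε) (fun a b => hε1 a b y hy) (hε2 y hy)]
    simp only [mul_add, Finset.sum_add_distrib, Finset.sum_sub_distrib, Finset.mul_sum,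
      Finset.sum_neg_distrib]
    ring
  -- The limit `b (∂ₖη) ∂ⱼg` left by the second-order terms sums up to `(∂ₖη) Vᵏ` and cancels the
  -- limit of `t2`; those of `t3` and `t4` cancel each other.
  · filter_upwards with y
    simp only [fieldV_eq hGs, Finset.mul_sum]
    rw [add_sub_cancel_right, sub_eq_zero]
    refine Finset.sum_congr rfl fun k _ => Finset.sum_congr rfl fun j _ =>
      Finset.sum_congr rfl fun a _ => Finset.sum_congr rfl fun b _ => ?_
    ring

end ChartScal


/-! ### Transformation of the second-order term under a change of coordinates -/

section SecondOrder

variable {n : ℕ}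

/-- The second-order expression `∑ (gʲᵃ gᵏᵇ - gᵏʲ gᵃᵇ) ∂ₖ ∂ⱼ T_ab` in the metric `H`. -/
def secOrd (H T : Eu n → Matrix (Fin n) (Fin n) ℝ) (y : Eu n) : ℝ :=
  ∑ k, ∑ j, ∑ a, ∑ b, bcoef (H y)⁻¹ k j a b * pderiv k (pderiv j (fun z => T z a b)) y

/-- The products `J_ca J_db` of entries of the Jacobian matrix. -/
def jacProd (φ : Eu n → Eu n) (c d a b : Fin n) (y : Eu n) : ℝ := jac φ y c a * jac φ y d b

/-- The terms of lower order in the transformation of `secOrd`. -/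
def secRem (φ : Eu n → Eu n) (H' T : Eu n → Matrix (Fin n) (Fin n) ℝ) (y : Eu n) : ℝ :=
  ∑ k, ∑ j, ∑ a, ∑ b, bcoef (H' y)⁻¹ k j a b * ∑ c, ∑ d,
    (pderiv k (pderiv j (jacProd φ c d a b)) y * T (φ y) c d +
      ∑ e, (pderiv j (jacProd φ c d a b) y * jac φ y e k +
        pderiv k (jacProd φ c d a b) y * jac φ y e j +
        jacProd φ c d a b y * pderiv k (fun z => jac φ z e j) y) *
          pderiv e (fun z => T z c d) (φ y))

theorem contDiffAt_jacProd {φ : Eu n → Eu n} {y : Eu n} (hφ : ContDiffAt ℝ ∞ φ y)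
    (c d a b : Fin n) : ContDiffAt ℝ ∞ (jacProd φ c d a b) y :=
  (contDiffAt_jac hφ c a).mul (contDiffAt_jac hφ d b)

theorem eventually_differentiableAt {f : Eu n → ℝ} {y : Eu n} (hf : ContDiffAt ℝ ∞ f y) :
    ∀ᶠ z in 𝓝 y, DifferentiableAt ℝ f z :=
  ((hf.of_le (by exact_mod_cast le_top : (1 : WithTop ℕ∞) ≤ _)).eventually (by simp)).mono
    fun _ hz => hz.differentiableAt (by simp)

theorem pderiv_pderiv_mul {f g : Eu n → ℝ} {y : Eu n} (hf : ContDiffAt ℝ ∞ f y)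
    (hg : ContDiffAt ℝ ∞ g y) (k j : Fin n) :
    pderiv k (pderiv j (fun z => f z * g z)) y =
      pderiv k (pderiv j f) y * g y + pderiv j f y * pderiv k g y +
        (pderiv k f y * pderiv j g y + f y * pderiv k (pderiv j g) y) := by
  have h1 : pderiv j (fun z => f z * g z) =ᶠ[𝓝 y] fun z => pderiv j f z * g z + f z * pderiv j g z := by
    filter_upwards [eventually_differentiableAt hf, eventually_differentiableAt hg] with z h1 h2
    exact pderiv_mul h1 h2 j
  have d1 := hf.differentiableAt_infty
  have d2 := hg.differentiableAt_infty
  have d3 := (contDiffAt_pderiv hf j).differentiableAt_infty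
  have d4 := (contDiffAt_pderiv hg j).differentiableAt_infty
  rw [pderiv_congr h1, pderiv_add (d3.fun_mul d2) (d1.fun_mul d4), pderiv_mul d3 d2, pderiv_mul d1 d4]

theorem pderiv_pderiv_sum {ι : Type*} (s : Finset ι) {f : ι → Eu n → ℝ} {y : Eu n}
    (hf : ∀ i ∈ s, ContDiffAt ℝ ∞ (f i) y) (k j : Fin n) :
    pderiv k (pderiv j (fun z => ∑ i ∈ s, f i z)) y = ∑ i ∈ s, pderiv k (pderiv j (f i)) y := by
  have h1 : pderiv j (fun z => ∑ i ∈ s, f i z) =ᶠ[𝓝 y] fun z => ∑ i ∈ s, pderiv j (f i) z := by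
    have h2 : ∀ᶠ z in 𝓝 y, ∀ i ∈ s, DifferentiableAt ℝ (f i) z :=
      (Filter.eventually_all_finset s).mpr fun i hi => eventually_differentiableAt (hf i hi)
    filter_upwards [h2] with z hz
    exact pderiv_sum s hz j
  rw [pderiv_congr h1]
  exact pderiv_sum s (fun i hi => (contDiffAt_pderiv (hf i hi) j).differentiableAt_infty) k

theorem pderiv_pderiv_congr {f g : Eu n → ℝ} {y : Eu n} (h : f =ᶠ[𝓝 y] g) (k j : Fin n) :
    pderiv k (pderiv j f) y = pderiv k (pderiv j g) y :=
  pderiv_congr (h.eventuallyEq_nhds.mono fun _ hz => pderiv_congr hz j) k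

theorem pderiv_pderiv_comp {f : Eu n → ℝ} {φ : Eu n → Eu n} {y : Eu n}
    (hf : ContDiffAt ℝ ∞ f (φ y)) (hφ : ContDiffAt ℝ ∞ φ y) (k j : Fin n) :
    pderiv k (pderiv j (fun z => f (φ z))) y =
      ∑ e, (pderiv k (fun z => jac φ z e j) y * pderiv e f (φ y) +
        jac φ y e j * ∑ g, jac φ y g k * pderiv g (pderiv e f) (φ y)) := by
  have hφd : DifferentiableAt ℝ φ y := hφ.differentiableAt (by simp)
  have hφe : ∀ᶠ z in 𝓝 y, DifferentiableAt ℝ φ z :=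
    ((hφ.of_le (by exact_mod_cast le_top : (1 : WithTop ℕ∞) ≤ _)).eventually (by simp)).mono
      fun _ hz => hz.differentiableAt (by simp)
  have h1 : pderiv j (fun z => f (φ z)) =ᶠ[𝓝 y] fun z => ∑ e, jac φ z e j * pderiv e f (φ z) := by
    filter_upwards [hφe, hφd.continuousAt.eventually (eventually_differentiableAt hf)] with z h2 h3
    exact pderiv_comp h3 h2 j
  have hd : ∀ e, DifferentiableAt ℝ (pderiv e f) (φ y) := fun e =>
    (contDiffAt_pderiv hf e).differentiableAt_infty
  have hd' : ∀ e, DifferentiableAt ℝ (fun z => pderiv e f (φ z)) y := fun e => (hd e).fun_comp' y hφd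
  have hJ : ∀ e, DifferentiableAt ℝ (fun z => jac φ z e j) y := fun e =>
    (contDiffAt_jac hφ e j).differentiableAt_infty
  rw [pderiv_congr h1, pderiv_sum _ fun e _ => (hJ e).fun_mul (hd' e)]
  refine Finset.sum_congr rfl fun e _ => ?_
  rw [pderiv_mul (hJ e) (hd' e), pderiv_comp (hd e) hφd]
  rfl

theorem sum_comm_four {ι κ : Type*} [Fintype ι] [Fintype κ] (f : ι → ι → ι → ι → κ → ℝ) :
    ∑ k, ∑ j, ∑ a, ∑ b, ∑ s, f k j a b s = ∑ s, ∑ k, ∑ j, ∑ a, ∑ b, f k j a b s := by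
  calc _ = ∑ k, ∑ j, ∑ a, ∑ s, ∑ b, f k j a b s :=
        Finset.sum_congr rfl fun _ _ => Finset.sum_congr rfl fun _ _ =>
          Finset.sum_congr rfl fun _ _ => Finset.sum_comm
    _ = ∑ k, ∑ j, ∑ s, ∑ a, ∑ b, f k j a b s :=
        Finset.sum_congr rfl fun _ _ => Finset.sum_congr rfl fun _ _ => Finset.sum_comm
    _ = ∑ k, ∑ s, ∑ j, ∑ a, ∑ b, f k j a b s := Finset.sum_congr rfl fun _ _ => Finset.sum_comm
    _ = _ := Finset.sum_comm

/-- Being quadratic in the inverse metric, `bcoef` is a contravariant tensor with four indices; this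
is why the principal part of `secOrd` does not depend on the chart. -/
theorem bcoef_contract {A' J : Matrix (Fin n) (Fin n) ℝ} (g e c d : Fin n) :
    ∑ k, ∑ j, ∑ a, ∑ b, bcoef A' k j a b * (J c a * J d b * (J e j * J g k)) =
      bcoef (J * A' * J.transpose) g e c d := by
  have hm : ∀ s t, (J * A' * J.transpose) s t = ∑ i, ∑ j, J s i * A' i j * J t j := by
    intro s t
    rw [Finset.sum_comm]
    simp only [Matrix.mul_apply, Finset.sum_mul, Matrix.transpose_apply]
  have h1 : ∑ k, ∑ j, ∑ a, ∑ b, A' j a * A' k b * (J c a * J d b * (J e j * J g k)) =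
      (∑ j, ∑ a, J e j * A' j a * J c a) * ∑ k, ∑ b, J g k * A' k b * J d b := by
    simp only [Finset.sum_mul]
    simp only [Finset.mul_sum]
    calc _ = ∑ j, ∑ k, ∑ a, ∑ b, A' j a * A' k b * (J c a * J d b * (J e j * J g k)) :=
          Finset.sum_comm
      _ = ∑ j, ∑ a, ∑ k, ∑ b, A' j a * A' k b * (J c a * J d b * (J e j * J g k)) :=
          Finset.sum_congr rfl fun _ _ => Finset.sum_comm
      _ = _ := Finset.sum_congr rfl fun _ _ => Finset.sum_congr rfl fun _ _ =>
          Finset.sum_congr rfl fun _ _ => Finset.sum_congr rfl fun _ _ => by ring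
  have h2 : ∑ k, ∑ j, ∑ a, ∑ b, A' k j * A' a b * (J c a * J d b * (J e j * J g k)) =
      (∑ k, ∑ j, J g k * A' k j * J e j) * ∑ a, ∑ b, J c a * A' a b * J d b := by
    simp only [Finset.sum_mul]
    simp only [Finset.mul_sum]
    exact Finset.sum_congr rfl fun _ _ => Finset.sum_congr rfl fun _ _ =>
          Finset.sum_congr rfl fun _ _ => Finset.sum_congr rfl fun _ _ => by ring
  simp only [bcoef, sub_mul, Finset.sum_sub_distrib, h1, h2, hm]

/-- The transformation of `secOrd` under a change of coordinates. -/
theorem secOrd_transform {H H' T T' : Eu n → Matrix (Fin n) (Fin n) ℝ} {φ : Eu n → Eu n} {y : Eu n}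
    (hφ : ContDiffAt ℝ ∞ φ y) (hT : ∀ c d, ContDiffAt ℝ ∞ (fun z => T z c d) (φ y))
    (hJ : (jac φ y).det ≠ 0) (hH' : H' y = (jac φ y).transpose * H (φ y) * jac φ y)
    (hT' : T' =ᶠ[𝓝 y] fun z => (jac φ z).transpose * T (φ z) * jac φ z) :
    secOrd H' T' y = secOrd H T (φ y) + secRem φ H' T y := by
  have hTφ : ∀ c d, ContDiffAt ℝ ∞ (fun z => T (φ z) c d) y := fun c d => (hT c d).comp y hφ
  have hφd : DifferentiableAt ℝ φ y := hφ.differentiableAt (by simp)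
  have hΘ := contDiffAt_jacProd hφ
  -- Product and chain rule: the first sum has both derivatives on `T`, the second collects
  -- everything else and sees only `T` and its first derivatives.
  have key : ∀ k j a b, pderiv k (pderiv j (fun z => T' z a b)) y =
      ∑ c, ∑ d, ∑ e, ∑ g, jac φ y c a * jac φ y d b * (jac φ y e j * jac φ y g k) *
          pderiv g (pderiv e (fun z => T z c d)) (φ y) +
        ∑ c, ∑ d,
          (pderiv k (pderiv j (jacProd φ c d a b)) y * T (φ y) c d +
            ∑ e, (pderiv j (jacProd φ c d a b) y * jac φ y e k +
              pderiv k (jacProd φ c d a b) y * jac φ y e j +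
              jacProd φ c d a b y * pderiv k (fun z => jac φ z e j) y) *
                pderiv e (fun z => T z c d) (φ y)) := by
    intro k j a b
    have h1 : (fun z => T' z a b) =ᶠ[𝓝 y]
        fun z => ∑ c, ∑ d, jacProd φ c d a b z * T (φ z) c d := by
      filter_upwards [hT'] with z hz
      rw [hz, Finset.sum_comm]
      simp only [Matrix.mul_apply, Finset.sum_mul, Matrix.transpose_apply, jacProd]
      refine Finset.sum_congr rfl fun c _ => Finset.sum_congr rfl fun d _ => ?_
      ring
    have hm : ∀ c d, ContDiffAt ℝ ∞ (fun z => jacProd φ c d a b z * T (φ z) c d) y :=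
      fun c d => (hΘ c d a b).mul (hTφ c d)
    rw [pderiv_pderiv_congr h1, pderiv_pderiv_sum _ fun c _ => ContDiffAt.sum fun d _ => hm c d,
      ← Finset.sum_add_distrib]
    refine Finset.sum_congr rfl fun c _ => ?_
    rw [pderiv_pderiv_sum _ fun d _ => hm c d, ← Finset.sum_add_distrib]
    refine Finset.sum_congr rfl fun d _ => ?_
    rw [pderiv_pderiv_mul (hΘ c d a b) (hTφ c d), pderiv_pderiv_comp (f := fun z => T z c d) (hT c d) hφ,
      pderiv_comp (f := fun z => T z c d) (hT c d).differentiableAt_infty hφd,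
      pderiv_comp (f := fun z => T z c d) (hT c d).differentiableAt_infty hφd]
    have e1 : ∑ e, ∑ g, jac φ y c a * jac φ y d b * (jac φ y e j * jac φ y g k) *
          pderiv g (pderiv e (fun z => T z c d)) (φ y) =
        jacProd φ c d a b y * ∑ e, jac φ y e j * ∑ g, jac φ y g k *
          pderiv g (pderiv e (fun z => T z c d)) (φ y) := by
      simp only [Finset.mul_sum, jacProd]
      refine Finset.sum_congr rfl fun e _ => Finset.sum_congr rfl fun g _ => ?_
      ring
    have e2 : ∑ e, (pderiv j (jacProd φ c d a b) y * jac φ y e k +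
              pderiv k (jacProd φ c d a b) y * jac φ y e j +
              jacProd φ c d a b y * pderiv k (fun z => jac φ z e j) y) *
                pderiv e (fun z => T z c d) (φ y) =
        pderiv j (jacProd φ c d a b) y * ∑ e, jac φ y e k * pderiv e (fun z => T z c d) (φ y) +
        pderiv k (jacProd φ c d a b) y * ∑ e, jac φ y e j * pderiv e (fun z => T z c d) (φ y) +
        jacProd φ c d a b y * ∑ e, pderiv k (fun z => jac φ z e j) y *
          pderiv e (fun z => T z c d) (φ y) := by
      simp only [Finset.mul_sum, ← Finset.sum_add_distrib]
      refine Finset.sum_congr rfl fun e _ => ?_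
      ring
    rw [e1, e2, Finset.sum_add_distrib]
    change _ + pderiv j (jacProd φ c d a b) y * ∑ e, jac φ y e k * _ +
      (pderiv k (jacProd φ c d a b) y * ∑ e, jac φ y e j * _ + _) = _
    ring
  have hA : jac φ y * (H' y)⁻¹ * (jac φ y).transpose = (H (φ y))⁻¹ := by
    rw [hH', jac_mul_inv_mul_transpose hJ]
  have split : ∀ B M R : Fin n → Fin n → Fin n → Fin n → ℝ,
      ∑ k, ∑ j, ∑ a, ∑ b, B k j a b * (M k j a b + R k j a b) =
        ∑ k, ∑ j, ∑ a, ∑ b, B k j a b * M k j a b + ∑ k, ∑ j, ∑ a, ∑ b, B k j a b * R k j a b := by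
    intro B M R
    simp only [mul_add, Finset.sum_add_distrib]
  have reorder : ∀ f : Fin n → Fin n → Fin n → Fin n → ℝ,
      ∑ g, ∑ e, ∑ c, ∑ d, f g e c d = ∑ c, ∑ d, ∑ e, ∑ g, f g e c d := by
    intro f
    calc _ = ∑ e, ∑ g, ∑ c, ∑ d, f g e c d := Finset.sum_comm
      _ = ∑ e, ∑ c, ∑ g, ∑ d, f g e c d := Finset.sum_congr rfl fun _ _ => Finset.sum_comm
      _ = ∑ e, ∑ c, ∑ d, ∑ g, f g e c d := Finset.sum_congr rfl fun _ _ =>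
          Finset.sum_congr rfl fun _ _ => Finset.sum_comm
      _ = ∑ c, ∑ e, ∑ d, ∑ g, f g e c d := Finset.sum_comm
      _ = _ := Finset.sum_congr rfl fun _ _ => Finset.sum_comm
  simp only [secOrd, key]
  rw [split, ← secRem]
  congr 1
  conv_rhs => rw [reorder]
  simp only [Finset.mul_sum]
  rw [sum_comm_four]
  refine Finset.sum_congr rfl fun c _ => ?_
  rw [sum_comm_four]
  refine Finset.sum_congr rfl fun d _ => ?_
  rw [sum_comm_four]
  refine Finset.sum_congr rfl fun e _ => ?_
  rw [sum_comm_four]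
  refine Finset.sum_congr rfl fun g _ => ?_
  rw [← hA, ← bcoef_contract]
  simp only [Finset.sum_mul]
  refine Finset.sum_congr rfl fun k _ => Finset.sum_congr rfl fun j _ =>
    Finset.sum_congr rfl fun a _ => Finset.sum_congr rfl fun b _ => ?_
  ring

theorem secOrd_eq_zero {H T : Eu n → Matrix (Fin n) (Fin n) ℝ} {y : Eu n}
    (h : T =ᶠ[𝓝 y] fun _ => 0) : secOrd H T y = 0 := by
  refine Finset.sum_eq_zero fun k _ => Finset.sum_eq_zero fun j _ => Finset.sum_eq_zero fun a _ =>
    Finset.sum_eq_zero fun b _ => ?_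
  have h1 : (fun z => T z a b) =ᶠ[𝓝 y] fun _ => (0 : ℝ) := h.mono fun z hz => by simp only [hz]; rfl
  rw [pderiv_pderiv_congr h1]
  have h2 : pderiv j (fun _ : Eu n => (0 : ℝ)) = fun _ => 0 := funext fun z => pderiv_const 0 j z
  rw [h2, pderiv_const, mul_zero]

/-- Linearity in `T` with the metric held fixed is what allows the second-order corrections of
different charts to cancel. -/
theorem secOrd_sum {ι : Type*} (s : Finset ι) {H : Eu n → Matrix (Fin n) (Fin n) ℝ}
    {T : ι → Eu n → Matrix (Fin n) (Fin n) ℝ} {y : Eu n}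
    (hT : ∀ i ∈ s, ∀ a b, ContDiffAt ℝ ∞ (fun z => T i z a b) y) :
    ∑ i ∈ s, secOrd H (T i) y = secOrd H (fun z => ∑ i ∈ s, T i z) y := by
  have h1 : ∀ k j a b, pderiv k (pderiv j (fun z => (∑ i ∈ s, T i z) a b)) y =
      ∑ i ∈ s, pderiv k (pderiv j (fun z => T i z a b)) y := by
    intro k j a b
    simp only [Matrix.sum_apply]
    exact pderiv_pderiv_sum s (fun i hi => hT i hi a b) k j
  simp only [secOrd, h1, Finset.mul_sum]
  rw [Finset.sum_comm]
  refine Finset.sum_congr rfl fun k _ => ?_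
  rw [Finset.sum_comm]
  refine Finset.sum_congr rfl fun j _ => ?_
  rw [Finset.sum_comm]
  refine Finset.sum_congr rfl fun a _ => ?_
  exact Finset.sum_comm

theorem jac_eq_toMatrix (φ : Eu n → Eu n) (y : Eu n) (hφ : DifferentiableAt ℝ φ y) :
    jac φ y = LinearMap.toMatrix (EuclideanSpace.basisFun (Fin n) ℝ).toBasis
      (EuclideanSpace.basisFun (Fin n) ℝ).toBasis (fderiv ℝ φ y : Eu n →ₗ[ℝ] Eu n) := by
  ext c a
  have h2 := ((EuclideanSpace.proj (𝕜 := ℝ) c).hasFDerivAt (x := φ y)).comp y hφ.hasFDerivAt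
  have h3 : fderiv ℝ (fun z => φ z c) y = _ := h2.fderiv
  rw [LinearMap.toMatrix_apply]
  simp only [jac, Matrix.of_apply, pderiv]
  rw [h3]
  simp [stdVec]

theorem det_jac {φ : Eu n → Eu n} {y : Eu n} (hφ : DifferentiableAt ℝ φ y) :
    (jac φ y).det = (fderiv ℝ φ y).det := by
  rw [jac_eq_toMatrix φ y hφ, LinearMap.det_toMatrix]

/-- The lower-order terms in the transformation of `secOrd` tend to zero if the field tends to zero
together with its first derivatives. -/
theorem tendsLp_secRem {p q : ℝ≥0∞} (hq : 1 ≤ q) (hqp : q ≤ p) {K : Set (Eu n)} (hK : IsCompact K)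
    {φ : Eu n → Eu n} (hφ : ∀ y ∈ K, ContDiffAt ℝ ∞ φ y) (hinj : InjOn φ K)
    (hdet : ∀ y ∈ K, (jac φ y).det ≠ 0) {H' T : ℝ → Eu n → Matrix (Fin n) (Fin n) ℝ}
    {B : Fin n → Fin n → Fin n → Fin n → Eu n → ℝ}
    (hB : ∀ k j a b, TendsLp ∞ (volume.restrict K) (fun ε y => bcoef (H' ε y)⁻¹ k j a b) (B k j a b))
    (hT : ∀ c d, TendsLp p (volume.restrict (φ '' K)) (fun ε y => T ε y c d) (fun _ => 0))
    (hdT : ∀ e c d, TendsLp p (volume.restrict (φ '' K))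
      (fun ε => pderiv e (fun z => T ε z c d)) (fun _ => 0)) :
    TendsLp q (volume.restrict K) (fun ε => secRem φ (H' ε) (T ε)) (fun _ => 0) := by
  have hp : 1 ≤ p := hq.trans hqp
  have hfin : IsFiniteMeasure (volume.restrict K) := ⟨by simpa using hK.measure_lt_top⟩
  have hdet' : ∀ y ∈ K, (fderiv ℝ φ y).det ≠ 0 := fun y hy => by
    rw [← det_jac ((hφ y hy).differentiableAt (by simp))]
    exact hdet y hy
  have tc : ∀ {g : Eu n → ℝ}, (∀ y ∈ K, ContDiffAt ℝ ∞ g y) →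
      TendsLp ∞ (volume.restrict K) (fun _ => g) g := fun hg =>
    TendsLp.const (memLp_of_continuousOn hK (continuousOn_of_contDiffAt hg) ∞)
  have hT' := fun c d => tendsLp_comp_diffeo hK hφ hinj hdet' (hT c d)
  have hdT' := fun e c d => tendsLp_comp_diffeo hK hφ hinj hdet' (hdT e c d)
  have hΘ := fun c d a b y hy => contDiffAt_jacProd (hφ y hy) c d a b
  have hJ := fun c a y hy => contDiffAt_jac (hφ y hy) c a
  have h := TendsLp.sum hp Finset.univ fun k _ => TendsLp.sum hp Finset.univ fun j _ =>
    TendsLp.sum hp Finset.univ fun a _ => TendsLp.sum hp Finset.univ fun b _ =>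
    TendsLp.mul (p := ∞) (q := p) (r := p) hp hp (hB k j a b)
      (TendsLp.sum hp Finset.univ fun c _ => TendsLp.sum hp Finset.univ fun d _ =>
        (TendsLp.mul (p := ∞) (q := p) (r := p) hp hp (tc fun y hy =>
          contDiffAt_pderiv (contDiffAt_pderiv (hΘ c d a b y hy) j) k) (hT' c d)).add hp
          (TendsLp.sum hp Finset.univ fun e _ => TendsLp.mul (p := ∞) (q := p) (r := p) hp hp
            (tc fun y hy => (((contDiffAt_pderiv (hΘ c d a b y hy) j).mul (hJ e k y hy)).add
              ((contDiffAt_pderiv (hΘ c d a b y hy) k).mul (hJ e j y hy))).add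
                ((hΘ c d a b y hy).mul (contDiffAt_pderiv (hJ e j y hy) k))) (hdT' e c d)))
  refine (h.mono_exponent hqp hq).congr (Eventually.of_forall fun ε => ae_eq_rfl)
    (Eventually.of_forall fun y => ?_)
  simp

end SecondOrder


/-! ### Tensor fields in charts -/

section Charts

variable {n : ℕ} {M : Type*} [TopologicalSpace M]

/-- The domain of the transition map from the chart `e` to the chart `e'`. -/
def overlap (e e' : OpenPartialHomeomorph M (Eu n)) : Set (Eu n) := e.target ∩ e.symm ⁻¹' e'.source

/-- The transition map from the chart `e` to the chart `e'`. -/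
def transition (e e' : OpenPartialHomeomorph M (Eu n)) (y : Eu n) : Eu n := e' (e.symm y)

theorem isOpen_overlap (e e' : OpenPartialHomeomorph M (Eu n)) : IsOpen (overlap e e') :=
  e.symm.continuousOn.isOpen_inter_preimage e.open_target e'.open_source

theorem transition_mem {e e' : OpenPartialHomeomorph M (Eu n)} {y : Eu n} (hy : y ∈ overlap e e') :
    transition e e' y ∈ overlap e' e := by
  refine ⟨e'.map_source hy.2, ?_⟩
  change e'.symm (e' (e.symm y)) ∈ e.source
  rw [e'.left_inv hy.2]
  exact e.map_target hy.1

theorem symm_transition {e e' : OpenPartialHomeomorph M (Eu n)} {y : Eu n} (hy : y ∈ overlap e e') :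
    e'.symm (transition e e' y) = e.symm y := e'.left_inv hy.2

theorem transition_transition {e e' : OpenPartialHomeomorph M (Eu n)} {y : Eu n}
    (hy : y ∈ overlap e e') : transition e' e (transition e e' y) = y := by
  rw [transition, symm_transition hy, e.right_inv hy.1]

theorem injOn_transition (e e' : OpenPartialHomeomorph M (Eu n)) :
    InjOn (transition e e') (overlap e e') := fun y hy z hz h => by
  rw [← transition_transition hy, h, transition_transition hz]

theorem pushFun_transition {e e' : OpenPartialHomeomorph M (Eu n)} (f : M → ℝ) {y : Eu n}
    (hy : y ∈ overlap e e') : pushFun e' f (transition e e' y) = f (e.symm y) := by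
  rw [pushFun, indicator_of_mem (transition_mem hy).1, symm_transition hy]

variable [ChartedSpace (Eu n) M] {e e' : OpenPartialHomeomorph M (Eu n)}

theorem contDiffAt_transition (he : e ∈ IsManifold.maximalAtlas (𝓡 n) ∞ M)
    (he' : e' ∈ IsManifold.maximalAtlas (𝓡 n) ∞ M) {y : Eu n} (hy : y ∈ overlap e e') :
    ContDiffAt ℝ ∞ (transition e e') y := by
  have h : ContMDiffAt 𝓘(ℝ, Eu n) 𝓘(ℝ, Eu n) ∞ (e' ∘ e.symm) y :=
    (contMDiffAt_of_mem_maximalAtlas he' hy.2).comp y (contMDiffAt_symm_of_mem_maximalAtlas he hy.1)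
  exact h.contDiffAt

/-- The opposite transition map is a local inverse; differentiate the composition and take
determinants. -/
theorem det_jac_transition (he : e ∈ IsManifold.maximalAtlas (𝓡 n) ∞ M)
    (he' : e' ∈ IsManifold.maximalAtlas (𝓡 n) ∞ M) {y : Eu n} (hy : y ∈ overlap e e') :
    (jac (transition e e') y).det ≠ 0 := by
  have h1 : DifferentiableAt ℝ (transition e e') y :=
    (contDiffAt_transition he he' hy).differentiableAt (by simp)
  have h2 : DifferentiableAt ℝ (transition e' e) (transition e e' y) :=
    (contDiffAt_transition he' he (transition_mem hy)).differentiableAt (by simp)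
  have h3 : fderiv ℝ (fun z => transition e' e (transition e e' z)) y = _ :=
    (h2.hasFDerivAt.comp y h1.hasFDerivAt).fderiv
  have h4 : (fun z => transition e' e (transition e e' z)) =ᶠ[𝓝 y] id := by
    filter_upwards [(isOpen_overlap e e').mem_nhds hy] with z hz using transition_transition hz
  rw [h4.fderiv_eq, fderiv_id] at h3
  rw [det_jac h1]
  intro h0
  have h5 := congrArg ContinuousLinearMap.det h3
  rw [ContinuousLinearMap.det, ContinuousLinearMap.det, ContinuousLinearMap.toLinearMap_comp,
    LinearMap.det_comp] at h5
  have h6 : LinearMap.det (fderiv ℝ (transition e e') y : Eu n →ₗ[ℝ] Eu n) = 0 := h0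
  rw [h6, mul_zero] at h5
  simp at h5

/-- All tangent spaces are the same model space, so one pair of vectors can be inserted at two
expressions for the same base point. -/
theorem tensor_apply_congr (h : Tensor02 n M) {x x' : M} (hx : x = x') (v w : Eu n) :
    (h x : Eu n →L[ℝ] Eu n →L[ℝ] ℝ) v w = (h x' : Eu n →L[ℝ] Eu n →L[ℝ] ℝ) v w := by
  rw [hx]

theorem mfderiv_symm_transition (he : e ∈ IsManifold.maximalAtlas (𝓡 n) ∞ M)
    (he' : e' ∈ IsManifold.maximalAtlas (𝓡 n) ∞ M) {y : Eu n} (hy : y ∈ overlap e e') (v : Eu n) :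
    (mfderiv 𝓘(ℝ, Eu n) (𝓡 n) e.symm y v : Eu n) =
      mfderiv 𝓘(ℝ, Eu n) (𝓡 n) e'.symm (transition e e' y) (fderiv ℝ (transition e e') y v) := by
  have h1 : e.symm =ᶠ[𝓝 y] e'.symm ∘ transition e e' := by
    filter_upwards [(isOpen_overlap e e').mem_nhds hy] with z hz using (symm_transition hz).symm
  have d1 : MDifferentiableAt 𝓘(ℝ, Eu n) 𝓘(ℝ, Eu n) (transition e e') y :=
    ((contDiffAt_transition he he' hy).differentiableAt (by simp)).mdifferentiableAt
  have d2 : MDifferentiableAt 𝓘(ℝ, Eu n) (𝓡 n) e'.symm (transition e e' y) :=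
    (contMDiffAt_symm_of_mem_maximalAtlas he' (transition_mem hy).1).mdifferentiableAt (by simp)
  have h2 := h1.mfderiv_eq (I := 𝓘(ℝ, Eu n)) (I' := 𝓡 n)
  have h3 := mfderiv_comp y d2 d1
  rw [h3, mfderiv_eq_fderiv] at h2
  exact congrArg (fun L : Eu n →L[ℝ] Eu n => L v) h2

theorem chartRep_transition (he : e ∈ IsManifold.maximalAtlas (𝓡 n) ∞ M)
    (he' : e' ∈ IsManifold.maximalAtlas (𝓡 n) ∞ M) (h : Tensor02 n M) {y : Eu n}
    (hy : y ∈ overlap e e') (v w : Eu n) :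
    chartRep e h y v w = chartRep e' h (transition e e' y) (fderiv ℝ (transition e e') y v)
      (fderiv ℝ (transition e e') y w) := by
  calc chartRep e h y v w
      = (h (e.symm y) : Eu n →L[ℝ] Eu n →L[ℝ] ℝ) _ _ :=
        congrArg₂ (fun u u' : Eu n => (h (e.symm y) : Eu n →L[ℝ] Eu n →L[ℝ] ℝ) u u')
          (mfderiv_symm_transition he he' hy v) (mfderiv_symm_transition he he' hy w)
    _ = _ := tensor_apply_congr h (symm_transition hy).symm _ _

theorem bilin_eq_sum (B : Eu n →L[ℝ] Eu n →L[ℝ] ℝ) (v w : Eu n) :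
    B v w = ∑ a, ∑ b, v a * w b * B (stdVec a) (stdVec b) := by
  conv_lhs => rw [← sum_smul_stdVec v, ← sum_smul_stdVec w]
  simp only [map_sum, map_smul, sum_apply, smul_apply, smul_eq_mul, Finset.mul_sum]
  rw [Finset.sum_comm]
  exact Finset.sum_congr rfl fun a _ => Finset.sum_congr rfl fun b _ => by ring

theorem jac_eq {φ : Eu n → Eu n} {y : Eu n} (hφ : DifferentiableAt ℝ φ y) (c a : Fin n) :
    jac φ y c a = fderiv ℝ φ y (stdVec a) c := by
  have h2 := ((EuclideanSpace.proj (𝕜 := ℝ) c).hasFDerivAt (x := φ y)).comp y hφ.hasFDerivAt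
  have h3 : fderiv ℝ (fun z => φ z c) y = _ := h2.fderiv
  simp only [jac, Matrix.of_apply, pderiv]
  rw [h3]
  rfl

theorem comps_transition (he : e ∈ IsManifold.maximalAtlas (𝓡 n) ∞ M)
    (he' : e' ∈ IsManifold.maximalAtlas (𝓡 n) ∞ M) (h : Tensor02 n M) {y : Eu n}
    (hy : y ∈ overlap e e') :
    comps e h y = (jac (transition e e') y).transpose * comps e' h (transition e e' y) *
      jac (transition e e') y := by
  have hφ : DifferentiableAt ℝ (transition e e') y :=
    (contDiffAt_transition he he' hy).differentiableAt (by simp)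
  ext a b
  change chartRep e h y (stdVec a) (stdVec b) = _
  rw [chartRep_transition he he' h hy, bilin_eq_sum, Finset.sum_comm]
  simp only [Matrix.mul_apply, Finset.sum_mul, Matrix.transpose_apply, jac_eq hφ]
  refine Finset.sum_congr rfl fun c _ => Finset.sum_congr rfl fun d _ => ?_
  change _ = _ * chartRep e' h (transition e e' y) (stdVec d) (stdVec c) * _
  ring

theorem comps_isSymm {h : Tensor02 n M} (hs : ∀ x v w, h x v w = h x w v)
    (e : OpenPartialHomeomorph M (Eu n)) (y : Eu n) : (comps e h y).IsSymm := by
  ext a b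
  exact hs _ _ _

theorem mfderiv_mfderiv_symm (he : e ∈ IsManifold.maximalAtlas (𝓡 n) ∞ M) {y : Eu n}
    (hy : y ∈ e.target) (v : Eu n) :
    (mfderiv (𝓡 n) 𝓘(ℝ, Eu n) e (e.symm y) (mfderiv 𝓘(ℝ, Eu n) (𝓡 n) e.symm y v) : Eu n) = v := by
  have d1 : MDifferentiableAt 𝓘(ℝ, Eu n) (𝓡 n) e.symm y :=
    (contMDiffAt_symm_of_mem_maximalAtlas he hy).mdifferentiableAt (by simp)
  have d2 : MDifferentiableAt (𝓡 n) 𝓘(ℝ, Eu n) e (e.symm y) :=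
    (contMDiffAt_of_mem_maximalAtlas he (e.map_target hy)).mdifferentiableAt (by simp)
  have h1 : e ∘ e.symm =ᶠ[𝓝 y] id := by
    filter_upwards [e.open_target.mem_nhds hy] with z hz using e.right_inv hz
  have h2 := h1.mfderiv_eq (I := 𝓘(ℝ, Eu n)) (I' := 𝓘(ℝ, Eu n))
  rw [mfderiv_comp y d2 d1, mfderiv_id] at h2
  exact congrArg (fun L : Eu n →L[ℝ] Eu n => L v) h2

theorem mfderiv_symm_ne_zero (he : e ∈ IsManifold.maximalAtlas (𝓡 n) ∞ M) {y : Eu n}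
    (hy : y ∈ e.target) {v : Eu n} (hv : v ≠ 0) :
    mfderiv 𝓘(ℝ, Eu n) (𝓡 n) e.symm y v ≠ 0 := by
  intro h0
  have h := mfderiv_mfderiv_symm he hy v
  rw [h0, map_zero] at h
  exact hv h.symm

theorem mfderiv_symm_mfderiv (he : e ∈ IsManifold.maximalAtlas (𝓡 n) ∞ M) {x : M}
    (hx : x ∈ e.source) (v : TangentSpace (𝓡 n) x) :
    (mfderiv 𝓘(ℝ, Eu n) (𝓡 n) e.symm (e x) (mfderiv (𝓡 n) 𝓘(ℝ, Eu n) e x v) : Eu n) = v := by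
  have d1 : MDifferentiableAt 𝓘(ℝ, Eu n) (𝓡 n) e.symm (e x) :=
    (contMDiffAt_symm_of_mem_maximalAtlas he (e.map_source hx)).mdifferentiableAt (by simp)
  have d2 : MDifferentiableAt (𝓡 n) 𝓘(ℝ, Eu n) e x :=
    (contMDiffAt_of_mem_maximalAtlas he hx).mdifferentiableAt (by simp)
  have h1 : e.symm ∘ e =ᶠ[𝓝 x] id := by
    filter_upwards [e.open_source.mem_nhds hx] with z hz using e.left_inv hz
  have h2 := h1.mfderiv_eq (I := 𝓡 n) (I' := 𝓡 n)
  rw [mfderiv_comp x d1 d2, mfderiv_id] at h2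
  exact congrArg (fun L : Eu n →L[ℝ] Eu n => L v) h2

/-- The coordinate fields are continuous sections because the tangent map of `e.symm` is continuous;
evaluating the continuous metric section on two of them gives a continuous function. -/
theorem continuousOn_comps [IsManifold (𝓡 n) ∞ M] (he : e ∈ IsManifold.maximalAtlas (𝓡 n) ∞ M)
    (g : ContinuousRiemannianMetric (Eu n) (fun x : M => TangentSpace (𝓡 n) x)) (a b : Fin n) :
    ContinuousOn (fun y => comps e g.inner y a b) e.target := by
  have hsec : ∀ v : Eu n, ContinuousOn (fun y : Eu n => TotalSpace.mk' (Eu n)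
      (E := fun x : M => TangentSpace (𝓡 n) x) (e.symm y)
      (mfderiv 𝓘(ℝ, Eu n) (𝓡 n) e.symm y v)) e.target := by
    intro v
    have h1 := (contMDiffOn_symm_of_mem_maximalAtlas he).continuousOn_tangentMapWithin (by simp)
      e.open_target.uniqueMDiffOn
    have h2 : Continuous (fun y : Eu n => (⟨y, v⟩ : TangentBundle 𝓘(ℝ, Eu n) (Eu n))) :=
      (tangentBundleModelSpaceHomeomorph 𝓘(ℝ, Eu n)).symm.continuous.comp
        (continuous_id.prodMk continuous_const)
    refine (h1.comp h2.continuousOn fun y hy => hy).congr fun y hy => ?_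
    simp only [Function.comp, tangentMapWithin, mfderivWithin_of_isOpen e.open_target hy]
  have hg : ContinuousOn (fun y : Eu n => TotalSpace.mk' (Eu n →L[ℝ] Eu n →L[ℝ] ℝ)
      (E := fun x : M => TangentSpace (𝓡 n) x →L[ℝ] TangentSpace (𝓡 n) x →L[ℝ] ℝ) (e.symm y)
      (g.inner (e.symm y))) e.target := g.continuous.comp_continuousOn e.symm.continuousOn
  have h3 := ContinuousOn.clm_bundle_apply₂ (F₃ := ℝ) (E₃ := Bundle.Trivial M ℝ) hg
    (hsec (stdVec a)) (hsec (stdVec b))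
  intro y hy
  have h4 := (FiberBundle.continuousWithinAt_totalSpace ℝ _).mp (h3 y hy)
  exact h4.2

end Charts


/-! ### The regularised metric in a chart -/

section Mollified

variable {n : ℕ} {p : ℝ≥0∞}

/-- After the cut-off the function is a compactly supported `W^{1,p}` function on the whole space,
so its mollifications converge globally; hence one `w` serves every `K`. -/
theorem SobConv.exists_of_weakD_mollify (ρ : Mollifier n) (hp : 1 ≤ p) (hp' : p ≠ ⊤)
    {Ω : Opens (Eu n)} {f η : Eu n → ℝ} (hf : ContinuousOn f Ω) (hf1 : MemW1Loc Ω p f)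
    (hη : ContDiff ℝ ∞ η) (hηc : HasCompactSupport η) (hηs : tsupport η ⊆ Ω) :
    ∃ w, ∀ K : Set (Eu n), SobConv p K (fun ε => cv (ρ.scaled ε) (fun z => η z * f z))
      (fun z => η z * f z) w := by
  obtain ⟨h0, h1⟩ := hf1
  choose w hw hfw using h1
  set W : Fin n → Eu n → ℝ := fun a z => η z * w a z + pderiv a η z * f z with hW
  have huc := continuous_mul_cutoff hf hη.continuous hηs
  have hus : HasCompactSupport (fun z => η z * f z) := hηc.mul_right
  have hu : MemLp (fun z => η z * f z) p volume := memLp_mul_cutoff h0 hη.continuous hηc hηs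
  have hWLp : ∀ a, MemLp (W a) p volume := fun a =>
    (memLp_mul_cutoff (hw a) hη.continuous hηc hηs).add
      (memLp_mul_cutoff h0 (contDiff_pderiv hη a).continuous (hasCompactSupport_pderiv hηc a)
        ((tsupport_pderiv_subset a η).trans hηs))
  have hWD : ∀ a, WeakD univ a (fun z => η z * f z) (W a) := fun a =>
    (isWeakPartial_iff.mp (hfw a)).2.2.cutoff (isWeakPartial_iff.mp (hfw a)).1
      (isWeakPartial_iff.mp (hfw a)).2.1 hη hηc hηs
  have hul := locallyIntegrable_of_memLp hp hu
  refine ⟨W, fun K => SobConv.mono (K := univ) ⟨?_, ?_, ?_, fun a => ?_⟩ (subset_univ K)⟩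
  · filter_upwards [eventually_pos] with ε hε y _
    exact (contDiff_cv (ρ.contDiff_scaled ε) (ρ.hasCompactSupport_scaled hε) hul).contDiffAt
  · exact (ρ.tendstoUniformly_cv huc hus).tendstoUniformlyOn
  · rw [Measure.restrict_univ]
    exact ρ.rateLp_cv hp hp' hu hWLp hWD
  · rw [Measure.restrict_univ]
    refine (ρ.tendsLp_cv hp hp' (hWLp a)).congr ?_ ae_eq_rfl
    filter_upwards [eventually_pos] with ε hε
    rw [pderiv_cv (ρ.contDiff_scaled ε) (ρ.hasCompactSupport_scaled hε) hul,
      cv_pderiv_of_weakD (hWD a) (ρ.contDiff_scaled ε) (ρ.hasCompactSupport_scaled hε)]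

theorem integral_sum_smul_const {F ι κ : Type*} [NormedAddCommGroup F] [NormedSpace ℝ F]
    [CompleteSpace F] [Fintype ι] [Fintype κ] {f : ι → κ → Eu n → ℝ}
    (hf : ∀ a b, Integrable (f a b) volume) (E : ι → κ → F) :
    ∫ z, ∑ a, ∑ b, f a b z • E a b = ∑ a, ∑ b, (∫ z, f a b z) • E a b := by
  rw [integral_finsetSum _ fun a _ => integrable_finsetSum _ fun b _ => (hf a b).smul_const _]
  refine Finset.sum_congr rfl fun a _ => ?_
  rw [integral_finsetSum _ fun b _ => (hf a b).smul_const _]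
  exact Finset.sum_congr rfl fun b _ => integral_smul_const _ _

end Mollified

/-! ### The summands of the regularised tensor field, read in charts. -/

section Pieces

variable {n : ℕ} {M : Type*} [TopologicalSpace M] [ChartedSpace (Eu n) M]

theorem contDiffAt_comp_symm {e : OpenPartialHomeomorph M (Eu n)}
    (he : e ∈ IsManifold.maximalAtlas (𝓡 n) ∞ M) {f : M → ℝ} (hf : ContMDiff (𝓡 n) 𝓘(ℝ, ℝ) ∞ f)
    {y : Eu n} (hy : y ∈ e.target) : ContDiffAt ℝ ∞ (fun z => f (e.symm z)) y := by
  have h1 : ContMDiffAt 𝓘(ℝ, Eu n) 𝓘(ℝ, ℝ) ∞ (f ∘ e.symm) y :=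
    hf.contMDiffAt.comp y (contMDiffAt_symm_of_mem_maximalAtlas he hy)
  exact h1.contDiffAt

namespace RegData

variable (D : RegData n M)

/-- The function `ηᵢ` read in the chart `ψᵢ`. -/
def cut (i : ℕ) : Eu n → ℝ := pushFun (D.ψ i) (D.η i)

theorem contDiff_cut [IsManifold (𝓡 n) ∞ M] (i : ℕ) : ContDiff ℝ ∞ (D.cut i) :=
  contDiff_pushFun (D.ψ_smooth i) (D.η i).contMDiff (D.η_compact i) (D.η_subordinate i)

theorem hasCompactSupport_cut (i : ℕ) : HasCompactSupport (D.cut i) :=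
  hasCompactSupport_pushFun (D.η_compact i) (D.η_subordinate i)

theorem tsupport_cut_subset (i : ℕ) : tsupport (D.cut i) ⊆ (chartTarget (D.ψ i) : Set (Eu n)) :=
  (tsupport_pushFun (D.η_compact i) (D.η_subordinate i)).trans
    (image_tsupport_subset (D.η_subordinate i))

/-- The matrix of the components of the mollified tensor field `(ψᵢ)_*(ηᵢ h) * ρ_ε`. -/
def convComp (ρ : Mollifier n) (h : Tensor02 n M) (ε : ℝ) (i : ℕ) (y : Eu n) :
    Matrix (Fin n) (Fin n) ℝ :=
  Matrix.of fun a b => cv (ρ.scaled ε) (fun z => D.cut i z * comps (D.ψ i) h z a b) y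

/-- Expanding the integrand in the basis `E a b` of bilinear forms reduces the integral to scalar
convolutions of components. -/
theorem convTensor_apply [IsManifold (𝓡 n) ∞ M] (ρ : Mollifier n) {h : Tensor02 n M} {i : ℕ}
    (hc : ∀ a b, ContinuousOn (fun y => comps (D.ψ i) h y a b) (D.ψ i).target) {ε : ℝ} (hε : 0 < ε)
    (y v w : Eu n) :
    D.convTensor ρ h ε i y v w = ∑ a, ∑ b, v a * w b * D.convComp ρ h ε i y a b := by
  have hl : ∀ a b, LocallyIntegrable (fun z => D.cut i z * comps (D.ψ i) h z a b) volume := fun a b =>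
    (continuous_mul_cutoff (Ω := chartTarget (D.ψ i)) (hc a b) (D.contDiff_cut i).continuous
      (D.tsupport_cut_subset i)).locallyIntegrable
  have hi : ∀ a b, Integrable (fun z => D.cut i z * comps (D.ψ i) h z a b * ρ.scaled ε (y - z)) volume :=
    fun a b => integrable_cv (ρ.contDiff_scaled ε).continuous (ρ.hasCompactSupport_scaled hε) (hl a b) y
  set E : Fin n → Fin n → (Eu n →L[ℝ] Eu n →L[ℝ] ℝ) := fun a b =>
    (EuclideanSpace.proj (𝕜 := ℝ) a : Eu n →L[ℝ] ℝ).smulRight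
      (EuclideanSpace.proj (𝕜 := ℝ) b : Eu n →L[ℝ] ℝ) with hE
  have hEa : ∀ a b (v w : Eu n), E a b v w = v a * w b := fun a b v w => rfl
  have he : ∀ z, (pushFun (D.ψ i) (D.η i) z * ρ.scaled ε (y - z)) • chartRep (D.ψ i) h z =
      ∑ a, ∑ b, (D.cut i z * comps (D.ψ i) h z a b * ρ.scaled ε (y - z)) • E a b := by
    intro z
    ext v w
    simp only [smul_apply, sum_apply, smul_eq_mul, hEa]
    rw [bilin_eq_sum, Finset.mul_sum]
    refine Finset.sum_congr rfl fun a _ => ?_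
    rw [Finset.mul_sum]
    refine Finset.sum_congr rfl fun b _ => ?_
    change D.cut i z * ρ.scaled ε (y - z) * (v a * w b * comps (D.ψ i) h z a b) = _
    ring
  have hint : D.convTensor ρ h ε i y = ∑ a, ∑ b, D.convComp ρ h ε i y a b • E a b := by
    simp only [convTensor, he]
    exact integral_sum_smul_const hi E
  rw [hint]
  simp only [smul_apply, sum_apply, smul_eq_mul, hEa]
  exact Finset.sum_congr rfl fun a _ => Finset.sum_congr rfl fun b _ => mul_comm _ _

/-- The `i`-th summand of the regularised tensor field. -/
def piece (ρ : Mollifier n) (h : Tensor02 n M) (ε : ℝ) (i : ℕ) : Tensor02 n M := fun x =>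
  D.χ i x • pullBilin (D.convTensor ρ h ε i (D.ψ i x)) (mfderiv (𝓡 n) 𝓘(ℝ, Eu n) (D.ψ i) x)

theorem regTensor_eq (ρ : Mollifier n) (h : Tensor02 n M) (ε : ℝ) (x : M) :
    D.regTensor ρ h ε x = ∑ᶠ i, D.piece ρ h ε i x := rfl

theorem χ_eq_zero {i : ℕ} {x : M} (hx : x ∉ (D.ψ i).source) : D.χ i x = 0 :=
  image_eq_zero_of_notMem_tsupport fun h => hx (D.χ_supp i h)

theorem η_eq_zero {i : ℕ} {x : M} (hx : x ∉ (D.ψ i).source) : D.η i x = 0 :=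
  image_eq_zero_of_notMem_tsupport fun h => hx (D.η_subordinate i h)

theorem χ_mul_η (i : ℕ) (x : M) : D.χ i x * D.η i x = D.η i x := by
  by_cases hx : x ∈ tsupport (D.η i)
  · rw [(eventually_nhdsSet_iff_forall.mp (D.χ_eq_one i) x hx).self_of_nhds, one_mul]
  · rw [image_eq_zero_of_notMem_tsupport hx, mul_zero]

theorem piece_of_χ_eq_zero (ρ : Mollifier n) (h : Tensor02 n M) (ε : ℝ) {i : ℕ} {x : M}
    (hx : D.χ i x = 0) : D.piece ρ h ε i x = 0 := by
  unfold piece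
  rw [hx]
  exact ContinuousLinearMap.ext fun v => ContinuousLinearMap.ext fun w => zero_mul _

theorem comps_piece_of_χ_eq_zero (ρ : Mollifier n) (h : Tensor02 n M) (ε : ℝ) {i : ℕ}
    {e : OpenPartialHomeomorph M (Eu n)} {y : Eu n} (hy : D.χ i (e.symm y) = 0) :
    comps e (D.piece ρ h ε i) y = 0 := by
  ext a b
  exact congrArg (fun L : Eu n →L[ℝ] Eu n →L[ℝ] ℝ =>
    L (mfderiv 𝓘(ℝ, Eu n) (𝓡 n) e.symm y (stdVec a)) (mfderiv 𝓘(ℝ, Eu n) (𝓡 n) e.symm y (stdVec b)))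
    (D.piece_of_χ_eq_zero ρ h ε hy)

theorem comps_piece_self [IsManifold (𝓡 n) ∞ M] (ρ : Mollifier n) {h : Tensor02 n M} {i : ℕ}
    (hc : ∀ a b, ContinuousOn (fun y => comps (D.ψ i) h y a b) (D.ψ i).target) {ε : ℝ} (hε : 0 < ε)
    {y : Eu n} (hy : y ∈ (D.ψ i).target) :
    comps (D.ψ i) (D.piece ρ h ε i) y = D.χ i ((D.ψ i).symm y) • D.convComp ρ h ε i y := by
  ext a b
  have h1 : comps (D.ψ i) (D.piece ρ h ε i) y a b = D.χ i ((D.ψ i).symm y) *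
      D.convTensor ρ h ε i (D.ψ i ((D.ψ i).symm y)) (stdVec a) (stdVec b) :=
    congrArg₂ (fun u u' : Eu n => D.χ i ((D.ψ i).symm y) *
      D.convTensor ρ h ε i (D.ψ i ((D.ψ i).symm y)) u u')
      (mfderiv_mfderiv_symm (D.ψ_smooth i) hy _) (mfderiv_mfderiv_symm (D.ψ_smooth i) hy _)
  rw [h1, (D.ψ i).right_inv hy, D.convTensor_apply ρ hc hε]
  simp [stdVec]

theorem comps_piece [IsManifold (𝓡 n) ∞ M] (ρ : Mollifier n) {h : Tensor02 n M} {i : ℕ}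
    (hc : ∀ a b, ContinuousOn (fun y => comps (D.ψ i) h y a b) (D.ψ i).target) {ε : ℝ} (hε : 0 < ε)
    {e : OpenPartialHomeomorph M (Eu n)} (he : e ∈ IsManifold.maximalAtlas (𝓡 n) ∞ M)
    {y : Eu n} (hy : y ∈ overlap e (D.ψ i)) :
    comps e (D.piece ρ h ε i) y = D.χ i (e.symm y) • ((jac (transition e (D.ψ i)) y).transpose *
      D.convComp ρ h ε i (transition e (D.ψ i) y) * jac (transition e (D.ψ i)) y) := by
  rw [comps_transition he (D.ψ_smooth i) _ hy, D.comps_piece_self ρ hc hε (transition_mem hy).1,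
    symm_transition hy, Matrix.mul_smul, Matrix.smul_mul]

/-- Near a compact subset of a chart, only finitely many charts of the cover matter. -/
theorem exists_finset {e : OpenPartialHomeomorph M (Eu n)} {K : Set (Eu n)} (hK : IsCompact K)
    (hKe : K ⊆ e.target) : ∃ (I : Finset ℕ) (V : Set (Eu n)), IsOpen V ∧ K ⊆ V ∧ V ⊆ e.target ∧
      ∀ y ∈ V, ∀ i ∉ I, e.symm y ∉ (D.ψ i).source := by
  obtain ⟨K', hK', hKK', hK'e⟩ := exists_compact_between hK e.open_target hKe
  have h1 : IsCompact (e.symm '' K') := hK'.image_of_continuousOn (e.symm.continuousOn.mono hK'e)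
  have h2 := D.ψ_locallyFinite.finite_nonempty_inter_compact h1
  refine ⟨h2.toFinset, interior K', isOpen_interior, hKK', interior_subset.trans hK'e,
    fun y hy i hi hs => hi ?_⟩
  rw [Set.Finite.mem_toFinset]
  exact ⟨e.symm y, hs, y, interior_subset hy, rfl⟩

theorem comps_regTensor (ρ : Mollifier n) (h : Tensor02 n M) (ε : ℝ)
    {e : OpenPartialHomeomorph M (Eu n)} {I : Finset ℕ} {y : Eu n}
    (hI : ∀ i ∉ I, e.symm y ∉ (D.ψ i).source) :
    comps e (D.regTensor ρ h ε) y = ∑ i ∈ I, comps e (D.piece ρ h ε i) y := by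
  have h1 : D.regTensor ρ h ε (e.symm y) = ∑ i ∈ I, D.piece ρ h ε i (e.symm y) := by
    rw [regTensor_eq]
    refine finsum_eq_sum_of_support_subset _ fun i hi => ?_
    by_contra hiI
    exact hi (D.piece_of_χ_eq_zero ρ h ε (D.χ_eq_zero (hI i hiI)))
  ext a b
  rw [Matrix.sum_apply]
  change (D.regTensor ρ h ε (e.symm y) : Eu n →L[ℝ] Eu n →L[ℝ] ℝ) _ _ = _
  have h2 := congrArg (fun L : Eu n →L[ℝ] Eu n →L[ℝ] ℝ =>
    L (mfderiv 𝓘(ℝ, Eu n) (𝓡 n) e.symm y (stdVec a)) (mfderiv 𝓘(ℝ, Eu n) (𝓡 n) e.symm y (stdVec b))) h1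
  refine h2.trans ?_
  change (∑ i ∈ I, (D.piece ρ h ε i (e.symm y) : Eu n →L[ℝ] Eu n →L[ℝ] ℝ)) _ _ = _
  rw [sum_apply, sum_apply]
  rfl

theorem sum_η {I : Finset ℕ} {x : M} (hI : ∀ i ∉ I, x ∉ (D.ψ i).source) : ∑ i ∈ I, D.η i x = 1 := by
  rw [← D.η.sum_eq_one (mem_univ x)]
  refine (finsum_eq_sum_of_support_subset _ fun i hi => ?_).symm
  by_contra hiI
  exact hi (D.η_eq_zero (hI i hiI))

end RegData

end Pieces


/-! ### Smoothness and Sobolev convergence of the regularised tensor field. -/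

section RegConv

variable {n : ℕ} {M : Type*} [TopologicalSpace M] [ChartedSpace (Eu n) M] [IsManifold (𝓡 n) ∞ M]
  {p : ℝ≥0∞}

/-- The components of `h` in every smooth chart are continuous. -/
def TensorContinuous (h : Tensor02 n M) : Prop :=
  ∀ e ∈ IsManifold.maximalAtlas (𝓡 n) ∞ M, ∀ a b : Fin n,
    ContinuousOn (fun y => comps e h y a b) e.target

namespace RegData

variable (D : RegData n M)

theorem sobConv_convComp (ρ : Mollifier n) (hp : 1 ≤ p) (hp' : p ≠ ⊤) {h : Tensor02 n M}
    (hc : TensorContinuous h) (hh : TensorW1Loc p h) (i : ℕ) (a b : Fin n) :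
    ∃ w, ∀ K : Set (Eu n), SobConv p K (fun ε y => D.convComp ρ h ε i y a b)
      (fun y => D.cut i y * comps (D.ψ i) h y a b) w :=
  SobConv.exists_of_weakD_mollify ρ hp hp' (Ω := chartTarget (D.ψ i)) (hc _ (D.ψ_smooth i) a b)
    (hh _ (D.ψ_smooth i) a b) (D.contDiff_cut i) (D.hasCompactSupport_cut i) (D.tsupport_cut_subset i)

theorem comps_piece_apply (ρ : Mollifier n) {h : Tensor02 n M} (hc : TensorContinuous h) {i : ℕ}
    {ε : ℝ} (hε : 0 < ε) {e : OpenPartialHomeomorph M (Eu n)}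
    (he : e ∈ IsManifold.maximalAtlas (𝓡 n) ∞ M) {y : Eu n} (hy : y ∈ overlap e (D.ψ i))
    (a b : Fin n) :
    comps e (D.piece ρ h ε i) y a b = ∑ c, ∑ d, D.χ i (e.symm y) *
      jacProd (transition e (D.ψ i)) c d a b y * D.convComp ρ h ε i (transition e (D.ψ i) y) c d := by
  rw [D.comps_piece ρ (hc _ (D.ψ_smooth i)) hε he hy, Matrix.smul_apply, Finset.sum_comm]
  simp only [Matrix.mul_apply, Finset.sum_mul, Matrix.transpose_apply, smul_eq_mul, Finset.mul_sum,
    jacProd]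
  refine Finset.sum_congr rfl fun d _ => Finset.sum_congr rfl fun c _ => ?_
  ring

/-- On the support of `χᵢ` the summand is a sum of smooth coefficients times convolved components
composed with the transition map, so the calculus of `SobConv` applies; in the limit `χᵢ ηᵢ = ηᵢ`.
-/
theorem sobConv_piece (ρ : Mollifier n) (hp : 1 ≤ p) (hp' : p ≠ ⊤) {h : Tensor02 n M}
    (hc : TensorContinuous h) (hh : TensorW1Loc p h) (i : ℕ) {e : OpenPartialHomeomorph M (Eu n)}
    (he : e ∈ IsManifold.maximalAtlas (𝓡 n) ∞ M) (a b : Fin n) {K : Set (Eu n)} (hK : IsCompact K)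
    (hKe : K ⊆ e.target) :
    ∃ v, SobConv p K (fun ε y => comps e (D.piece ρ h ε i) y a b)
      (fun y => D.η i (e.symm y) * comps e h y a b) v := by
  obtain ⟨K', hK', hKK', hK'e⟩ := exists_compact_between hK e.open_target hKe
  set φ := transition e (D.ψ i) with hφdef
  set C := K' ∩ e.symm ⁻¹' tsupport (D.χ i) with hCdef
  have hC : IsCompact C := by
    have h1 : IsClosed C := (e.symm.continuousOn.mono hK'e).preimage_isClosed_of_isClosed hK'.isClosed
      (isClosed_tsupport _)
    exact hK'.of_isClosed_subset h1 inter_subset_left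
  have hCo : C ⊆ overlap e (D.ψ i) := fun y hy => ⟨hK'e hy.1, D.χ_supp i hy.2⟩
  have hKC : IsCompact (K ∩ C) := hK.inter hC
  have hKCo : K ∩ C ⊆ overlap e (D.ψ i) := inter_subset_right.trans hCo
  choose w hw using D.sobConv_convComp ρ hp hp' hc hh i
  have hφs : ∀ y ∈ K ∩ C, ContDiffAt ℝ ∞ φ y := fun y hy =>
    contDiffAt_transition he (D.ψ_smooth i) (hKCo hy)
  have hN := fun c d => (hw c d (φ '' (K ∩ C))).comp hp hKC hφs ((injOn_transition e _).mono hKCo)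
    (fun y hy => by
      rw [← det_jac ((hφs y hy).differentiableAt (by simp))]
      exact det_jac_transition he (D.ψ_smooth i) (hKCo hy))
  have hcoef : ∀ c d, SobConv p (K ∩ C) (fun _ y => D.χ i (e.symm y) * jacProd φ c d a b y)
      (fun y => D.χ i (e.symm y) * jacProd φ c d a b y) _ := fun c d =>
    SobConv.const hKC fun y hy => (contDiffAt_comp_symm he (D.χ_smooth i) (hKCo hy).1).mul
      (contDiffAt_jacProd (hφs y hy) c d a b)
  have h1 := SobConv.sum hp hKC Finset.univ fun c _ => SobConv.sum hp hKC Finset.univ fun d _ =>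
    (hcoef c d).mul hp hKC (hN c d)
  -- Extension by zero asks for vanishing at all points off `C`, but components carry no information
  -- outside the target of `e`. The indicator of `interior K'` enforces it and changes nothing near
  -- `K`.
  set F : ℝ → Eu n → ℝ := fun ε => (interior K').indicator fun y => comps e (D.piece ρ h ε i) y a b
    with hF
  set f : Eu n → ℝ := (interior K').indicator fun y => D.η i (e.symm y) * comps e h y a b with hf
  have h2 : ∃ v, SobConv p (K ∩ C) F f v := by
    refine ⟨_, (h1.congr_left hKC ?_).congr_right hKC ?_⟩
    · filter_upwards [eventually_pos] with ε hε y hy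
      filter_upwards [(isOpen_overlap e (D.ψ i)).mem_nhds (hKCo hy),
        isOpen_interior.mem_nhds (hKK' hy.1)] with z hz hz'
      simp only [hF, indicator_of_mem hz']
      rw [D.comps_piece_apply ρ hc hε he hz]
    · intro y hy
      have hyo := hKCo hy
      simp only [hf, indicator_of_mem (hKK' hy.1)]
      have h3 : D.cut i (φ y) = D.η i (e.symm y) := pushFun_transition _ hyo
      rw [comps_transition he (D.ψ_smooth i) h hyo, ← hφdef, h3, Finset.sum_comm]
      simp only [Matrix.mul_apply, Finset.sum_mul, Matrix.transpose_apply, Finset.mul_sum,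
        jacProd]
      refine Finset.sum_congr rfl fun d _ => Finset.sum_congr rfl fun c _ => ?_
      linear_combination (jac φ y c a * jac φ y d b * comps (D.ψ i) h (φ y) c d) *
        D.χ_mul_η i (e.symm y)
  obtain ⟨v, hv⟩ := h2
  have hzero : ∀ y ∉ C, y ∈ interior K' → D.χ i (e.symm y) = 0 := fun y hy hy' =>
    image_eq_zero_of_notMem_tsupport fun h => hy ⟨interior_subset hy', h⟩
  have h5 : SobConv p K F f _ := SobConv.extend hC.isClosed hv
    (Eventually.of_forall fun ε y hy => by
      by_cases hy' : y ∈ interior K'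
      · simp only [hF, indicator_of_mem hy']
        rw [D.comps_piece_of_χ_eq_zero ρ h ε (hzero y hy hy')]
        rfl
      · simp only [hF, indicator_of_notMem hy'])
    (fun y hy => by
      by_cases hy' : y ∈ interior K'
      · simp only [hf, indicator_of_mem hy']
        rw [← D.χ_mul_η, hzero y hy hy', zero_mul, zero_mul]
      · simp only [hf, indicator_of_notMem hy'])
  refine ⟨_, (h5.congr_left hK (Eventually.of_forall fun ε y hy => ?_)).congr_right hK fun y hy => ?_⟩
  · filter_upwards [isOpen_interior.mem_nhds (hKK' hy)] with z hz
    simp only [hF, indicator_of_mem hz]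
  · simp only [hf, indicator_of_mem (hKK' hy)]

/-- Finitely many summands matter near `K`, and their limits `ηᵢ h` add up to `h`. -/
theorem sobConv_regTensor (ρ : Mollifier n) (hp : 1 ≤ p) (hp' : p ≠ ⊤) {h : Tensor02 n M}
    (hc : TensorContinuous h) (hh : TensorW1Loc p h) {e : OpenPartialHomeomorph M (Eu n)}
    (he : e ∈ IsManifold.maximalAtlas (𝓡 n) ∞ M) (a b : Fin n) {K : Set (Eu n)} (hK : IsCompact K)
    (hKe : K ⊆ e.target) :
    ∃ v, SobConv p K (fun ε y => comps e (D.regTensor ρ h ε) y a b) (fun y => comps e h y a b) v := by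
  obtain ⟨I, V, hV, hKV, hVe, hI⟩ := D.exists_finset hK hKe
  choose v hv using fun i => D.sobConv_piece ρ hp hp' hc hh i he a b hK hKe
  refine ⟨_, ((SobConv.sum hp hK I fun i _ => hv i).congr_left hK
    (Eventually.of_forall fun ε y hy => ?_)).congr_right hK fun y hy => ?_⟩
  · filter_upwards [hV.mem_nhds (hKV hy)] with z hz
    rw [D.comps_regTensor ρ h ε (hI z hz), Matrix.sum_apply]
  · simp only [← Finset.sum_mul, D.sum_η (hI y (hKV hy)), one_mul]

/-- The derivative limits found so far may depend on `K`; the weak derivatives of `h`, which exist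
by hypothesis, replace them on all compact sets at once. -/
theorem sobConvOn_regTensor (ρ : Mollifier n) (hp : 1 ≤ p) (hp' : p ≠ ⊤) {h : Tensor02 n M}
    (hc : TensorContinuous h) (hh : TensorW1Loc p h) {e : OpenPartialHomeomorph M (Eu n)}
    (he : e ∈ IsManifold.maximalAtlas (𝓡 n) ∞ M) (a b : Fin n) :
    SobConvOn p (chartTarget e) (fun ε y => comps e (D.regTensor ρ h ε) y a b)
      (fun y => comps e h y a b) := by
  have hW := hh e he a b
  have hw : ∀ c, IsWeakPartial (chartTarget e) c (fun y => comps e h y a b)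
      (weakPartial (chartTarget e) c fun y => comps e h y a b) := fun c => by
    obtain ⟨w, -, hw⟩ := hW.2 c
    exact weakPartial_spec hw
  exact ⟨fun c => weakPartial (chartTarget e) c fun y => comps e h y a b, fun K hK hKe =>
    SobConv.of_weakD (chartTarget e).isOpen hp
      (fun K hK hKe => D.sobConv_regTensor ρ hp hp' hc hh he a b hK hKe)
      (fun c => (isWeakPartial_iff.mp (hw c)).2.1) (fun c => (isWeakPartial_iff.mp (hw c)).2.2) hK hKe⟩

/-- At points of the support of `χᵢ` the coordinate formula holds nearby and all its factors are
smooth; elsewhere the summand vanishes nearby. -/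
theorem contDiffAt_comps_piece (ρ : Mollifier n) {h : Tensor02 n M} (hc : TensorContinuous h)
    {ε : ℝ} (hε : 0 < ε) (i : ℕ) {e : OpenPartialHomeomorph M (Eu n)}
    (he : e ∈ IsManifold.maximalAtlas (𝓡 n) ∞ M) {y : Eu n} (hy : y ∈ e.target) (a b : Fin n) :
    ContDiffAt ℝ ∞ (fun z => comps e (D.piece ρ h ε i) z a b) y := by
  by_cases hyχ : e.symm y ∈ tsupport (D.χ i)
  · have hyo : y ∈ overlap e (D.ψ i) := ⟨hy, D.χ_supp i hyχ⟩
    have hφ := contDiffAt_transition he (D.ψ_smooth i) hyo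
    have h2 : ∀ c d, ContDiff ℝ ∞ (fun z => D.convComp ρ h ε i z c d) := fun c d =>
      contDiff_cv (ρ.contDiff_scaled ε) (ρ.hasCompactSupport_scaled hε)
        (continuous_mul_cutoff (Ω := chartTarget (D.ψ i)) (hc _ (D.ψ_smooth i) c d)
          (D.contDiff_cut i).continuous (D.tsupport_cut_subset i)).locallyIntegrable
    have h3 : ContDiffAt ℝ ∞ (fun z => ∑ c, ∑ d, D.χ i (e.symm z) *
        jacProd (transition e (D.ψ i)) c d a b z *
          D.convComp ρ h ε i (transition e (D.ψ i) z) c d) y :=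
      ContDiffAt.sum fun c _ => ContDiffAt.sum fun d _ =>
        ((contDiffAt_comp_symm he (D.χ_smooth i) hy).mul (contDiffAt_jacProd hφ c d a b)).mul
          ((h2 c d).contDiffAt.comp y hφ)
    refine h3.congr_of_eventuallyEq ?_
    filter_upwards [(isOpen_overlap e (D.ψ i)).mem_nhds hyo] with z hz
    exact D.comps_piece_apply ρ hc hε he hz a b
  · refine (contDiffAt_const (c := (0 : ℝ))).congr_of_eventuallyEq ?_
    have h2 : ∀ᶠ z in 𝓝 y, e.symm z ∉ tsupport (D.χ i) :=
      (e.symm.continuousAt hy).eventually ((isClosed_tsupport _).isOpen_compl.mem_nhds hyχ)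
    filter_upwards [h2] with z hz
    rw [D.comps_piece_of_χ_eq_zero ρ h ε (image_eq_zero_of_notMem_tsupport hz)]
    rfl

theorem contDiffAt_comps_regTensor (ρ : Mollifier n) {h : Tensor02 n M} (hc : TensorContinuous h)
    {ε : ℝ} (hε : 0 < ε) {e : OpenPartialHomeomorph M (Eu n)}
    (he : e ∈ IsManifold.maximalAtlas (𝓡 n) ∞ M) {y : Eu n} (hy : y ∈ e.target) (a b : Fin n) :
    ContDiffAt ℝ ∞ (fun z => comps e (D.regTensor ρ h ε) z a b) y := by
  obtain ⟨I, V, hV, hyV, hVe, hI⟩ := D.exists_finset (isCompact_singleton (x := y))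
    (singleton_subset_iff.mpr hy)
  have h2 : ContDiffAt ℝ ∞ (fun z => ∑ i ∈ I, comps e (D.piece ρ h ε i) z a b) y :=
    ContDiffAt.sum fun i _ => D.contDiffAt_comps_piece ρ hc hε i he hy a b
  refine h2.congr_of_eventuallyEq ?_
  filter_upwards [hV.mem_nhds (hyV rfl)] with z hz
  rw [D.comps_regTensor ρ h ε (hI z hz), Matrix.sum_apply]

theorem tensorSmooth_regTensor (ρ : Mollifier n) {h : Tensor02 n M} (hc : TensorContinuous h)
    {ε : ℝ} (hε : 0 < ε) : TensorSmooth (D.regTensor ρ h ε) := fun _ he a b _ hy =>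
  (D.contDiffAt_comps_regTensor ρ hc hε he hy a b).contDiffWithinAt

end RegData

end RegConv


/-! ### Positivity of the regularised metric -/

section Positivity

variable {n : ℕ} {M : Type*} [TopologicalSpace M] [ChartedSpace (Eu n) M]
  {e : OpenPartialHomeomorph M (Eu n)}

/-- `A` is the differential of the chart, injective because that of the inverse chart undoes it.
Symmetry and positivity at a point thereby become properties of the component matrix. -/
theorem exists_tensor_eq_sum (he : e ∈ IsManifold.maximalAtlas (𝓡 n) ∞ M) (h : Tensor02 n M) {x : M}
    (hx : x ∈ e.source) :
    ∃ A : TangentSpace (𝓡 n) x → Eu n, (∀ v, A v = 0 → v = 0) ∧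
      ∀ v w, h x v w = ∑ a, ∑ b, A v a * A w b * comps e h (e x) a b := by
  refine ⟨fun v => mfderiv (𝓡 n) 𝓘(ℝ, Eu n) e x v, fun v hv => ?_, fun v w => ?_⟩
  · have h1 := mfderiv_symm_mfderiv he hx v
    exact h1.symm.trans ((congrArg (mfderiv 𝓘(ℝ, Eu n) (𝓡 n) e.symm (e x)) hv).trans (map_zero _))
  · have h1 : chartRep e h (e x) (mfderiv (𝓡 n) 𝓘(ℝ, Eu n) e x v) (mfderiv (𝓡 n) 𝓘(ℝ, Eu n) e x w) =
        h x v w :=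
      (congrArg₂ (fun u u' : Eu n => (h (e.symm (e x)) : Eu n →L[ℝ] Eu n →L[ℝ] ℝ) u u')
        (mfderiv_symm_mfderiv he hx v) (mfderiv_symm_mfderiv he hx w)).trans
      (tensor_apply_congr h (e.left_inv hx) _ _)
    exact h1.symm.trans (bilin_eq_sum _ _ _)

theorem tensor_symm_of_comps (he : e ∈ IsManifold.maximalAtlas (𝓡 n) ∞ M) {h : Tensor02 n M}
    {x : M} (hx : x ∈ e.source) (hs : (comps e h (e x)).IsSymm) (v w : TangentSpace (𝓡 n) x) :
    h x v w = h x w v := by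
  obtain ⟨A, -, hA⟩ := exists_tensor_eq_sum he h hx
  rw [hA v w, hA w v, Finset.sum_comm]
  refine Finset.sum_congr rfl fun a _ => Finset.sum_congr rfl fun b _ => ?_
  rw [hs.apply a b]
  ring

theorem isRiemannianAt_of_comps (he : e ∈ IsManifold.maximalAtlas (𝓡 n) ∞ M) {h : Tensor02 n M}
    {x : M} (hx : x ∈ e.source) (hs : (comps e h (e x)).IsSymm)
    (hpos : ∀ u : Eu n, u ≠ 0 → 0 < ∑ a, ∑ b, u a * u b * comps e h (e x) a b) :
    IsRiemannianAt h x := by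
  refine ⟨tensor_symm_of_comps he hx hs, fun v hv => ?_⟩
  obtain ⟨A, hA0, hA⟩ := exists_tensor_eq_sum he h hx
  rw [hA v v]
  exact hpos _ fun h0 => hv (hA0 v h0)

theorem comps_quad_pos (he : e ∈ IsManifold.maximalAtlas (𝓡 n) ∞ M) {h : Tensor02 n M} {y : Eu n}
    (hy : y ∈ e.target) (hh : IsRiemannianAt h (e.symm y)) {u : Eu n} (hu : u ≠ 0) :
    0 < ∑ a, ∑ b, u a * u b * comps e h y a b := by
  have h1 := bilin_eq_sum (chartRep e h y) u u
  refine lt_of_lt_of_eq ?_ h1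
  exact hh.2 _ (mfderiv_symm_ne_zero he hy hu)

/-- A nonzero kernel vector would be null for a definite form. -/
theorem comps_det_ne_zero (he : e ∈ IsManifold.maximalAtlas (𝓡 n) ∞ M) {h : Tensor02 n M} {y : Eu n}
    (hy : y ∈ e.target) (hh : IsRiemannianAt h (e.symm y)) : (comps e h y).det ≠ 0 := by
  intro h0
  obtain ⟨v, hv, hv0⟩ := Matrix.exists_mulVec_eq_zero_iff.mpr h0
  have h1 : (WithLp.toLp 2 v : Eu n) ≠ 0 := fun h => hv (by
    have := congrArg (fun w : Eu n => w.ofLp) h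
    simpa using this)
  have h2 := comps_quad_pos he hy hh h1
  have h3 : ∑ a, ∑ b, v a * v b * comps e h y a b = ∑ a, v a * (comps e h y).mulVec v a := by
    simp only [Matrix.mulVec, dotProduct, Finset.mul_sum]
    exact Finset.sum_congr rfl fun a _ => Finset.sum_congr rfl fun b _ => by ring
  have h4 : ∑ a, ∑ b, v a * v b * comps e h y a b = 0 := by
    rw [h3, hv0]; simp
  exact h2.ne' h4

/-- A uniformly convergent family of matrices is positive definite if the limit is. -/
theorem eventually_quad_pos {K : Set (Eu n)} (hK : IsCompact K)
    {H : ℝ → Eu n → Matrix (Fin n) (Fin n) ℝ} {G : Eu n → Matrix (Fin n) (Fin n) ℝ}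
    (hG : ∀ a b, ContinuousOn (fun y => G y a b) K)
    (hH : ∀ a b, TendstoUniformlyOn (fun ε y => H ε y a b) (fun y => G y a b) (𝓝[>] (0 : ℝ)) K)
    (hpos : ∀ y ∈ K, ∀ u : Eu n, u ≠ 0 → 0 < ∑ a, ∑ b, u a * u b * G y a b) :
    ∀ᶠ ε in 𝓝[>] (0 : ℝ), ∀ y ∈ K, ∀ u : Eu n, u ≠ 0 →
      0 < ∑ a, ∑ b, u a * u b * H ε y a b := by
  have hS : IsCompact (K ×ˢ Metric.sphere (0 : Eu n) 1) := hK.prod (isCompact_sphere _ _)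
  have hq : ContinuousOn (fun x : Eu n × Eu n => ∑ a, ∑ b, x.2 a * x.2 b * G x.1 a b)
      (K ×ˢ Metric.sphere (0 : Eu n) 1) := by
    refine continuousOn_finsetSum _ fun a _ => continuousOn_finsetSum _ fun b _ => ?_
    refine ContinuousOn.mul (Continuous.continuousOn ?_)
      ((hG a b).comp continuousOn_fst fun x hx => hx.1)
    fun_prop
  obtain ⟨m, hm, hmin⟩ := hS.exists_forall_le' hq (a := 0) (fun x hx => hpos x.1 hx.1 x.2 fun h0 => by
    have := hx.2
    rw [h0] at this
    simp at this)
  -- Coordinates of a unit vector are at most `1` in absolute value, so changing each of the `n²`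
  -- components by `δ` moves the form by at most `n² δ < m`. The `+ 1` makes this strict and covers
  -- `n = 0`.
  set δ : ℝ := m / ((n : ℝ) ^ 2 + 1) with hδ
  have hδ0 : 0 < δ := by positivity
  have hev : ∀ᶠ ε in 𝓝[>] (0 : ℝ), ∀ a b, ∀ y ∈ K, dist (G y a b) (H ε y a b) < δ :=
    eventually_all.mpr fun a => eventually_all.mpr fun b =>
      Metric.tendstoUniformlyOn_iff.mp (hH a b) δ hδ0
  filter_upwards [hev] with ε hε y hy u hu
  have hn : 0 < ‖u‖ := norm_pos_iff.mpr hu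
  set w : Eu n := ‖u‖⁻¹ • u with hw
  have hw1 : ‖w‖ = 1 := by rw [hw, norm_smul, norm_inv, norm_norm, inv_mul_cancel₀ hn.ne']
  have hwm := hmin (y, w) ⟨hy, by simp [hw1]⟩
  have hwH : 0 < ∑ a, ∑ b, w a * w b * H ε y a b := by
    have h1 : |∑ a, ∑ b, w a * w b * (G y a b - H ε y a b)| ≤ (n : ℝ) ^ 2 * δ := by
      calc |∑ a, ∑ b, w a * w b * (G y a b - H ε y a b)|
          ≤ ∑ a : Fin n, ∑ b : Fin n, δ := by
            refine (Finset.abs_sum_le_sum_abs _ _).trans (Finset.sum_le_sum fun a _ =>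
              (Finset.abs_sum_le_sum_abs _ _).trans (Finset.sum_le_sum fun b _ => ?_))
            rw [abs_mul, abs_mul]
            have ha := (abs_apply_le_norm w a).trans hw1.le
            have hb := (abs_apply_le_norm w b).trans hw1.le
            have hd : |G y a b - H ε y a b| ≤ δ := (hε a b y hy).le
            calc |w a| * |w b| * |G y a b - H ε y a b| ≤ 1 * 1 * δ := by gcongr
              _ = δ := by ring
        _ = (n : ℝ) ^ 2 * δ := by simp; ring
    have h2 : ∑ a, ∑ b, w a * w b * (G y a b - H ε y a b) =
        ∑ a, ∑ b, w a * w b * G y a b - ∑ a, ∑ b, w a * w b * H ε y a b := by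
      simp only [mul_sub, Finset.sum_sub_distrib]
    have h3 : ((n : ℝ) ^ 2 + 1) * δ = m := by rw [hδ]; field_simp
    have h4 := (abs_le.mp h1).2
    rw [h2] at h4
    have h5 : m ≤ ∑ a, ∑ b, w a * w b * G y a b := hwm
    linarith
  have hscale : ∑ a, ∑ b, u a * u b * H ε y a b =
      ‖u‖ ^ 2 * ∑ a, ∑ b, w a * w b * H ε y a b := by
    simp only [Finset.mul_sum]
    refine Finset.sum_congr rfl fun a _ => Finset.sum_congr rfl fun b _ => ?_
    simp only [hw, PiLp.smul_apply, smul_eq_mul]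
    field_simp
  rw [hscale]
  positivity

namespace RegData

variable [IsManifold (𝓡 n) ∞ M] (D : RegData n M) {p : ℝ≥0∞}

theorem comps_piece_isSymm (ρ : Mollifier n) {h : Tensor02 n M} (hc : TensorContinuous h)
    (hs : ∀ x v w, h x v w = h x w v) {ε : ℝ} (hε : 0 < ε) (i : ℕ)
    (he : e ∈ IsManifold.maximalAtlas (𝓡 n) ∞ M) {y : Eu n} (hy : y ∈ e.target) :
    (comps e (D.piece ρ h ε i) y).IsSymm := by
  by_cases hyi : e.symm y ∈ (D.ψ i).source
  · rw [D.comps_piece ρ (hc _ (D.ψ_smooth i)) hε he ⟨hy, hyi⟩]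
    have hN : (D.convComp ρ h ε i (transition e (D.ψ i) y)).IsSymm := by
      ext a b
      change cv _ _ _ = cv _ _ _
      congr 1
      funext z
      rw [(comps_isSymm hs (D.ψ i) z).apply a b]
    rw [Matrix.IsSymm, Matrix.transpose_smul, Matrix.transpose_mul, Matrix.transpose_mul,
      Matrix.transpose_transpose, hN, Matrix.mul_assoc]
  · rw [D.comps_piece_of_χ_eq_zero ρ h ε (D.χ_eq_zero hyi)]
    exact Matrix.isSymm_zero

theorem comps_regTensor_isSymm (ρ : Mollifier n) {h : Tensor02 n M} (hc : TensorContinuous h)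
    (hs : ∀ x v w, h x v w = h x w v) {ε : ℝ} (hε : 0 < ε)
    (he : e ∈ IsManifold.maximalAtlas (𝓡 n) ∞ M) {y : Eu n} (hy : y ∈ e.target) :
    (comps e (D.regTensor ρ h ε) y).IsSymm := by
  obtain ⟨I, V, hV, hyV, hVe, hI⟩ := D.exists_finset (isCompact_singleton (x := y))
    (singleton_subset_iff.mpr hy)
  rw [D.comps_regTensor ρ h ε (hI y (hyV rfl)), Matrix.IsSymm, Matrix.transpose_sum]
  exact Finset.sum_congr rfl fun i _ => D.comps_piece_isSymm ρ hc hs hε i he hy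

theorem regTensor_symm (ρ : Mollifier n) {h : Tensor02 n M} (hc : TensorContinuous h)
    (hs : ∀ x v w, h x v w = h x w v) {ε : ℝ} (hε : 0 < ε) (x : M) (v w : TangentSpace (𝓡 n) x) :
    D.regTensor ρ h ε x v w = D.regTensor ρ h ε x w v := by
  have hx := mem_chart_source (Eu n) x
  have he := IsManifold.chart_mem_maximalAtlas (I := 𝓡 n) (n := ∞) x
  exact tensor_symm_of_comps he hx
    (D.comps_regTensor_isSymm ρ hc hs hε he ((chartAt (Eu n) x).map_source hx)) v w

theorem eventually_isRiemannianAt_chart (ρ : Mollifier n) (hp : 1 ≤ p) (hp' : p ≠ ⊤)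
    {h : Tensor02 n M} (hc : TensorContinuous h) (hh : TensorW1Loc p h)
    (hr : ∀ x, IsRiemannianAt h x) (he : e ∈ IsManifold.maximalAtlas (𝓡 n) ∞ M) {K : Set (Eu n)}
    (hK : IsCompact K) (hKe : K ⊆ e.target) :
    ∀ᶠ ε in 𝓝[>] (0 : ℝ), ∀ y ∈ K, IsRiemannianAt (D.regTensor ρ h ε) (e.symm y) := by
  choose v hv using fun a b => D.sobConv_regTensor ρ hp hp' hc hh he a b hK hKe
  have h1 := eventually_quad_pos hK (fun a b => (hc e he a b).mono hKe) (fun a b => (hv a b).unif)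
    fun y hy u hu => comps_quad_pos he (hKe hy) (hr _) hu
  filter_upwards [h1, eventually_pos] with ε h2 hε y hy
  have hy' := hKe hy
  refine isRiemannianAt_of_comps he (e.map_target hy') ?_ fun u hu => ?_
  · rw [e.right_inv hy']
    exact D.comps_regTensor_isSymm ρ hc (fun x v w => (hr x).1 v w) hε he hy'
  · rw [e.right_inv hy']
    exact h2 y hy u hu

/-- The property passes to subsets and finite unions, so compactness reduces it to a neighbourhood
of one point with compact closure inside a chart. -/
theorem eventually_isRiemannianAt (ρ : Mollifier n) (hp : 1 ≤ p) (hp' : p ≠ ⊤)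
    {h : Tensor02 n M} (hc : TensorContinuous h) (hh : TensorW1Loc p h)
    (hr : ∀ x, IsRiemannianAt h x) {K : Set M} (hK : IsCompact K) :
    ∀ᶠ ε in 𝓝[>] (0 : ℝ), ∀ x ∈ K, IsRiemannianAt (D.regTensor ρ h ε) x := by
  refine hK.induction_on (p := fun S : Set M =>
    ∀ᶠ ε in 𝓝[>] (0 : ℝ), ∀ x ∈ S, IsRiemannianAt (D.regTensor ρ h ε) x) ?_ ?_ ?_ ?_
  · exact Eventually.of_forall fun ε x hx => absurd hx (notMem_empty x)
  · intro s t hst ht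
    exact ht.mono fun ε hε x hx => hε x (hst hx)
  · intro s t hs ht
    filter_upwards [hs, ht] with ε h1 h2 x hx
    exact hx.elim (h1 x) (h2 x)
  · intro x _
    set e := chartAt (Eu n) x
    have hx : x ∈ e.source := mem_chart_source (Eu n) x
    have he := IsManifold.chart_mem_maximalAtlas (I := 𝓡 n) (n := ∞) x
    obtain ⟨L, hL, hxL, hLe⟩ := exists_compact_subset e.open_target (e.map_source hx)
    refine ⟨e.source ∩ e ⁻¹' interior L, mem_nhdsWithin_of_mem_nhds
      ((e.continuousOn.isOpen_inter_preimage e.open_source isOpen_interior).mem_nhds ⟨hx, hxL⟩), ?_⟩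
    filter_upwards [D.eventually_isRiemannianAt_chart ρ hp hp' hc hh hr he hL hLe] with ε hε z hz
    have := hε (e z) (interior_subset hz.2)
    rwa [e.left_inv hz.1] at this

end RegData

end Positivity


/-! ### Convergence of the scalar curvatures -/

section Convergence

variable {n : ℕ} {M : Type*} [TopologicalSpace M] [ChartedSpace (Eu n) M]
  {e : OpenPartialHomeomorph M (Eu n)} {p q : ℝ≥0∞}

theorem TendsLp.extend_zero {K C : Set (Eu n)} (hC : MeasurableSet C) (hK : MeasurableSet K)
    {F : ℝ → Eu n → ℝ} (h : TendsLp q (volume.restrict (K ∩ C)) F (fun _ => 0))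
    (h0 : ∀ᶠ ε in 𝓝[>] (0 : ℝ), ∀ y ∈ K, y ∉ C → F ε y = 0) :
    TendsLp q (volume.restrict K) F (fun _ => 0) := by
  have hind : TendsLp q (volume.restrict K) (fun ε => C.indicator (F ε)) (fun _ => 0) := by
    obtain ⟨h1, -, h3⟩ := h
    refine ⟨?_, MemLp.zero, ?_⟩
    · filter_upwards [h1] with ε hε
      rwa [memLp_indicator_iff_restrict hC, Measure.restrict_restrict hC, inter_comm]
    · refine h3.congr fun ε => ?_
      simp only [sub_zero]
      rw [eLpNorm_indicator_eq_eLpNorm_restrict hC, Measure.restrict_restrict hC, inter_comm]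
  refine hind.congr ?_ EventuallyEq.rfl
  filter_upwards [h0] with ε hε
  filter_upwards [ae_restrict_mem hK] with y hy
  by_cases hyC : y ∈ C
  · simp [hyC]
  · simp [hyC, hε y hy hyC]

theorem secOrd_congr {H T T' : Eu n → Matrix (Fin n) (Fin n) ℝ} {y : Eu n} (h : T =ᶠ[𝓝 y] T') :
    secOrd H T y = secOrd H T' y := by
  simp only [secOrd]
  refine Finset.sum_congr rfl fun k _ => Finset.sum_congr rfl fun j _ => Finset.sum_congr rfl
    fun a _ => Finset.sum_congr rfl fun b _ => ?_
  congr 1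
  refine pderiv_congr ?_ k
  filter_upwards [h.eventuallyEq_nhds] with z hz
  refine pderiv_congr ?_ j
  filter_upwards [hz] with w hw
  rw [hw]

/-- Curvature differentiates the inverse metric, so nondegeneracy is required on an open set `W` and
not just at `y`. -/
theorem coordScal_comps_transition {h : Tensor02 n M} (hs : ∀ x v w, h x v w = h x w v)
    {e' : OpenPartialHomeomorph M (Eu n)} (he : e ∈ IsManifold.maximalAtlas (𝓡 n) ∞ M)
    (he' : e' ∈ IsManifold.maximalAtlas (𝓡 n) ∞ M)
    (hsm : ∀ z ∈ e'.target, ∀ a b, ContDiffAt ℝ ∞ (fun z => comps e' h z a b) z)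
    {W : Set (Eu n)} (hW : IsOpen W) (hr : ∀ z ∈ W, IsRiemannianAt h (e.symm z)) {y : Eu n}
    (hyW : y ∈ W) (hy : y ∈ overlap e e') :
    coordScal (comps e h) y = coordScal (comps e' h) (transition e e' y) := by
  refine coordScal_transform (φ := transition e e') (hW.inter (isOpen_overlap e e'))
    (fun z hz => contDiffAt_transition he he' hz.2) (comps_isSymm hs e') (comps_isSymm hs e)
    (fun z hz => hsm _ (transition_mem hz.2).1) (fun z hz => comps_transition he he' h hz.2)
    (fun z hz => det_jac_transition he he' hz.2) (fun z hz => ?_) ⟨hyW, hy⟩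
  refine comps_det_ne_zero he' (transition_mem hz.2).1 ?_
  rw [symm_transition hz.2]
  exact hr z hz.1

namespace RegData

variable (D : RegData n M) (ρ : Mollifier n)

/-- The difference between the `i`-th summand of the regularisation and `ηᵢ` times the whole. -/
def defect (h : Tensor02 n M) (ε : ℝ) (i : ℕ) : Tensor02 n M := fun x =>
  D.piece ρ h ε i x - D.η i x • D.regTensor ρ h ε x

theorem comps_defect (h : Tensor02 n M) (ε : ℝ) (i : ℕ) (e : OpenPartialHomeomorph M (Eu n))
    (y : Eu n) (a b : Fin n) : comps e (D.defect ρ h ε i) y a b =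
      comps e (D.piece ρ h ε i) y a b - D.η i (e.symm y) * comps e (D.regTensor ρ h ε) y a b :=
  rfl

/-- The decisive cancellation: the summands add up to the regularised field, and so do its multiples
by `ηᵢ`, because `∑ ηᵢ = 1`. -/
theorem sum_comps_defect (h : Tensor02 n M) (ε : ℝ) {I : Finset ℕ} {y : Eu n}
    (hI : ∀ i ∉ I, e.symm y ∉ (D.ψ i).source) :
    ∑ i ∈ I, comps e (D.defect ρ h ε i) y = 0 := by
  ext a b
  have h1 := congrArg (fun A : Matrix (Fin n) (Fin n) ℝ => A a b) (D.comps_regTensor ρ h ε hI)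
  simp only [Matrix.sum_apply] at h1
  simp only [Matrix.sum_apply, comps_defect, Finset.sum_sub_distrib, ← Finset.sum_mul, D.sum_η hI,
    one_mul, ← h1, sub_self, Matrix.zero_apply]

/-- Where the cut-off `χᵢ` differs from `1`, the convolution and `ηᵢ` vanish. -/
theorem eventually_χ_eq_one_or (h : Tensor02 n M) (i : ℕ) :
    ∀ᶠ ε in 𝓝[>] (0 : ℝ), ∀ y ∈ (D.ψ i).target,
      (∀ᶠ z in 𝓝 y, D.χ i ((D.ψ i).symm z) = 1) ∨
      (∀ᶠ z in 𝓝 y, D.convComp ρ h ε i z = 0 ∧ D.cut i z = 0) := by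
  set Z := tsupport (D.cut i)
  have hZ : IsCompact Z := D.hasCompactSupport_cut i
  obtain ⟨V₀, hV₀, hηV, hV₀χ⟩ := mem_nhdsSet_iff_exists.mp (D.χ_eq_one i)
  set V := (D.ψ i).target ∩ (D.ψ i).symm ⁻¹' V₀
  have hV : IsOpen V := (D.ψ i).symm.continuousOn.isOpen_inter_preimage (D.ψ i).open_target hV₀
  have hZV : Z ⊆ V := by
    intro z hz
    obtain ⟨x, hx, rfl⟩ := tsupport_pushFun (D.η_compact i) (D.η_subordinate i) hz
    have hxs := D.η_subordinate i hx
    refine ⟨(D.ψ i).map_source hxs, ?_⟩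
    rw [mem_preimage, (D.ψ i).left_inv hxs]
    exact hηV hx
  -- Convolution at scale `ε ≤ δ` enlarges the support by at most `ε`. So it vanishes off the closed
  -- `δ`-neighbourhood of the support of `ηᵢ`, and this neighbourhood lies where `χᵢ = 1`.
  obtain ⟨δ, hδ, hδV⟩ := hZ.exists_cthickening_subset_open hV hZV
  filter_upwards [eventually_pos, eventually_le_pos hδ] with ε hε hεδ y hy
  by_cases hyV : y ∈ V
  · left
    filter_upwards [hV.mem_nhds hyV] with z hz
    exact hV₀χ hz.2
  · right
    have h1 : ∀ᶠ z in 𝓝 y, z ∉ Metric.cthickening δ Z :=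
      Metric.isClosed_cthickening.isOpen_compl.mem_nhds fun h => hyV (hδV h)
    filter_upwards [h1] with z hz
    have h2 : ∀ z' ∈ Z, ε < dist z z' := fun z' hz' => by
      by_contra! h3
      exact hz (Metric.mem_cthickening_of_dist_le z z' δ Z hz' (h3.trans hεδ))
    have h3 : ∀ z' ∉ Z, D.cut i z' = 0 := fun z' hz' => image_eq_zero_of_notMem_tsupport hz'
    refine ⟨?_, h3 z fun hzZ => hz (Metric.self_subset_cthickening _ hzZ)⟩
    ext a b
    exact cv_eq_zero_of_notMem (fun z' hz' => by rw [h3 z' hz', zero_mul])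
      (fun w hw => ρ.scaled_eq_zero hε hw) h2

theorem comps_defect_eventually_zero (h : Tensor02 n M) (ε : ℝ) {i : ℕ} {y : Eu n}
    (hy : y ∈ e.target) (hχ : e.symm y ∉ tsupport (D.χ i)) :
    comps e (D.defect ρ h ε i) =ᶠ[𝓝 y] fun _ => 0 := by
  filter_upwards [(e.symm.continuousAt hy).eventually
    ((isClosed_tsupport _).isOpen_compl.mem_nhds hχ)] with z hz
  have h0 : D.χ i (e.symm z) = 0 := image_eq_zero_of_notMem_tsupport hz
  ext a b
  rw [comps_defect, D.comps_piece_of_χ_eq_zero ρ h ε h0, ← D.χ_mul_η, h0]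
  simp

variable [IsManifold (𝓡 n) ∞ M]

theorem contDiffAt_comps_defect {h : Tensor02 n M} (hc : TensorContinuous h) {ε : ℝ} (hε : 0 < ε)
    (i : ℕ) (he : e ∈ IsManifold.maximalAtlas (𝓡 n) ∞ M) {y : Eu n} (hy : y ∈ e.target)
    (a b : Fin n) : ContDiffAt ℝ ∞ (fun z => comps e (D.defect ρ h ε i) z a b) y :=
  (D.contDiffAt_comps_piece ρ hc hε i he hy a b).sub
    ((contDiffAt_comp_symm he (D.η i).contMDiff hy).mul
      (D.contDiffAt_comps_regTensor ρ hc hε he hy a b))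

/-- The summand and `ηᵢ` times the regularised field have the same limit `ηᵢ h`. As the difference
tends to zero, whose weak derivatives are zero, so do its first derivatives. -/
theorem sobConv_defect (hp : 1 ≤ p) (hp' : p ≠ ⊤) {h : Tensor02 n M}
    (hc : TensorContinuous h) (hh : TensorW1Loc p h) (i : ℕ)
    (he : e ∈ IsManifold.maximalAtlas (𝓡 n) ∞ M) (a b : Fin n) {K : Set (Eu n)} (hK : IsCompact K)
    (hKe : K ⊆ e.target) :
    SobConv p K (fun ε y => comps e (D.defect ρ h ε i) y a b) (fun _ => 0) (fun _ _ => 0) := by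
  refine SobConv.of_weakD (U := e.target) e.open_target hp (fun K hK hKe => ?_)
    (fun _ => (locallyIntegrable_zero).locallyIntegrableOn _) (fun a φ _ _ _ => by simp) hK hKe
  obtain ⟨v, hv⟩ := D.sobConv_piece ρ hp hp' hc hh i he a b hK hKe
  obtain ⟨w, hw⟩ := D.sobConv_regTensor ρ hp hp' hc hh he a b hK hKe
  have h1 := hv.sub hp hK ((SobConv.const hK fun y hy =>
    contDiffAt_comp_symm he (D.η i).contMDiff (hKe hy)).mul hp hK hw)
  exact ⟨_, h1.congr_right hK fun y _ => sub_self _⟩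

/-- The error between the regularised curvature distribution and the curvature of the
regularisation, in the chart `ψᵢ` and after subtraction of the second order terms. -/
def chartError (h : Tensor02 n M) (ε : ℝ) (i : ℕ) (y : Eu n) : ℝ :=
  distScalM h (D.ψ i) (D.kernel ρ ε i y) - D.cut i y * coordScal (comps (D.ψ i) (D.regTensor ρ h ε)) y
    - secOrd (comps (D.ψ i) (D.regTensor ρ h ε)) (comps (D.ψ i) (D.defect ρ h ε i)) y

theorem comps_defect_self {h : Tensor02 n M} (hc : TensorContinuous h) {ε : ℝ} (hε : 0 < ε) {i : ℕ}
    {y : Eu n} (hy : y ∈ (D.ψ i).target) :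
    comps (D.ψ i) (D.defect ρ h ε i) y = D.χ i ((D.ψ i).symm y) • D.convComp ρ h ε i y -
      D.cut i y • comps (D.ψ i) (D.regTensor ρ h ε) y := by
  ext a b
  rw [comps_defect, D.comps_piece_self ρ (hc _ (D.ψ_smooth i)) hε hy]
  simp [cut, pushFun, hy]

/-- `tendsLp_chart` gives this with the convolution minus `ηᵢ` times the regularised metric in place
of the defect, where the convolution carries an extra factor `χᵢ`. Near each point either `χᵢ = 1`
or the convolution vanishes, so `secOrd` does not see the difference. -/
theorem tendsLp_chartError [ENNReal.HolderTriple p p q] (hp' : p ≠ ⊤) (hq : 1 ≤ q)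
    {h : Tensor02 n M} (hc : TensorContinuous h) (hh : TensorW1Loc p h)
    (hr : ∀ x, IsRiemannianAt h x) (i : ℕ) {L : Set (Eu n)} (hL : IsCompact L)
    (hLi : L ⊆ (D.ψ i).target) :
    TendsLp q (volume.restrict L) (fun ε => D.chartError ρ h ε i) (fun _ => 0) := by
  have hp : 1 ≤ p := hq.trans (holder_le p q)
  have hs : ∀ x v w, h x v w = h x w v := fun x => (hr x).1
  refine (tendsLp_chart (p := p) (q := q) (Ω := chartTarget (D.ψ i)) (G := comps (D.ψ i) h)
    (H := fun ε => comps (D.ψ i) (D.regTensor ρ h ε)) ρ hp' hq (comps_isSymm hs _)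
    (fun ε hε => comps_isSymm (D.regTensor_symm ρ hc hs hε) _)
    (D.sobConvOn_regTensor ρ hp hp' hc hh (D.ψ_smooth i))
    (fun y hy => comps_det_ne_zero (D.ψ_smooth i) hy (hr _)) (D.contDiff_cut i)
    (D.hasCompactSupport_cut i) (D.tsupport_cut_subset i) hL hLi
    (fun ε y => D.kernel ρ ε i y) (fun ε y z => rfl)).congr ?_ EventuallyEq.rfl
  filter_upwards [eventually_pos, D.eventually_χ_eq_one_or ρ h i] with ε hε h1
  filter_upwards [ae_restrict_mem hL.measurableSet] with y hy
  rw [chartError]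
  congr 1
  refine (secOrd_congr (T' := fun z => D.convComp ρ h ε i z -
    D.cut i z • comps (D.ψ i) (D.regTensor ρ h ε) z) ?_).symm
  have h2 := (D.ψ i).open_target.mem_nhds (hLi hy)
  rcases h1 y (hLi hy) with h3 | h3
  · filter_upwards [h2, h3] with z hz hz'
    rw [D.comps_defect_self ρ hc hε hz, hz', one_smul]
  · filter_upwards [h2, h3] with z hz hz'
    rw [D.comps_defect_self ρ hc hε hz, hz'.1, hz'.2]
    simp

end RegData

end Convergence


/-! ### Transport to one chart and summation over the cover. -/

section MainConvergence

variable {n : ℕ} {M : Type*} [TopologicalSpace M] [ChartedSpace (Eu n) M] [IsManifold (𝓡 n) ∞ M]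
  {e : OpenPartialHomeomorph M (Eu n)} {p q : ℝ≥0∞}

namespace RegData

variable (D : RegData n M) (ρ : Mollifier n)

/-- The `i`-th summand of the difference between the regularised curvature distribution and the
curvature of the regularisation, read in the chart `e`. -/
def summandError (e : OpenPartialHomeomorph M (Eu n)) (h : Tensor02 n M) (ε : ℝ) (i : ℕ)
    (y : Eu n) : ℝ :=
  D.χ i (e.symm y) * distScalM h (D.ψ i) (D.kernel ρ ε i (transition e (D.ψ i) y)) -
    D.η i (e.symm y) * coordScal (comps e (D.regTensor ρ h ε)) y -
    secOrd (comps e (D.regTensor ρ h ε)) (comps e (D.defect ρ h ε i)) y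

/-- Scalar curvature is invariant and `secOrd` is invariant up to `secRem`; the remaining terms
absorb the factor `χᵢ`, since `χᵢ ηᵢ = ηᵢ`. -/
theorem summandError_eq {h : Tensor02 n M} (hc : TensorContinuous h)
    (hs : ∀ x v w, h x v w = h x w v) (he : e ∈ IsManifold.maximalAtlas (𝓡 n) ∞ M) {ε : ℝ}
    (hε : 0 < ε) {i : ℕ} {W : Set (Eu n)} (hW : IsOpen W)
    (hr : ∀ z ∈ W, IsRiemannianAt (D.regTensor ρ h ε) (e.symm z))
    (hχ : ∀ y ∈ (D.ψ i).target, (∀ᶠ z in 𝓝 y, D.χ i ((D.ψ i).symm z) = 1) ∨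
      (∀ᶠ z in 𝓝 y, D.convComp ρ h ε i z = 0 ∧ D.cut i z = 0)) {y : Eu n} (hyW : y ∈ W)
    (hy : y ∈ overlap e (D.ψ i)) :
    D.summandError ρ e h ε i y =
      D.χ i (e.symm y) * D.chartError ρ h ε i (transition e (D.ψ i) y) -
      secRem (transition e (D.ψ i)) (comps e (D.regTensor ρ h ε))
        (comps (D.ψ i) (D.defect ρ h ε i)) y := by
  set φ := transition e (D.ψ i) with hφ
  have hi := D.ψ_smooth i
  have hφy : φ y ∈ (D.ψ i).target := (transition_mem hy).1
  have h1 : coordScal (comps e (D.regTensor ρ h ε)) y =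
      coordScal (comps (D.ψ i) (D.regTensor ρ h ε)) (φ y) :=
    coordScal_comps_transition (D.regTensor_symm ρ hc hs hε) he hi
      (fun z hz => D.contDiffAt_comps_regTensor ρ hc hε hi hz) hW hr hyW hy
  have h2 : secOrd (comps e (D.regTensor ρ h ε)) (comps e (D.defect ρ h ε i)) y =
      secOrd (comps (D.ψ i) (D.regTensor ρ h ε)) (comps (D.ψ i) (D.defect ρ h ε i)) (φ y) +
      secRem φ (comps e (D.regTensor ρ h ε)) (comps (D.ψ i) (D.defect ρ h ε i)) y := by
    refine secOrd_transform (contDiffAt_transition he hi hy)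
      (D.contDiffAt_comps_defect ρ hc hε i hi hφy) (det_jac_transition he hi hy)
      (comps_transition he hi _ hy) ?_
    filter_upwards [(isOpen_overlap e (D.ψ i)).mem_nhds hy] with z hz
    exact comps_transition he hi _ hz
  -- Either `χᵢ = 1` at the point, or the defect vanishes near it and both sides are zero.
  have h3 : D.χ i (e.symm y) *
      secOrd (comps (D.ψ i) (D.regTensor ρ h ε)) (comps (D.ψ i) (D.defect ρ h ε i)) (φ y) =
      secOrd (comps (D.ψ i) (D.regTensor ρ h ε)) (comps (D.ψ i) (D.defect ρ h ε i)) (φ y) := by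
    rcases hχ _ hφy with h4 | h4
    · have h5 := h4.self_of_nhds
      rw [hφ, symm_transition hy] at h5
      rw [h5, one_mul]
    · rw [secOrd_eq_zero, mul_zero]
      filter_upwards [h4, (D.ψ i).open_target.mem_nhds hφy] with z hz hz'
      rw [D.comps_defect_self ρ hc hε hz', hz.1, hz.2]
      simp
  have h6 : D.cut i (φ y) = D.η i (e.symm y) := pushFun_transition _ hy
  rw [summandError, chartError, h1, h2, h6, ← D.χ_mul_η i (e.symm y)]
  linear_combination h3 + (D.χ i (e.symm y) *
    coordScal (comps (D.ψ i) (D.regTensor ρ h ε)) (φ y)) * D.χ_mul_η i (e.symm y)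

/-- On the support of `χᵢ` this combines the transported chart error with `secRem`, which is small
because the defect tends to zero with its first derivatives. Off that support all terms vanish. -/
theorem tendsLp_summandError [ENNReal.HolderTriple p p q] (hp' : p ≠ ⊤) (hq : 1 ≤ q)
    {h : Tensor02 n M} (hc : TensorContinuous h) (hh : TensorW1Loc p h)
    (hr : ∀ x, IsRiemannianAt h x) (he : e ∈ IsManifold.maximalAtlas (𝓡 n) ∞ M) (i : ℕ)
    {K : Set (Eu n)} (hK : IsCompact K) (hKe : K ⊆ e.target) :
    TendsLp q (volume.restrict K) (fun ε => D.summandError ρ e h ε i) (fun _ => 0) := by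
  have hp : 1 ≤ p := hq.trans (holder_le p q)
  have hs : ∀ x v w, h x v w = h x w v := fun x => (hr x).1
  have hi := D.ψ_smooth i
  -- Invariance of the curvature needs positive definiteness on an open neighbourhood of `K`, hence
  -- the larger compact set.
  obtain ⟨K', hK', hKK', hK'e⟩ := exists_compact_between hK e.open_target hKe
  set φ := transition e (D.ψ i) with hφ
  set C := K ∩ e.symm ⁻¹' tsupport (D.χ i) with hCdef
  have hC : IsCompact C := by
    have h1 : IsClosed C := (e.symm.continuousOn.mono hKe).preimage_isClosed_of_isClosed hK.isClosed
      (isClosed_tsupport _)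
    exact hK.of_isClosed_subset h1 inter_subset_left
  have hCe : C ⊆ e.target := inter_subset_left.trans hKe
  have hCo : C ⊆ overlap e (D.ψ i) := fun y hy => ⟨hKe hy.1, D.χ_supp i hy.2⟩
  have hKC : K ∩ C = C := inter_eq_self_of_subset_right inter_subset_left
  refine TendsLp.extend_zero hC.measurableSet hK.measurableSet (C := C) ?_
    (Eventually.of_forall fun ε y hy hyC => ?_)
  · rw [hKC]
    have hφs : ∀ y ∈ C, ContDiffAt ℝ ∞ φ y := fun y hy => contDiffAt_transition he hi (hCo hy)
    have hinj : InjOn φ C := (injOn_transition e _).mono hCo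
    have hjac : ∀ y ∈ C, (jac φ y).det ≠ 0 := fun y hy => det_jac_transition he hi (hCo hy)
    have hL : IsCompact (φ '' C) := hC.image_of_continuousOn fun y hy =>
      (hφs y hy).continuousAt.continuousWithinAt
    have hLi : φ '' C ⊆ (D.ψ i).target := by
      rintro _ ⟨y, hy, rfl⟩
      exact (transition_mem (hCo hy)).1
    have hE := tendsLp_comp_diffeo hC hφs hinj
      (fun y hy => by
        rw [← det_jac ((hφs y hy).differentiableAt (by simp))]
        exact hjac y hy) (D.tendsLp_chartError ρ (p := p) hp' hq hc hh hr i hL hLi)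
    have hχ : TendsLp ∞ (volume.restrict C) (fun _ y => D.χ i (e.symm y))
        (fun y => D.χ i (e.symm y)) :=
      TendsLp.const (memLp_of_continuousOn hC (continuousOn_of_contDiffAt fun y hy =>
        contDiffAt_comp_symm he (D.χ_smooth i) (hCe hy)) _)
    have hdef := fun c d => D.sobConv_defect ρ hp hp' hc hh i hi c d hL hLi
    have hR := tendsLp_secRem (q := q) (p := p) hq (holder_le p q) hC hφs hinj hjac
      (H' := fun ε => comps e (D.regTensor ρ h ε))
      (T := fun ε => comps (D.ψ i) (D.defect ρ h ε i))
      (fun k j a b => (SobConvOn.bcoef (Ω := chartTarget e) hp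
        (D.sobConvOn_regTensor ρ hp hp' hc hh he)
        (fun y hy => comps_det_ne_zero he hy (hr _)) k j a b).tendsLp_top hC hCe)
      (fun c d => (hdef c d).tendsLp hp hL) (fun a c d => (hdef c d).deriv a)
    refine ((TendsLp.mul (p := ∞) (q := q) (r := q) hq hq hχ hE).sub hq hR).congr ?_
      (Eventually.of_forall fun y => by simp)
    filter_upwards [eventually_pos, D.eventually_χ_eq_one_or ρ h i,
      D.eventually_isRiemannianAt_chart ρ hp hp' hc hh hr he hK' hK'e] with ε hε h1 h2
    filter_upwards [ae_restrict_mem hC.measurableSet] with y hy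
    exact (D.summandError_eq ρ hc hs he hε isOpen_interior
      (fun z hz => h2 z (interior_subset hz)) h1 (hKK' hy.1) (hCo hy)).symm
  · have hχ0 : e.symm y ∉ tsupport (D.χ i) := fun h => hyC ⟨hy, h⟩
    have h0 : D.χ i (e.symm y) = 0 := image_eq_zero_of_notMem_tsupport hχ0
    rw [summandError, secOrd_eq_zero (D.comps_defect_eventually_zero ρ h ε (hKe hy) hχ0),
      ← D.χ_mul_η, h0]
    ring

/-- Here the second-order corrections disappear: read in one chart they sum to `secOrd` of the sum
of the defects, which vanishes near the point. The multiples of the curvature by `ηᵢ` add up to the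
curvature itself. -/
theorem regScalar_sub_scal {h : Tensor02 n M} (hc : TensorContinuous h)
    (hs : ∀ x v w, h x v w = h x w v) (he : e ∈ IsManifold.maximalAtlas (𝓡 n) ∞ M) {ε : ℝ}
    (hε : 0 < ε) {W : Set (Eu n)} (hW : IsOpen W) (hWe : W ⊆ e.target)
    (hr : ∀ z ∈ W, IsRiemannianAt (D.regTensor ρ h ε) (e.symm z)) {I : Finset ℕ}
    (hI : ∀ y ∈ W, ∀ i ∉ I, e.symm y ∉ (D.ψ i).source) {y : Eu n} (hy : y ∈ W) :
    D.regScalar ρ (distScalM h) ε (e.symm y) - scal (D.regTensor ρ h ε) (e.symm y) =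
      ∑ i ∈ I, D.summandError ρ e h ε i y := by
  have h1 : D.regScalar ρ (distScalM h) ε (e.symm y) =
      ∑ i ∈ I, D.χ i (e.symm y) *
        distScalM h (D.ψ i) (D.kernel ρ ε i (transition e (D.ψ i) y)) := by
    refine finsum_eq_sum_of_support_subset _ fun i hi => ?_
    by_contra hiI
    exact hi (by simp [D.χ_eq_zero (hI y hy i hiI)])
  have h2 : scal (D.regTensor ρ h ε) (e.symm y) = coordScal (comps e (D.regTensor ρ h ε)) y :=
    (coordScal_comps_transition (D.regTensor_symm ρ hc hs hε) he
      (IsManifold.chart_mem_maximalAtlas (I := 𝓡 n) (n := ∞) (e.symm y))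
      (fun z hz => D.contDiffAt_comps_regTensor ρ hc hε (IsManifold.chart_mem_maximalAtlas _) hz)
      hW hr hy ⟨hWe hy, mem_chart_source (Eu n) (e.symm y)⟩).symm
  have h3 : ∑ i ∈ I, secOrd (comps e (D.regTensor ρ h ε)) (comps e (D.defect ρ h ε i)) y = 0 := by
    rw [secOrd_sum I fun i _ => D.contDiffAt_comps_defect ρ hc hε i he (hWe hy)]
    refine secOrd_eq_zero ?_
    filter_upwards [hW.mem_nhds hy] with z hz
    exact D.sum_comps_defect ρ h ε (hI z hz)
  simp only [summandError, Finset.sum_sub_distrib, ← Finset.sum_mul]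
  rw [h1, h2, h3, D.sum_η (hI y hy), one_mul, sub_zero]

theorem tendstoZeroLpLoc_regScalar_sub_scal [ENNReal.HolderTriple p p q] (hp' : p ≠ ⊤) (hq : 1 ≤ q)
    {h : Tensor02 n M} (hc : TensorContinuous h) (hh : TensorW1Loc p h)
    (hr : ∀ x, IsRiemannianAt h x) :
    TendstoZeroLpLoc (n := n) q
      (fun ε x => D.regScalar ρ (distScalM h) ε x - scal (D.regTensor ρ h ε) x) := by
  intro e he K hK hKe
  have hp : 1 ≤ p := hq.trans (holder_le p q)
  obtain ⟨I, V, hV, hKV, hVe, hI⟩ := D.exists_finset hK hKe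
  obtain ⟨K', hK', hKK', hK'V⟩ := exists_compact_between hK hV hKV
  have h1 : TendsLp q (volume.restrict K) (fun ε y => ∑ i ∈ I, D.summandError ρ e h ε i y)
      (fun _ => ∑ i ∈ I, 0) :=
    TendsLp.sum hq I fun i _ => D.tendsLp_summandError ρ (p := p) hp' hq hc hh hr he i hK hKe
  have h2 : TendsLp q (volume.restrict K) (fun ε y =>
      D.regScalar ρ (distScalM h) ε (e.symm y) - scal (D.regTensor ρ h ε) (e.symm y))
      (fun _ => 0) := by
    refine h1.congr ?_ (Eventually.of_forall fun y => Finset.sum_const_zero)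
    filter_upwards [eventually_pos, D.eventually_isRiemannianAt_chart ρ hp hp' hc hh hr he hK'
      (hK'V.trans hVe)] with ε hε h3
    filter_upwards [ae_restrict_mem hK.measurableSet] with y hy
    exact (D.regScalar_sub_scal ρ hc (fun x => (hr x).1) he hε isOpen_interior
      ((interior_subset.trans hK'V).trans hVe) (fun z hz => h3 z (interior_subset hz))
      (fun z hz => hI z (hK'V (interior_subset hz))) (hKK' hy)).symm
  exact ⟨h2.1, by simpa using h2.2.2⟩

end RegData

end MainConvergence

end LowRegScal

end

/-! ### The theorem. -/

open LowRegScal in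
theorem mainTheorem4 {n : ℕ} {M : Type*} [TopologicalSpace M] [ChartedSpace (Eu n) M]
    [IsManifold (𝓡 n) ∞ M] [T2Space M] [SecondCountableTopology M]
    (g : ContinuousRiemannianMetric (Eu n) (fun x : M => TangentSpace (𝓡 n) x))
    (p : ℝ) (hp : 2 ≤ p) (hg : TensorW1Loc (ENNReal.ofReal p) (fun x : M => g.inner x))
    (D : RegData n M) (ρ : Mollifier n) :
    (∀ ε ∈ Ioc (0 : ℝ) 1, TensorSmooth (D.regTensor ρ g.inner ε)) ∧
    (∀ K : Set M, IsCompact K →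
      ∀ᶠ ε in 𝓝[>] (0 : ℝ), ∀ x ∈ K, IsRiemannianAt (D.regTensor ρ g.inner ε) x) ∧
    TendstoZeroLpLoc (n := n) (ENNReal.ofReal (p / 2))
      (fun ε x => D.regScalar ρ (distScalM g.inner) ε x - scal (D.regTensor ρ g.inner ε) x) := by
  have hp0 : 0 < p := by linarith
  have hc : TensorContinuous (n := n) (M := M) g.inner := fun e he a b => continuousOn_comps he g a b
  have hr : ∀ x : M, IsRiemannianAt (n := n) g.inner x := fun x => ⟨g.symm x, g.pos x⟩
  have hp1 : 1 ≤ ENNReal.ofReal p := by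
    rw [← ENNReal.ofReal_one]; exact ENNReal.ofReal_le_ofReal (by linarith)
  -- The assumption `p ≥ 2` enters here: it makes the exponent `p / 2` at least `1`, as the triangle
  -- and Minkowski inequalities demand.
  have hq1 : 1 ≤ ENNReal.ofReal (p / 2) := by
    rw [← ENNReal.ofReal_one]; exact ENNReal.ofReal_le_ofReal (by linarith)
  have hpq : ENNReal.HolderTriple (ENNReal.ofReal p) (ENNReal.ofReal p) (ENNReal.ofReal (p / 2)) := by
    refine ⟨?_⟩
    rw [← ENNReal.ofReal_inv_of_pos hp0, ← ENNReal.ofReal_inv_of_pos (by positivity),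
      ← ENNReal.ofReal_add (by positivity) (by positivity)]
    congr 1
    field_simp
    norm_num
  exact ⟨fun ε hε => D.tensorSmooth_regTensor ρ hc hε.1,
    fun K hK => D.eventually_isRiemannianAt ρ hp1 ENNReal.ofReal_ne_top hc hg hr hK,
    D.tendstoZeroLpLoc_regScalar_sub_scal ρ (p := ENNReal.ofReal p) ENNReal.ofReal_ne_top hq1 hc hg hr⟩
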